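/- Let $d\ge 1$, $A=\{0,\dots,d\}$, and let $(X,s_0)$ be an extended continued fraction algorithm: $X$ is a set of directions in $(\mathbb R_+^{d+1}\setminus\{0\})/\mathbb R_+^*$, each identified with its representative of $1$-norm one; $S$ is a finite set of non-erasing substitutions on $A$ whose abelianization matrices have determinant $\pm1$; and $s_0\colon X\to S$ is such that $F(x)=\operatorname{ab}(s_0(x))^{-1}x$ is a map $F\colon X\to X$. Put $s(x)=(s_0(F^n x))_{n\ge0}$ and $M_{[0,n)}(x)=\operatorname{ab}(s_0(x))\operatorname{ab}(s_0(Fx))\cdots\operatorname{ab}(s_0(F^{n-1}x))$. Let $\pi_x(z)=z-h(z)x$, with $h(z)=\sum_i z_i$, be the projection along $x$ onto $P=\{h=0\}$. A point $x\in X$ is a *seed point* if - its coordinates are linearly independent over $\mathbb Q$; - $F^n$ is continuous at $x$ for every $n\in\mathbb N$; - $\limsup_{n\to\infty}\frac1n\ln\|\pi_xM_{[0,n)}(x)\|_1<0$, where $\|\cdot\|_1$ is the operator norm for the $1$-norm; - there are a letter $a\in A$ and a sequence $(u_k)_{k\ge0}$ of infinite words over $A$ with $s_k(x)(u_{k+1})=u_k$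 for all $k$, such that the set $W_a(u_0)=\{\operatorname{ab}(p)\mid pa\text{ is a prefix of }u_0\}$ has non-empty interior in $\mathbb H=\{z\in\mathbb Z^{d+1}\mid h(z)\ge0\}$, for the topology whose open sets are the sets $\pi_x^{-1}(U)\cap\mathbb H$ with $U$ open in $P$. A point of $X$ is *algebraic* if the coordinates of its representative of $1$-norm one are algebraic; it is then described exactly by giving, for each coordinate, the primitive integer minimal polynomial with positive leading coefficient, and the rank of the coordinate among the real roots of this polynomial. An integer matrix $M$ is a *branch of $F^n$ at $x$* if every neighbourhood of $x$ in $X$ contains a point $y$ with $M_{[0,n)}(y)=M$. We say that $F$ is *computable* (as a piecewise projective map) if there are algorithms that compute, from the exact description of any algebraic point $x\in X$, the substitution $s_0(x)$ and the exact description of $F(x)$, and, given also $n\in\mathbb N$, the finite list of the branches of $F^n$ at $x$. **Proposition.** If $F$ is computable, then being a seed point is a decidable property for $F$-periodic points (points $x$ with $F^p(x)=x$ for some $p\ge1$). That is, every $F$-periodic point that is a seed point is algebraic, and there is an algorithm which, from the exact description of any algebraic $F$-periodic point $x\in X$, decides whether $x$ is a seed point. -/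

import Mathlib

open Filter Topology

/-- The alphabet `{0, …, d}`. -/
abbrev Letter (d : ℕ) : Type := Fin (d + 1)

/-- A non-erasing substitution on `{0, …, d}`, given by the images of the letters. -/
structure Subst (d : ℕ) where
  image : Letter d → List (Letter d)
  nonerasing : ∀ a, image a ≠ []

/-- Abelianization of a finite word. -/
def abWord {d : ℕ} (w : List (Letter d)) : Letter d → ℤ := fun i => (w.count i : ℤ)

/-- The prefix of length `n` of an infinite word. -/
def wordPrefix {d : ℕ} (u : ℕ → Letter d) (n : ℕ) : List (Letter d) :=
  (List.range n).map u

namespace Subst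

variable {d : ℕ}

/-- The substitution as an endomorphism of the free monoid of finite words. -/
def onWord (σ : Subst d) (w : List (Letter d)) : List (Letter d) := w.flatMap σ.image

/-- The matrix of a substitution: column `j` is the abelianization of the image of `j`. -/
def ab (σ : Subst d) : Matrix (Letter d) (Letter d) ℤ :=
  Matrix.of fun i j => abWord (σ.image j) i

def Unimodular (σ : Subst d) : Prop := |σ.ab.det| = 1

theorem length_le_onWord (σ : Subst d) (w : List (Letter d)) :
    w.length ≤ (σ.onWord w).length := by
  induction w with
  | nil => simp
  | cons a w ih =>
    have h : 0 < (σ.image a).length := List.length_pos_iff.mpr (σ.nonerasing a)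
    simp only [onWord, List.flatMap_cons, List.length_append, List.length_cons] at ih ⊢
    omega

/-- The action on infinite words: `σ(u)` is the limit of `σ(p)` over the prefixes `p` of `u`.
Its letter of index `n` is read off from the image of the prefix of length `n + 1`. -/
def onInfinite (σ : Subst d) (u : ℕ → Letter d) : ℕ → Letter d := fun n =>
  (σ.onWord (wordPrefix u (n + 1)))[n]'(by
    have h := σ.length_le_onWord (wordPrefix u (n + 1))
    have h' : (wordPrefix u (n + 1)).length = n + 1 := by simp [wordPrefix]
    omega)

end Subst

/-- The representative of norm one of the direction of a nonzero nonnegative vector. -/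
noncomputable def normalizeDir {d : ℕ} (y : Letter d → ℝ) : Letter d → ℝ := (∑ i, y i)⁻¹ • y

/-- `M⁻¹ y`, for an integer matrix `M` and a real vector `y`. -/
noncomputable def invMulVec {d : ℕ} (M : Matrix (Letter d) (Letter d) ℤ) (y : Letter d → ℝ) :
    Letter d → ℝ :=
  (M.map (Int.cast : ℤ → ℝ))⁻¹.mulVec y

/-- An extended continued fraction algorithm `(X, s₀)` in dimension `d`.  A direction in the
space of positive directions is identified with its representative of norm one, so that `X` is
a subset of the standard simplex.  The last field says that `ab(s₀(x))⁻¹ x` is again an element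
of `X`; the vector is nonzero because the matrix is invertible. -/
structure ExtendedCFA (d : ℕ) where
  X : Set (Letter d → ℝ)
  X_subset : X ⊆ stdSimplex ℝ (Letter d)
  S : Set (Subst d)
  S_finite : S.Finite
  S_unimodular : ∀ σ ∈ S, σ.Unimodular
  s₀ : X → Subst d
  s₀_mem : ∀ x, s₀ x ∈ S
  maps_to : ∀ x : X, (∀ i, 0 ≤ invMulVec (s₀ x).ab x i) ∧
    normalizeDir (invMulVec (s₀ x).ab x) ∈ X

/-- The hyperplane of `ℝ^{d+1}` of vectors whose coordinates sum to zero. -/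
def hyperplaneP (d : ℕ) : Set (Letter d → ℝ) := {y | ∑ i, y i = 0}

/-- The projection onto the hyperplane along `x`, where `x` has norm one. -/
def proj {d : ℕ} (x : stdSimplex ℝ (Letter d)) (z : Letter d → ℝ) : hyperplaneP d :=
  ⟨fun i => z i - (∑ j, z j) * x.1 i, by
    have hx : ∑ i, x.1 i = 1 := x.2.2
    simp [hyperplaneP, Finset.sum_sub_distrib, ← Finset.mul_sum, hx]⟩

/-- The integer half-space. -/
def HalfSpace (d : ℕ) : Type := {z : Letter d → ℤ // 0 ≤ ∑ i, z i}

/-- The topology on the integer half-space whose open sets are the preimages, under the projection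
along `x`, of the open subsets of the hyperplane. -/
@[reducible] def halfSpaceTopology {d : ℕ} (x : stdSimplex ℝ (Letter d)) : TopologicalSpace (HalfSpace d) :=
  TopologicalSpace.induced (fun z => proj x (fun i => (z.1 i : ℝ))) inferInstance

/-- The part `W_a(u) = {ab(p) ∣ p a is a prefix of u}` of the worm of `u`. -/
def worm {d : ℕ} (u : ℕ → Letter d) (a : Letter d) : Set (HalfSpace d) :=
  {z | ∃ n, u n = a ∧ z.1 = abWord (wordPrefix u n)}

/-- A fixed point of a directive sequence. -/
def IsFixedPoint {d : ℕ} (s : ℕ → Subst d) (u : ℕ → ℕ → Letter d) : Prop :=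
  ∀ k, (s k).onInfinite (u (k + 1)) = u k

noncomputable def norm1 {d : ℕ} (y : Letter d → ℝ) : ℝ := ∑ i, |y i|

/-- The operator norm, for the 1-norm, of the map `π_x ∘ M`. -/
noncomputable def projOpNorm {d : ℕ} (x : stdSimplex ℝ (Letter d))
    (M : Matrix (Letter d) (Letter d) ℤ) : ℝ :=
  ⨆ v : {v : Letter d → ℝ // v ≠ 0},
    norm1 (proj x ((M.map (Int.cast : ℤ → ℝ)).mulVec v.1)).1 / norm1 v.1

/-- `c = (coefficients, k)` is the code of the real algebraic number `t`: the list holds the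
coefficients, from degree zero up, of the primitive minimal polynomial of `t` over `ℤ` with positive
leading coefficient, and exactly `k` real roots of this polynomial are smaller than `t`. -/
def IsAlgCode (c : List ℤ × ℕ) (t : ℝ) : Prop :=
  ∃ P : Polynomial ℤ, Irreducible P ∧ 0 < P.leadingCoeff ∧ Polynomial.aeval t P = 0 ∧
    c.1 = (List.range (P.natDegree + 1)).map P.coeff ∧
    c.2 = Set.ncard {r : ℝ | r < t ∧ Polynomial.aeval r P = 0}

/-- Codes of directions whose normalized representative has algebraic coordinates. -/
abbrev PointCode (d : ℕ) : Type := Letter d → List ℤ × ℕ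

def IsPointCode {d : ℕ} (c : PointCode d) (x : Letter d → ℝ) : Prop :=
  ∀ i, IsAlgCode (c i) (x i)

namespace ExtendedCFA

variable {d : ℕ} (K : ExtendedCFA d)

/-- The map `F : X → X`, `F(x) = ab(s₀(x))⁻¹ x`. -/
noncomputable def F (x : K.X) : K.X :=
  ⟨normalizeDir (invMulVec (K.s₀ x).ab x), (K.maps_to x).2⟩

def toSimplex (x : K.X) : stdSimplex ℝ (Letter d) := ⟨x.1, K.X_subset x.2⟩

/-- The directive sequence `s(x)`. -/
noncomputable def directive (x : K.X) : ℕ → Subst d := fun n => K.s₀ (K.F^[n] x)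

/-- The product `M_0(x) M_1(x) ⋯ M_{n-1}(x)`. -/
noncomputable def matProd (x : K.X) : ℕ → Matrix (Letter d) (Letter d) ℤ
  | 0 => 1
  | n + 1 => matProd x n * (K.directive x n).ab

/-- Seed points. -/
def IsSeed (x : K.X) : Prop :=
  LinearIndependent ℚ (fun i => x.1 i) ∧
  (∀ n : ℕ, ContinuousAt (K.F^[n]) x) ∧
  limsup (fun n : ℕ =>
    (((1 / (n : ℝ)) * Real.log (projOpNorm (K.toSimplex x) (K.matProd x n)) : ℝ) : EReal))
    atTop < 0 ∧
  ∃ (a : Letter d) (u : ℕ → ℕ → Letter d), IsFixedPoint (K.directive x) u ∧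
    (@interior _ (halfSpaceTopology (K.toSimplex x)) (worm (u 0) a)).Nonempty

/-- `F`-periodic points. -/
def IsPeriodic (x : K.X) : Prop := ∃ p : ℕ, 1 ≤ p ∧ K.F^[p] x = x

/-- On the set of `y ∈ X` with `M_{[0,n)}(y) = M`, the map `F^n` is `y ↦ M⁻¹ y`.  The matrix `M` is
a branch of `F^n` at `x` if this set meets every neighbourhood of `x` in `X`. -/
def IsBranch (n : ℕ) (x : K.X) (M : Matrix (Letter d) (Letter d) ℤ) : Prop :=
  x ∈ closure {y : K.X | K.matProd y n = M}

/-- The algorithm is computable, as a piecewise projective map: from an exact description of a point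
`x ∈ X` with algebraic coordinates one can compute the substitution `s₀(x)` and the point `F(x)`
and, for every `n`, the finite list of the branches of `F^n` at `x`. -/
def IsComputable : Prop :=
  (∃ f : PointCode d →. (Letter d → List (Letter d)) × PointCode d, Partrec f ∧
    ∀ (x : K.X) (c : PointCode d), IsPointCode c x.1 →
      ∃ r ∈ f c, r.1 = (K.s₀ x).image ∧ IsPointCode r.2 (K.F x).1) ∧
  (∃ b : PointCode d × ℕ →. List (Letter d → Letter d → ℤ), Partrec b ∧
    ∀ (x : K.X) (c : PointCode d) (n : ℕ), IsPointCode c x.1 →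
      ∃ L ∈ b (c, n), ∀ M : Letter d → Letter d → ℤ,
        M ∈ L ↔ K.IsBranch n x (Matrix.of M))

end ExtendedCFA

/-! Let `F^p x = x`, let `M` be the product of the `p` matrices along the orbit and `g` the
composition of the `p` substitutions. Then `M x = lam • x`, and everything about `x` can be read
from the integer data `M`, `g` and the branches of the iterates. By `isSeed_iff`, `x` is a seed
point exactly when three conditions hold: `F, …, F^p` are continuous at `x`; `π_x M^n` tends to zero
(`Contracts`); and any two segments of broken lines that overlap in height acquire a common segment
after enough iterations of `g` (`AllCoincide`). Height is measured by the left eigenvector `f` with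
`f x = 1`. Rational independence comes for free: an integer relation, multiplied by `M^n`, gives
integers tending to zero.

The equivalence with interior is geometric. If the worm contains all integer points near some `z`, a
point chosen at a common height of two overlapping segments is pushed by `M^n` so close to `z` after
projection that both images must contain the same segment (`allCoincide_of_interior`). Conversely,
only finitely many relative positions of segments matter near a given point; `sync` makes all those
meeting a suitable window of heights share one segment, which therefore occurs at every nearby
integer point (`interior_of_allCoincide`). Coincidence does not mention the fixed point of the
directive sequence, so one choice of it is as good as another.

Contraction and coincidence are decided by unbounded search for finite integer certificates, one
kind for each answer. Contraction is certified by nearly proportional columns of powers of `M`, and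
refuted by `det (M - 1) = 0`, by an invariant bilinear form (an eigenvalue of modulus one, for `2 ≤
d`), or by a gap between `(tr M^n)^2` and `tr M^(2n)` (an eigenvalue outside the disc); see
`not_contracts_iff`. Failure of coincidence is certified by a finite set of overlaps closed under
descent and free of coincidences, success by treating all offsets in a computable box that absorbs
every overlap. Signs of heights are certified too, since `f z > 0` exactly when `M^n z` is positive
for some `n`. No real number is ever approximated.

Continuity of `F^n` at `x` means that all its branches agree there (`continuousAt_iterate_iff`).
Under contraction this becomes commutation of integer matrices, because `x` is, up to scaling, the
only eigenvector that an integer matrix commuting with `M` has to preserve and no nonzero integer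
matrix kills `x`. The period is found by following the orbit until the code of `x` returns: codes
determine algebraic numbers and conversely. Finally, a periodic seed point is algebraic because
`lam` is, and contraction makes any eigenvector for `lam` with algebraic entries proportional to
`x`. -/

/-! ### Words, broken lines and fixed points of directive sequences -/

section Words

variable {d : ℕ}

/-- The matrix of the morphism given by the images of the letters. -/
def morphMatrix (g : Letter d → List (Letter d)) : Matrix (Letter d) (Letter d) ℤ :=
  Matrix.of fun i j => abWord (g j) i

/-- The iterates of a morphism, as images of letters. -/
def morphPow (g : Letter d → List (Letter d)) : ℕ → Letter d → List (Letter d)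
  | 0, b => [b]
  | n + 1, b => (morphPow g n b).flatMap g

/-- The segments of the broken line of a word: the abelianizations of the prefixes, each with the
letter that follows. -/
def segs (w : List (Letter d)) : List ((Letter d → ℤ) × Letter d) :=
  (List.range w.length).map fun i => (abWord (w.take i), w.getD i 0)

theorem abWord_nil : abWord ([] : List (Letter d)) = 0 := by
  ext i; simp [abWord]

theorem abWord_append (w w' : List (Letter d)) : abWord (w ++ w') = abWord w + abWord w' := by
  ext i; simp [abWord]

theorem abWord_singleton (b : Letter d) : abWord [b] = Pi.single b 1 := by
  ext i
  by_cases h : i = b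
  · subst h; simp [abWord]
  · simp [abWord, h, Ne.symm h]

theorem abWord_cons (b : Letter d) (w : List (Letter d)) :
    abWord (b :: w) = Pi.single b 1 + abWord w := by
  rw [← abWord_singleton, ← abWord_append]; rfl

theorem abWord_nonneg (w : List (Letter d)) (i : Letter d) : 0 ≤ abWord w i := by
  simp [abWord]

theorem sum_abWord (w : List (Letter d)) : ∑ i, abWord w i = w.length := by
  induction w with
  | nil => simp [abWord_nil]
  | cons b w ih => simp [abWord_cons, Finset.sum_add_distrib, ih, add_comm]

theorem mem_segs {w : List (Letter d)} {v : Letter d → ℤ} {c : Letter d} :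
    (v, c) ∈ segs w ↔ ∃ p s, w = p ++ c :: s ∧ v = abWord p := by
  simp only [segs, List.mem_map, List.mem_range, Prod.mk.injEq]
  constructor
  · rintro ⟨i, hi, rfl, rfl⟩
    refine ⟨w.take i, w.drop (i + 1), ?_, rfl⟩
    rw [List.getD_eq_getElem _ _ hi, List.getElem_cons_drop, List.take_append_drop]
  · rintro ⟨p, s, rfl, rfl⟩
    exact ⟨p.length, by simp, by simp, by simp⟩

theorem segs_append {w w' : List (Letter d)} {v : Letter d → ℤ} {c : Letter d} :
    (v, c) ∈ segs (w ++ w') ↔ (v, c) ∈ segs w ∨ (v - abWord w, c) ∈ segs w' := by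
  simp only [mem_segs]
  constructor
  · rintro ⟨p, s, h, rfl⟩
    rcases List.append_eq_append_iff.mp h with ⟨a, rfl, h2⟩ | ⟨a, rfl, h2⟩
    · exact Or.inr ⟨a, s, h2, by simp [abWord_append]⟩
    · cases a with
      | nil =>
        refine Or.inr ⟨[], s, by simpa using h2.symm, by simp [abWord_nil]⟩
      | cons b a =>
        simp only [List.cons_append, List.cons.injEq] at h2
        exact Or.inl ⟨p, a, by rw [h2.1], rfl⟩
  · rintro (⟨p, s, rfl, rfl⟩ | ⟨p, s, rfl, h⟩)
    · exact ⟨p, s ++ w', by simp, rfl⟩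
    · exact ⟨w ++ p, s, by simp, by rw [abWord_append, ← h]; simp⟩

theorem segs_singleton {b c : Letter d} {v : Letter d → ℤ} :
    (v, c) ∈ segs [b] ↔ v = 0 ∧ c = b := by
  simp [segs, abWord_nil, Prod.ext_iff]

theorem abWord_flatMap (g : Letter d → List (Letter d)) (w : List (Letter d)) :
    abWord (w.flatMap g) = (morphMatrix g).mulVec (abWord w) := by
  induction w with
  | nil => simp [abWord_nil]
  | cons b w ih =>
    rw [List.flatMap_cons, abWord_append, abWord_cons, Matrix.mulVec_add, ih]
    congr 1
    ext i
    simp [morphMatrix]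

/-- The letter `c₁` at position `v₁` is replaced by the broken line of `g c₁` starting at `M v₁`.
This is the geometric form of a substitution, used throughout in place of words. -/
theorem segs_flatMap {g : Letter d → List (Letter d)} {w : List (Letter d)} {v : Letter d → ℤ}
    {c : Letter d} : (v, c) ∈ segs (w.flatMap g) ↔ ∃ v₁ c₁ u, (v₁, c₁) ∈ segs w ∧
      (u, c) ∈ segs (g c₁) ∧ v = (morphMatrix g).mulVec v₁ + u := by
  induction w using List.reverseRecOn with
  | nil => simp [segs]
  | append_singleton w b ih =>
    rw [List.flatMap_append, segs_append, ih, List.flatMap_singleton]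
    constructor
    · rintro (⟨v₁, c₁, u, h1, h2, h3⟩ | h)
      · exact ⟨v₁, c₁, u, segs_append.2 (Or.inl h1), h2, h3⟩
      · refine ⟨abWord w, b, _, segs_append.2 (Or.inr ?_), h, ?_⟩
        · simp [segs_singleton]
        · rw [abWord_flatMap]; simp
    · rintro ⟨v₁, c₁, u, h1, h2, h3⟩
      rcases segs_append.1 h1 with h1 | h1
      · exact Or.inl ⟨v₁, c₁, u, h1, h2, h3⟩
      · obtain ⟨h4, rfl⟩ := segs_singleton.1 h1
        refine Or.inr ?_
        rw [h3, abWord_flatMap, sub_eq_zero.1 h4]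
        simpa using h2

theorem flatMap_morphPow (g : Letter d → List (Letter d)) (n : ℕ) (w : List (Letter d)) :
    (w.flatMap (morphPow g n)).flatMap g = w.flatMap (morphPow g (n + 1)) := by
  rw [List.flatMap_assoc]; rfl

theorem morphPow_add (g : Letter d → List (Letter d)) (m n : ℕ) (b : Letter d) :
    morphPow g (m + n) b = (morphPow g m b).flatMap (morphPow g n) := by
  induction n with
  | zero =>
    show morphPow g m b = (morphPow g m b).flatMap (fun b => [b])
    simp
  | succ n ih => rw [← add_assoc, ← flatMap_morphPow, ← ih]; rfl

theorem morphMatrix_morphPow (g : Letter d → List (Letter d)) (n : ℕ) :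
    morphMatrix (morphPow g n) = morphMatrix g ^ n := by
  induction n with
  | zero =>
    ext i j
    simp [morphMatrix, morphPow, abWord_singleton, Matrix.one_apply, Pi.single_apply]
  | succ n ih =>
    rw [pow_succ', ← ih]
    ext i j
    simp only [morphMatrix, morphPow, Matrix.of_apply, Matrix.mul_apply]
    rw [abWord_flatMap]
    simp [Matrix.mulVec, dotProduct, morphMatrix]

theorem abWord_morphPow (g : Letter d → List (Letter d)) (n : ℕ) (b : Letter d) :
    abWord (morphPow g n b) = (morphMatrix g ^ n).mulVec (Pi.single b 1) := by
  rw [← morphMatrix_morphPow]; ext i; simp [morphMatrix]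

theorem segs_morphPow_add {g : Letter d → List (Letter d)} {m n : ℕ} {b c : Letter d}
    {v : Letter d → ℤ} : (v, c) ∈ segs (morphPow g (m + n) b) ↔
      ∃ v₁ c₁ u, (v₁, c₁) ∈ segs (morphPow g m b) ∧ (u, c) ∈ segs (morphPow g n c₁) ∧
        v = (morphMatrix g ^ n).mulVec v₁ + u := by
  rw [morphPow_add, segs_flatMap, morphMatrix_morphPow]

theorem morphPow_one (g : Letter d → List (Letter d)) : morphPow g 1 = g := by
  ext b : 1; simp [morphPow]

theorem morphPow_ne_nil {g : Letter d → List (Letter d)} (hg : ∀ b, g b ≠ []) (n : ℕ)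
    (b : Letter d) : morphPow g n b ≠ [] := by
  induction n with
  | zero => simp [morphPow]
  | succ n ih =>
    obtain ⟨c, hc⟩ := List.exists_mem_of_ne_nil _ ih
    intro h
    simp only [morphPow, List.flatMap_eq_nil_iff] at h
    exact hg c (h c hc)

theorem length_le_length_flatMap {g : Letter d → List (Letter d)} (hg : ∀ b, g b ≠ [])
    (w : List (Letter d)) : w.length ≤ (w.flatMap g).length := by
  induction w with
  | nil => simp
  | cons b w ih =>
    have := List.length_pos_iff.2 (hg b)
    simp only [List.flatMap_cons, List.length_append, List.length_cons]
    omega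

/-- The segments of the broken line of an infinite word. -/
def InfSeg (U : ℕ → Letter d) (v : Letter d → ℤ) (c : Letter d) : Prop :=
  ∃ m, U m = c ∧ v = abWord (wordPrefix U m)

/-- `U'` is the image of `U` under the morphism `g`. -/
def IsImage (g : Letter d → List (Letter d)) (U U' : ℕ → Letter d) : Prop :=
  ∀ m, ∃ k, (wordPrefix U m).flatMap g = wordPrefix U' k

theorem wordPrefix_succ (U : ℕ → Letter d) (m : ℕ) :
    wordPrefix U (m + 1) = wordPrefix U m ++ [U m] := by
  simp [wordPrefix, List.range_succ]

theorem wordPrefix_length (U : ℕ → Letter d) (m : ℕ) : (wordPrefix U m).length = m := by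
  simp [wordPrefix]

theorem wordPrefix_take (U : ℕ → Letter d) {m k : ℕ} (h : m ≤ k) :
    (wordPrefix U k).take m = wordPrefix U m := by
  simp [wordPrefix, ← List.map_take, List.take_range, h]

theorem wordPrefix_prefix (U : ℕ → Letter d) {m k : ℕ} (h : m ≤ k) :
    wordPrefix U m <+: wordPrefix U k := by
  rw [← wordPrefix_take U h]; exact List.take_prefix _ _

theorem wordPrefix_getElem (U : ℕ → Letter d) {m k : ℕ} (h : m < (wordPrefix U k).length) :
    (wordPrefix U k)[m] = U m := by
  simp [wordPrefix]

theorem mem_segs_wordPrefix {U : ℕ → Letter d} {k : ℕ} {v : Letter d → ℤ} {c : Letter d} :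
    (v, c) ∈ segs (wordPrefix U k) ↔ ∃ m < k, U m = c ∧ v = abWord (wordPrefix U m) := by
  simp only [segs, List.mem_map, List.mem_range, wordPrefix_length, Prod.mk.injEq]
  refine exists_congr fun m => ?_
  constructor
  · rintro ⟨h, rfl, rfl⟩
    refine ⟨h, ?_, by rw [wordPrefix_take U h.le]⟩
    rw [List.getD_eq_getElem _ _ (by simpa [wordPrefix_length] using h), wordPrefix_getElem]
  · rintro ⟨h, rfl, rfl⟩
    refine ⟨h, by rw [wordPrefix_take U h.le], ?_⟩
    rw [List.getD_eq_getElem _ _ (by simpa [wordPrefix_length] using h), wordPrefix_getElem]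

theorem InfSeg.of_prefix {U : ℕ → Letter d} {k : ℕ} {v : Letter d → ℤ} {c : Letter d}
    (h : (v, c) ∈ segs (wordPrefix U k)) : InfSeg U v c := by
  obtain ⟨m, _, h⟩ := mem_segs_wordPrefix.1 h
  exact ⟨m, h⟩

theorem InfSeg.image {g : Letter d → List (Letter d)} {U U' : ℕ → Letter d}
    (h : IsImage g U U') {v u : Letter d → ℤ} {c c' : Letter d} (hv : InfSeg U v c)
    (hu : (u, c') ∈ segs (g c)) : InfSeg U' ((morphMatrix g).mulVec v + u) c' := by
  obtain ⟨m, rfl, rfl⟩ := hv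
  obtain ⟨k, hk⟩ := h (m + 1)
  refine InfSeg.of_prefix (k := k) ?_
  rw [← hk, segs_flatMap]
  exact ⟨_, _, _, mem_segs_wordPrefix.2 ⟨m, by omega, rfl, rfl⟩, hu, rfl⟩

theorem IsImage.comp {g g' : Letter d → List (Letter d)} {U U' U'' : ℕ → Letter d}
    (h : IsImage g U U') (h' : IsImage g' U' U'') : IsImage (fun b => (g b).flatMap g') U U'' := by
  intro m
  obtain ⟨k, hk⟩ := h m
  obtain ⟨l, hl⟩ := h' k
  exact ⟨l, by rw [← hl, ← hk, List.flatMap_assoc]⟩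

theorem IsImage.refl (U : ℕ → Letter d) : IsImage (fun b => [b]) U U :=
  fun m => ⟨m, by simp⟩

theorem IsImage.pow {g : Letter d → List (Letter d)} {U : ℕ → ℕ → Letter d}
    (h : ∀ n, IsImage g (U (n + 1)) (U n)) (n m : ℕ) : IsImage (morphPow g n) (U (m + n)) (U m) := by
  induction n generalizing m with
  | zero => exact IsImage.refl _
  | succ n ih =>
    have := (ih (m + 1)).comp (h m)
    rwa [add_right_comm, add_assoc] at this

/-- Images of prefixes are prefixes of one another, so the letter read from the prefix of length `n
+ 1` is the letter read from any image long enough to contain it. -/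
theorem Subst.isImage_onInfinite (σ : Subst d) (U : ℕ → Letter d) :
    IsImage σ.image U (σ.onInfinite U) := by
  intro m
  refine ⟨((wordPrefix U m).flatMap σ.image).length, ?_⟩
  refine List.ext_getElem (by rw [wordPrefix_length]) fun n h1 h2 => ?_
  rw [wordPrefix_getElem]
  unfold Subst.onInfinite
  have key : ∀ k l, k ≤ l → ((wordPrefix U k).flatMap σ.image) <+:
      ((wordPrefix U l).flatMap σ.image) := by
    intro k l hkl
    obtain ⟨s, hs⟩ := wordPrefix_prefix U hkl
    rw [← hs, List.flatMap_append]
    exact List.prefix_append _ _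
  have h3 : n < ((wordPrefix U (n + 1)).flatMap σ.image).length := by
    have := length_le_length_flatMap σ.nonerasing (wordPrefix U (n + 1))
    rw [wordPrefix_length] at this; omega
  show _ = ((wordPrefix U (n + 1)).flatMap σ.image)[n]
  rcases le_total m (n + 1) with h | h
  · exact (key _ _ h).getElem h1
  · exact ((key _ _ h).getElem h3).symm

/-- The composition of a list of morphisms, the first one being applied last. -/
def morphComp (l : List (Letter d → List (Letter d))) (b : Letter d) : List (Letter d) :=
  l.foldr (fun g w => w.flatMap g) [b]

theorem morphComp_append_singleton (l : List (Letter d → List (Letter d)))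
    (g : Letter d → List (Letter d)) (b : Letter d) :
    morphComp (l ++ [g]) b = (g b).flatMap (morphComp l) := by
  have key : ∀ w : List (Letter d), l.foldr (fun g w => w.flatMap g) w
      = w.flatMap (morphComp l) := by
    intro w
    induction l with
    | nil =>
      show w = w.flatMap (fun b => [b])
      simp
    | cons a l ih => rw [List.foldr_cons, ih, List.flatMap_assoc]; rfl
  simp only [morphComp, List.foldr_append, List.foldr_cons, List.foldr_nil]
  rw [key]; simp

theorem morphMatrix_comp (g g' : Letter d → List (Letter d)) :
    morphMatrix (fun b => (g b).flatMap g') = morphMatrix g' * morphMatrix g := by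
  ext i j
  simp only [morphMatrix, Matrix.of_apply, Matrix.mul_apply]
  rw [abWord_flatMap]
  simp [Matrix.mulVec, dotProduct, morphMatrix]

/-- Compactness of sequences of infinite words: the first `N` equations can be solved backwards from
any word, and they define nested closed sets. -/
theorem exists_isFixedPoint (s : ℕ → Subst d) : ∃ u : ℕ → ℕ → Letter d, IsFixedPoint s u := by
  have hcont : ∀ k, Continuous fun U : ℕ → Letter d => (s k).onInfinite U := by
    intro k
    refine continuous_pi fun n => ?_
    -- Non-erasing substitutions are continuous: the letter of index `n` depends only on the first
    -- `n + 1` letters.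
    have h : (fun U : ℕ → Letter d => (s k).onInfinite U n) =
        (fun v : Fin (n + 1) → Letter d => ((s k).onWord (List.ofFn v)).getD n 0) ∘
          (fun U i => U i) := by
      funext U
      have : List.ofFn (fun i : Fin (n + 1) => U i) = wordPrefix U (n + 1) := by
        refine List.ext_getElem (by simp [wordPrefix]) fun i h1 h2 => ?_
        rw [List.getElem_ofFn, wordPrefix_getElem]
      simp only [Function.comp, this, Subst.onInfinite]
      rw [List.getD_eq_getElem]
    rw [h]
    exact continuous_of_discreteTopology.comp (continuous_pi fun i => continuous_apply _)
  let C : ℕ → Set (ℕ → ℕ → Letter d) := fun N => {u | ∀ k < N, (s k).onInfinite (u (k + 1)) = u k}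
  have hclosed : ∀ N, IsClosed (C N) := by
    intro N
    simp only [C, Set.ofPred_forall]
    refine isClosed_iInter fun k => isClosed_iInter fun _ => ?_
    exact isClosed_eq ((hcont k).comp (continuous_apply _)) (continuous_apply _)
  have hne : ∀ N, (C N).Nonempty := by
    have aux : ∀ N (t : ℕ → Subst d), ∃ u : ℕ → ℕ → Letter d, ∀ k < N, (t k).onInfinite (u (k + 1)) = u k := by
      intro N
      induction N with
      | zero => exact fun t => ⟨fun _ _ => 0, by simp⟩
      | succ N ih =>
        intro t
        obtain ⟨u, hu⟩ := ih (fun k => t (k + 1))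
        refine ⟨fun k => Nat.casesOn k ((t 0).onInfinite (u 0)) u, ?_⟩
        rintro (_ | k) hk
        · rfl
        · exact hu k (by omega)
    exact fun N => aux N s
  have := IsCompact.nonempty_iInter_of_sequence_nonempty_isCompact_isClosed C
    (fun N u hu k hk => hu k (by omega)) hne (hclosed 0).isCompact hclosed
  obtain ⟨u, hu⟩ := this
  exact ⟨u, fun k => Set.mem_iInter.1 hu (k + 1) k (by omega)⟩

end Words

/-! ### Contracting integer matrices and their eigenvectors -/

section Lin

variable {d : ℕ}

/-- The sum of the coordinates. -/
noncomputable def ht : (Letter d → ℝ) →ₗ[ℝ] ℝ := ∑ i, LinearMap.proj i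

theorem ht_apply (v : Letter d → ℝ) : ht v = ∑ i, v i := by simp [ht]

/-- The projection along `x` onto the vectors whose coordinates sum to zero. -/
noncomputable def prj (x : Letter d → ℝ) : (Letter d → ℝ) →ₗ[ℝ] (Letter d → ℝ) :=
  LinearMap.id - ht.smulRight x

theorem prj_apply (x v : Letter d → ℝ) : prj x v = v - ht v • x := by simp [prj]

/-- An integer vector as a real vector. -/
def vec (z : Letter d → ℤ) : Letter d → ℝ := fun i => (z i : ℝ)

/-- An integer matrix as a real matrix. -/
def rl (M : Matrix (Letter d) (Letter d) ℤ) : Matrix (Letter d) (Letter d) ℝ :=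
  M.map (Int.cast : ℤ → ℝ)

theorem vec_add (z w : Letter d → ℤ) : vec (z + w) = vec z + vec w := by ext i; simp [vec]
theorem vec_sub (z w : Letter d → ℤ) : vec (z - w) = vec z - vec w := by ext i; simp [vec]
theorem vec_neg (z : Letter d → ℤ) : vec (-z) = -vec z := by ext i; simp [vec]
theorem vec_zero : vec (0 : Letter d → ℤ) = 0 := by ext i; simp [vec]
theorem vec_single (b : Letter d) : vec (Pi.single b 1) = Pi.single b 1 := by
  ext i; by_cases h : i = b
  · subst h; simp [vec]
  · simp [vec, h]
theorem vec_mulVec (M : Matrix (Letter d) (Letter d) ℤ) (z : Letter d → ℤ) :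
    vec (M.mulVec z) = (rl M).mulVec (vec z) := by
  ext i; simp [vec, rl, Matrix.mulVec, dotProduct]

theorem rl_mul (M N : Matrix (Letter d) (Letter d) ℤ) : rl (M * N) = rl M * rl N :=
  Matrix.map_mul (f := Int.castRingHom ℝ)

theorem rl_one : rl (1 : Matrix (Letter d) (Letter d) ℤ) = 1 :=
  Matrix.map_one _ (by simp) (by simp)

theorem rl_pow (M : Matrix (Letter d) (Letter d) ℤ) (n : ℕ) : rl (M ^ n) = rl M ^ n := by
  induction n with
  | zero => simp [rl_one]
  | succ n ih => rw [pow_succ, rl_mul, ih, pow_succ]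

theorem det_rl (M : Matrix (Letter d) (Letter d) ℤ) : (rl M).det = (M.det : ℝ) :=
  ((Int.castRingHom ℝ).map_det M).symm

theorem ht_vec (z : Letter d → ℤ) : ht (vec z) = ((∑ i, z i : ℤ) : ℝ) := by
  simp [ht_apply, vec]

/-- `x` is a nonnegative eigenvector, of norm one, of the nonnegative unimodular matrix `M`. -/
structure IsPerron (M : Matrix (Letter d) (Letter d) ℤ) (x : Letter d → ℝ) (lam : ℝ) : Prop where
  nonneg : ∀ i j, 0 ≤ M i j
  one_le_col : ∀ j, 1 ≤ ∑ i, M i j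
  det : IsUnit M.det
  x_nonneg : ∀ i, 0 ≤ x i
  ht_x : ht x = 1
  eig : (rl M).mulVec x = lam • x

/-- The powers of `M` contract along `x`. -/
def Contracts (M : Matrix (Letter d) (Letter d) ℤ) (x : Letter d → ℝ) : Prop :=
  ∀ v, Tendsto (fun n : ℕ => prj x ((rl M ^ n).mulVec v)) atTop (𝓝 0)

variable {M : Matrix (Letter d) (Letter d) ℤ} {x : Letter d → ℝ} {lam : ℝ}

namespace IsPerron

theorem prj_self (h : IsPerron M x lam) : prj x x = 0 := by
  rw [prj_apply, h.ht_x, one_smul, sub_self]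

theorem eq_add (_ : IsPerron M x lam) (v : Letter d → ℝ) : v = ht v • x + prj x v := by
  rw [prj_apply]; abel

theorem eig_pow (h : IsPerron M x lam) (n : ℕ) : (rl M ^ n).mulVec x = lam ^ n • x := by
  induction n with
  | zero => simp
  | succ n ih =>
    rw [pow_succ, ← Matrix.mulVec_mulVec, h.eig, Matrix.mulVec_smul, ih, smul_smul, pow_succ']

/-- The line of `x` is invariant and killed by the projection, so only `prj x v` matters; this lets
contraction estimates be composed. -/
theorem prj_pow (h : IsPerron M x lam) (n : ℕ) (v : Letter d → ℝ) :
    prj x ((rl M ^ n).mulVec (prj x v)) = prj x ((rl M ^ n).mulVec v) := by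
  rw [prj_apply x v, Matrix.mulVec_sub, Matrix.mulVec_smul, h.eig_pow, map_sub, map_smul, map_smul,
    h.prj_self]
  simp

theorem one_le (h : IsPerron M x lam) : 1 ≤ lam := by
  have h1 : ht ((rl M).mulVec x) = lam := by rw [h.eig, map_smul, h.ht_x]; simp
  rw [← h1, ← h.ht_x, ht_apply, ht_apply]
  simp only [Matrix.mulVec, dotProduct]
  rw [Finset.sum_comm]
  refine Finset.sum_le_sum fun j _ => ?_
  rw [← Finset.sum_mul]
  have : (1 : ℝ) ≤ ∑ i, rl M i j := by
    have := h.one_le_col j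
    simp only [rl, Matrix.map_apply]
    exact_mod_cast this
  nlinarith [h.x_nonneg j]

theorem x_le_one (h : IsPerron M x lam) (i : Letter d) : x i ≤ 1 := by
  rw [← h.ht_x, ht_apply]
  exact Finset.single_le_sum (fun j _ => h.x_nonneg j) (Finset.mem_univ i)

theorem norm_x_le (h : IsPerron M x lam) : ‖x‖ ≤ 1 := by
  refine (pi_norm_le_iff_of_nonneg zero_le_one).2 fun i => ?_
  rw [Real.norm_of_nonneg (h.x_nonneg i)]
  exact h.x_le_one i

end IsPerron

theorem abs_ht_le (v : Letter d → ℝ) : |ht v| ≤ (d + 1) * ‖v‖ := by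
  rw [ht_apply]
  refine (Finset.abs_sum_le_sum_abs _ _).trans ?_
  calc ∑ i, |v i| ≤ ∑ _i : Letter d, ‖v‖ := Finset.sum_le_sum fun i _ => norm_le_pi_norm v i
    _ = _ := by simp

theorem IsPerron.norm_prj_le (h : IsPerron M x lam) (v : Letter d → ℝ) :
    ‖prj x v‖ ≤ (d + 2) * ‖v‖ := by
  rw [prj_apply]
  refine (norm_sub_le _ _).trans ?_
  rw [norm_smul, Real.norm_eq_abs]
  have h1 := abs_ht_le v
  have h2 := h.norm_x_le
  nlinarith [mul_le_mul h1 h2 (norm_nonneg _) (by positivity), norm_nonneg v]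

theorem tendsto_linear {ι : Type*} {l : Filter ι} (L : (Letter d → ℝ) →ₗ[ℝ] (Letter d → ℝ))
    {u : ι → Letter d → ℝ} {a : Letter d → ℝ} (h : Tendsto u l (𝓝 a)) :
    Tendsto (fun i => L (u i)) l (𝓝 (L a)) :=
  (L.continuous_of_finiteDimensional.tendsto a).comp h

theorem tendsto_functional {ι : Type*} {l : Filter ι} (L : (Letter d → ℝ) →ₗ[ℝ] ℝ)
    {u : ι → Letter d → ℝ} {a : Letter d → ℝ} (h : Tendsto u l (𝓝 a)) :
    Tendsto (fun i => L (u i)) l (𝓝 (L a)) :=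
  (L.continuous_of_finiteDimensional.tendsto a).comp h

theorem eq_sum_single (v : Letter d → ℝ) : v = ∑ j, v j • (Pi.single j 1 : Letter d → ℝ) :=
  pi_eq_sum_univ' v

theorem linear_norm_le (L : (Letter d → ℝ) →ₗ[ℝ] (Letter d → ℝ)) {ε : ℝ}
    (hL : ∀ j, ‖L (Pi.single j 1)‖ ≤ ε / (d + 1)) (v : Letter d → ℝ) : ‖L v‖ ≤ ε * ‖v‖ := by
  conv_lhs => rw [eq_sum_single v, map_sum]
  refine (norm_sum_le _ _).trans ?_
  calc ∑ j, ‖L (v j • Pi.single j 1)‖ ≤ ∑ _j : Letter d, ‖v‖ * (ε / (d + 1)) := by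
        refine Finset.sum_le_sum fun j _ => ?_
        rw [map_smul, norm_smul]
        exact mul_le_mul (norm_le_pi_norm v j) (hL j) (norm_nonneg _) (norm_nonneg _)
    _ = ε * ‖v‖ := by
        simp only [Finset.sum_const, Finset.card_univ, Fintype.card_fin, nsmul_eq_mul]
        push_cast
        field_simp

/-- The linear map `v ↦ π_x(Mⁿ v)`. -/
noncomputable def prjPow (M : Matrix (Letter d) (Letter d) ℤ) (x : Letter d → ℝ) (n : ℕ) :
    (Letter d → ℝ) →ₗ[ℝ] (Letter d → ℝ) := prj x ∘ₗ (rl M ^ n).mulVecLin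

theorem prjPow_apply (n : ℕ) (v : Letter d → ℝ) :
    prjPow M x n v = prj x ((rl M ^ n).mulVec v) := rfl

/-- In finite dimension, pointwise convergence on the `d + 1` basis vectors gives convergence of the
operators. -/
theorem Contracts.uniform (hc : Contracts M x) {ε : ℝ} (hε : 0 < ε) :
    ∀ᶠ n in atTop, ∀ v, ‖prj x ((rl M ^ n).mulVec v)‖ ≤ ε * ‖v‖ := by
  have h1 : ∀ j : Letter d, ∀ᶠ n in atTop, ‖prjPow M x n (Pi.single j 1)‖ ≤ ε / (d + 1) := by
    intro j
    have := (hc (Pi.single j 1)).norm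
    rw [norm_zero] at this
    exact (this.eventually_lt_const (by positivity : 0 < ε / ((d : ℝ) + 1))).mono fun n h => h.le
  filter_upwards [eventually_all.2 h1] with n hn v
  exact linear_norm_le (prjPow M x n) hn v

theorem Contracts.uniform_prj (h : IsPerron M x lam) (hc : Contracts M x) {ε : ℝ} (hε : 0 < ε) :
    ∀ᶠ n in atTop, ∀ v, ‖prj x ((rl M ^ n).mulVec v)‖ ≤ ε * ‖prj x v‖ := by
  filter_upwards [hc.uniform hε] with n hn v
  rw [← h.prj_pow]
  exact hn _

/-- One power that halves is enough: write `n = N * k + r`, with `r < N`, and take for `ρ` the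
`N`-th root of `1 / 2`. -/
theorem IsPerron.exponential (h : IsPerron M x lam) {N : ℕ} (hN : 1 ≤ N)
    (hN' : ∀ v, ‖prj x ((rl M ^ N).mulVec v)‖ ≤ 1 / 2 * ‖v‖) :
    ∃ C ρ : ℝ, 0 < C ∧ 0 < ρ ∧ ρ < 1 ∧
      ∀ n v, ‖prj x ((rl M ^ n).mulVec v)‖ ≤ C * ρ ^ n * ‖v‖ := by
  have hN0 : (N : ℝ) ≠ 0 := by positivity
  set ρ : ℝ := (1 / 2 : ℝ) ^ (1 / N : ℝ) with hρ
  have hρN : ρ ^ N = 1 / 2 := by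
    rw [hρ, ← Real.rpow_natCast, ← Real.rpow_mul (by norm_num)]
    field_simp
    simp
  have hρ0 : 0 < ρ := by positivity
  have hρ1 : ρ < 1 := Real.rpow_lt_one (by norm_num) (by norm_num) (by positivity)
  have h1 : ∀ k v, ‖prj x ((rl M ^ (N * k)).mulVec v)‖ ≤ (d + 2) * (1 / 2) ^ k * ‖v‖ := by
    intro k
    induction k with
    | zero => intro v; simpa using h.norm_prj_le v
    | succ k ih =>
      intro v
      rw [mul_add, mul_one, pow_add, ← Matrix.mulVec_mulVec, ← h.prj_pow]
      refine (ih _).trans ?_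
      have := hN' v
      rw [pow_succ]
      have h3 : 0 ≤ ((d : ℝ) + 2) * (1 / 2) ^ k := by positivity
      nlinarith
  have h2 : ∃ B : ℝ, 0 < B ∧ ∀ r < N, ∀ v, ‖(rl M ^ r).mulVec v‖ ≤ B * ‖v‖ := by
    have : ∀ r, ∃ B : ℝ, 0 ≤ B ∧ ∀ v, ‖(rl M ^ r).mulVec v‖ ≤ B * ‖v‖ := fun r =>
      ⟨‖LinearMap.toContinuousLinearMap (rl M ^ r).mulVecLin‖, norm_nonneg _,
        fun v => ContinuousLinearMap.le_opNorm
          (LinearMap.toContinuousLinearMap (rl M ^ r).mulVecLin) v⟩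
    choose B hB0 hB using this
    refine ⟨1 + ∑ r ∈ Finset.range N, B r,
      by have := Finset.sum_nonneg (fun r (_ : r ∈ Finset.range N) => hB0 r); linarith,
      fun r hr v => (hB r v).trans ?_⟩
    have := Finset.single_le_sum (fun r _ => hB0 r) (Finset.mem_range.2 hr)
    exact mul_le_mul_of_nonneg_right (by linarith) (norm_nonneg _)
  obtain ⟨B, hB0, hB⟩ := h2
  refine ⟨(d + 2) * 2 * B, ρ, by positivity, hρ0, hρ1, fun n v => ?_⟩
  have hn : n = N * (n / N) + n % N := (Nat.div_add_mod n N).symm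
  have hr : n % N < N := Nat.mod_lt _ hN
  -- Rounding `n / N` down costs at most the factor `ρ ^ (-N) = 2`.
  have h4 : ((1 : ℝ) / 2) ^ (n / N) ≤ 2 * ρ ^ n := by
    rw [← hρN, ← pow_mul]
    conv_rhs => rw [hn, pow_add]
    have : ρ ^ N ≤ ρ ^ (n % N) := pow_le_pow_of_le_one hρ0.le hρ1.le hr.le
    have h5 : 0 < ρ ^ (N * (n / N)) := by positivity
    rw [hρN] at this
    nlinarith
  conv_lhs => rw [hn, pow_add, ← Matrix.mulVec_mulVec]
  refine (h1 _ _).trans ?_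
  calc (d + 2) * (1 / 2) ^ (n / N) * ‖(rl M ^ (n % N)).mulVec v‖
      ≤ (d + 2) * (2 * ρ ^ n) * (B * ‖v‖) := by
        gcongr
        exact hB _ hr v
    _ = _ := by ring

theorem IsPerron.contracts_of_half (h : IsPerron M x lam) {N : ℕ} (hN : 1 ≤ N)
    (hN' : ∀ v, ‖prj x ((rl M ^ N).mulVec v)‖ ≤ 1 / 2 * ‖v‖) : Contracts M x := by
  obtain ⟨C, ρ, hC, hρ0, hρ1, hb⟩ := h.exponential hN hN'
  intro v
  refine squeeze_zero_norm (hb · v) ?_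
  have := ((tendsto_pow_atTop_nhds_zero_of_lt_one hρ0.le hρ1).const_mul C).mul_const ‖v‖
  simpa using this

theorem IsPerron.exponential_of_contracts (h : IsPerron M x lam) (hc : Contracts M x) :
    ∃ C ρ : ℝ, 0 < C ∧ 0 < ρ ∧ ρ < 1 ∧
      ∀ n v, ‖prj x ((rl M ^ n).mulVec v)‖ ≤ C * ρ ^ n * ‖v‖ := by
  obtain ⟨N, hN, hN1⟩ := ((hc.uniform (ε := 1 / 2) (by norm_num)).and (eventually_ge_atTop 1)).exists
  exact h.exponential hN1 hN

/-- An integer sequence with limit zero vanishes eventually. -/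
theorem eventually_eq_zero_of_tendsto {u : ℕ → ℤ} (h : Tendsto (fun n => (u n : ℝ)) atTop (𝓝 0)) :
    ∀ᶠ n in atTop, u n = 0 := by
  have := h.abs
  rw [abs_zero] at this
  filter_upwards [this.eventually_lt_const one_pos] with n hn
  have : |u n| < 1 := by exact_mod_cast hn
  exact Int.abs_lt_one_iff.1 this

theorem IsPerron.isUnit_rl (h : IsPerron M x lam) : IsUnit (rl M).det := by
  rw [det_rl]; exact h.det.map (Int.castRingHom ℝ)

/-- No integer relation between the coordinates of `x`. -/
theorem IsPerron.int_independent (h : IsPerron M x lam) (hc : Contracts M x) {c : Letter d → ℤ}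
    (h0 : ∑ i, (c i : ℝ) * x i = 0) : c = 0 := by
  -- As `c` is orthogonal to `x`, it sees only the projection of the column `M ^ n e_j`, which tends
  -- to zero; the values are integers.
  have h1 : ∀ j, ∀ᶠ n in atTop, (Matrix.vecMul c (M ^ n)) j = 0 := by
    intro j
    refine eventually_eq_zero_of_tendsto ?_
    have h2 : ∀ n, ((Matrix.vecMul c (M ^ n) j : ℤ) : ℝ) =
        (vec c) ⬝ᵥ prj x ((rl M ^ n).mulVec (Pi.single j 1)) := by
      intro n
      have h3 : (vec c) ⬝ᵥ x = 0 := h0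
      rw [prj_apply, dotProduct_sub, dotProduct_smul, h3, smul_zero, sub_zero, ← rl_pow]
      simp [Matrix.vecMul, dotProduct, vec, rl]
    simp_rw [h2]
    have := (hc (Pi.single j 1))
    have h4 : Tendsto (fun n : ℕ => ∑ i, vec c i * prj x ((rl M ^ n).mulVec (Pi.single j 1)) i) atTop
        (𝓝 (∑ i, vec c i * (0 : Letter d → ℝ) i)) := by
      refine tendsto_finsetSum _ fun i _ => Tendsto.const_mul _ ?_
      exact (tendsto_pi_nhds.1 this) i
    simpa [dotProduct] using h4
  obtain ⟨n, hn⟩ := (eventually_all.2 h1).exists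
  have h5 : Matrix.vecMul c (M ^ n) = 0 := funext hn
  have h6 : IsUnit (M ^ n).det := by rw [Matrix.det_pow]; exact h.det.pow n
  have := congrArg (fun w => Matrix.vecMul w (M ^ n)⁻¹) h5
  simpa [Matrix.mul_nonsing_inv _ h6] using this

theorem IsPerron.x_pos (h : IsPerron M x lam) (hc : Contracts M x) (i : Letter d) : 0 < x i := by
  refine lt_of_le_of_ne (h.x_nonneg i) fun h0 => ?_
  have := h.int_independent hc (c := Pi.single i 1) (by
    rw [Finset.sum_eq_single i] <;> simp +contextual [← h0])
  simpa using congrFun this i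

/-- An integer multiple of the direction `x` would give the integer relations `z i * x j = z j * x
i`. Hence the projection is injective on integer vectors. -/
theorem IsPerron.prj_int_ne_zero (h : IsPerron M x lam) (hc : Contracts M x) (hd : 1 ≤ d)
    {z : Letter d → ℤ} (hz : prj x (vec z) = 0) : z = 0 := by
  have h1 : vec z = ht (vec z) • x := by rw [prj_apply, sub_eq_zero] at hz; exact hz
  obtain ⟨i, j, hij⟩ : ∃ i j : Letter d, i ≠ j :=
    ⟨0, ⟨1, by omega⟩, by simp [Fin.ext_iff]⟩
  have key : ∀ i j : Letter d, i ≠ j → z i = 0 := by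
    intro i j hij
    have h2 := h.int_independent hc (c := Pi.single j (z i) - Pi.single i (z j)) (by
      have h3 : ∀ k, (((Pi.single j (z i) - Pi.single i (z j) : Letter d → ℤ) k : ℤ) : ℝ) * x k =
          (if k = j then (z i : ℝ) * x k else 0) - (if k = i then (z j : ℝ) * x k else 0) := by
        intro k
        simp only [Pi.sub_apply, Pi.single_apply]
        split_ifs <;> push_cast <;> ring
      simp_rw [h3, Finset.sum_sub_distrib]
      have h4 := congrFun h1 i
      have h5 := congrFun h1 j
      simp only [vec, Pi.smul_apply, smul_eq_mul] at h4 h5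
      simp only [Finset.sum_ite_eq', Finset.mem_univ, if_true]
      rw [h4, h5]; ring)
    have := congrFun h2 j
    simpa [hij.symm, hij, Pi.single_apply] using this
  ext k
  by_cases hk : k = i
  · exact hk ▸ key i j hij
  · exact key k i hk

/-- A left eigenvector. -/
structure IsLeft (M : Matrix (Letter d) (Letter d) ℤ) (x : Letter d → ℝ) (lam : ℝ)
    (f : (Letter d → ℝ) →ₗ[ℝ] ℝ) : Prop where
  f_x : f x = 1
  f_mul : ∀ v, f ((rl M).mulVec v) = lam * f v

/-- A left null vector `g` of `M - lam` cannot vanish on `x`: otherwise it would factor through the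
projection, and the values `lam ^ n * g j` would tend to zero although `1 ≤ lam`. -/
theorem IsPerron.exists_left (h : IsPerron M x lam) (hc : Contracts M x) :
    ∃ f, IsLeft M x lam f := by
  have hx : x ≠ 0 := by rintro rfl; have := h.ht_x; simp at this
  have h1 : (rl M - lam • 1).det = 0 := by
    rw [← Matrix.exists_mulVec_eq_zero_iff]
    exact ⟨x, hx, by rw [Matrix.sub_mulVec, h.eig, Matrix.smul_mulVec, Matrix.one_mulVec, sub_self]⟩
  obtain ⟨g, hg, hg'⟩ := Matrix.exists_vecMul_eq_zero_iff.2 h1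
  have h2 : ∀ v, g ⬝ᵥ (rl M).mulVec v = lam * (g ⬝ᵥ v) := by
    intro v
    have := congrArg (fun w => w ⬝ᵥ v) hg'
    simp only [Matrix.vecMul_sub, sub_dotProduct, zero_dotProduct, Matrix.vecMul_smul,
      Matrix.vecMul_one, smul_dotProduct] at this
    rw [Matrix.dotProduct_mulVec]
    simpa [sub_eq_zero] using this
  have h3 : g ⬝ᵥ x ≠ 0 := by
    intro h0
    refine hg (funext fun j => ?_)
    have h4 : ∀ n v, g ⬝ᵥ (rl M ^ n).mulVec v = lam ^ n * (g ⬝ᵥ v) := by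
      intro n
      induction n with
      | zero => simp
      | succ n ih => intro v; rw [pow_succ, ← Matrix.mulVec_mulVec, ih, h2, pow_succ]; ring
    have h5 : ∀ n, |g j| ≤ |g ⬝ᵥ prj x ((rl M ^ n).mulVec (Pi.single j 1))| := by
      intro n
      rw [prj_apply, dotProduct_sub, dotProduct_smul, h0, smul_zero, sub_zero, h4, abs_mul]
      simp only [dotProduct_single, mul_one]
      have : 1 ≤ |lam ^ n| := (one_le_pow₀ h.one_le).trans (le_abs_self _)
      nlinarith [abs_nonneg (g j)]
    have h6 : Tendsto (fun n : ℕ => ∑ i, g i * prj x ((rl M ^ n).mulVec (Pi.single j 1)) i) atTop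
        (𝓝 (∑ i, g i * (0 : Letter d → ℝ) i)) := by
      refine tendsto_finsetSum _ fun i _ => Tendsto.const_mul _ ?_
      exact (tendsto_pi_nhds.1 (hc (Pi.single j 1))) i
    have h7 := h6.abs
    simp only [Pi.zero_apply, mul_zero, Finset.sum_const_zero, abs_zero] at h7
    have := ge_of_tendsto' h7 h5
    exact abs_eq_zero.1 (le_antisymm this (abs_nonneg _))
  refine ⟨(g ⬝ᵥ x)⁻¹ • (LinearMap.mk ⟨fun v => g ⬝ᵥ v, dotProduct_add g⟩ fun c v => dotProduct_smul c g v),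
    ?_, fun v => ?_⟩
  · simp [h3]
  · simp only [LinearMap.smul_apply, LinearMap.coe_mk, AddHom.coe_mk, smul_eq_mul, h2]
    ring

variable {f : (Letter d → ℝ) →ₗ[ℝ] ℝ}

theorem IsLeft.f_pow (hf : IsLeft M x lam f) (n : ℕ) (v : Letter d → ℝ) :
    f ((rl M ^ n).mulVec v) = lam ^ n * f v := by
  induction n generalizing v with
  | zero => simp
  | succ n ih => rw [pow_succ, ← Matrix.mulVec_mulVec, ih, hf.f_mul, pow_succ]; ring

theorem IsLeft.f_eq (h : IsPerron M x lam) (hf : IsLeft M x lam f) (v : Letter d → ℝ) :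
    f v = ht v + f (prj x v) := by
  conv_lhs => rw [h.eq_add v]
  rw [map_add, map_smul, hf.f_x]; simp

/-- The stable hyperplane. -/
theorem IsLeft.tendsto_of_f_eq_zero (h : IsPerron M x lam) (hc : Contracts M x)
    (hf : IsLeft M x lam f) {v : Letter d → ℝ} (hv : f v = 0) :
    Tendsto (fun n : ℕ => (rl M ^ n).mulVec v) atTop (𝓝 0) := by
  have h1 : ∀ n, (rl M ^ n).mulVec v = (-f (prj x ((rl M ^ n).mulVec v))) • x +
      prj x ((rl M ^ n).mulVec v) := by
    intro n
    have := hf.f_eq h ((rl M ^ n).mulVec v)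
    rw [hf.f_pow, hv, mul_zero] at this
    conv_lhs => rw [h.eq_add ((rl M ^ n).mulVec v)]
    congr 2
    linarith
  have h2 := hc v
  have h3 := ((tendsto_functional f h2).neg.smul_const x).add h2
  simp only [map_zero, neg_zero, zero_smul, add_zero] at h3
  exact h3.congr fun n => (h1 n).symm

/-- Split `v` into its component along `x` and a vector of the stable hyperplane. Only `1 ≤ lam` is
needed, as the second part already tends to zero before scaling. -/
theorem IsLeft.tendsto_scaled (h : IsPerron M x lam) (hc : Contracts M x)
    (hf : IsLeft M x lam f) (v : Letter d → ℝ) :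
    Tendsto (fun n : ℕ => (lam ^ n)⁻¹ • (rl M ^ n).mulVec v) atTop (𝓝 (f v • x)) := by
  have h1 : f (v - f v • x) = 0 := by rw [map_sub, map_smul, hf.f_x]; simp
  have h2 := hf.tendsto_of_f_eq_zero h hc h1
  have h3 : ∀ n, (lam ^ n)⁻¹ • (rl M ^ n).mulVec v =
      f v • x + (lam ^ n)⁻¹ • (rl M ^ n).mulVec (v - f v • x) := by
    intro n
    have hl : lam ^ n ≠ 0 := pow_ne_zero _ (by have := h.one_le; positivity)
    rw [Matrix.mulVec_sub, Matrix.mulVec_smul, h.eig_pow, smul_sub, smul_smul, smul_smul]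
    rw [show (lam ^ n)⁻¹ * f v * lam ^ n = f v by field_simp]
    abel
  have h4 : Tendsto (fun n : ℕ => (lam ^ n)⁻¹ • (rl M ^ n).mulVec (v - f v • x)) atTop (𝓝 0) := by
    refine squeeze_zero_norm (fun n => ?_) (by simpa using h2.norm)
    rw [norm_smul]
    have : ‖(lam ^ n)⁻¹‖ ≤ 1 := by
      rw [norm_inv]
      refine inv_le_one_of_one_le₀ ?_
      rw [Real.norm_eq_abs]
      exact (one_le_pow₀ h.one_le).trans (le_abs_self _)
    nlinarith [norm_nonneg ((rl M ^ n).mulVec (v - f v • x))]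
  have := h4.const_add (f v • x)
  rw [add_zero] at this
  exact this.congr fun n => (h3 n).symm

theorem IsPerron.mulVec_eq_zero (h : IsPerron M x lam) {z : Letter d → ℤ} {n : ℕ}
    (hz : (M ^ n).mulVec z = 0) : z = 0 := by
  have h6 : IsUnit (M ^ n).det := by rw [Matrix.det_pow]; exact h.det.pow n
  have := congrArg (fun w => (M ^ n)⁻¹.mulVec w) hz
  simpa [Matrix.nonsing_inv_mul _ h6] using this

theorem vec_mulVec_pow (n : ℕ) (z : Letter d → ℤ) :
    vec ((M ^ n).mulVec z) = (rl M ^ n).mulVec (vec z) := by rw [vec_mulVec, rl_pow]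

/-- An integer vector in the stable hyperplane has an orbit of integer vectors tending to zero,
hence reaching zero, and `M` is invertible. -/
theorem IsLeft.f_int_ne_zero (h : IsPerron M x lam) (hc : Contracts M x)
    (hf : IsLeft M x lam f) {z : Letter d → ℤ} (hz : f (vec z) = 0) : z = 0 := by
  have h1 := hf.tendsto_of_f_eq_zero h hc hz
  have h2 : ∀ i, ∀ᶠ n in atTop, ((M ^ n).mulVec z) i = 0 := by
    intro i
    refine eventually_eq_zero_of_tendsto ?_
    have := (tendsto_pi_nhds.1 h1) i
    simp_rw [← vec_mulVec_pow] at this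
    exact this
  obtain ⟨n, hn⟩ := (eventually_all.2 h2).exists
  exact h.mulVec_eq_zero (n := n) (funext hn)

/-- The scaled orbit tends to `f z • x`, and `x` is positive. Together with `f_nonneg_of_nonneg`
this makes the sign of a height recognizable from integers alone. -/
theorem IsLeft.eventually_pos (h : IsPerron M x lam) (hc : Contracts M x)
    (hf : IsLeft M x lam f) {z : Letter d → ℤ} (hz : 0 < f (vec z)) :
    ∀ᶠ n in atTop, ∀ i, 0 < ((M ^ n).mulVec z) i := by
  refine eventually_all.2 fun i => ?_
  have h1 := (tendsto_pi_nhds.1 (hf.tendsto_scaled h hc (vec z))) i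
  have h2 : 0 < (f (vec z) • x) i := by
    simp only [Pi.smul_apply, smul_eq_mul]; exact mul_pos hz (h.x_pos hc i)
  filter_upwards [h1.eventually_const_lt h2] with n hn
  rw [← vec_mulVec_pow] at hn
  simp only [Pi.smul_apply, smul_eq_mul, vec] at hn
  have hl : 0 < (lam ^ n)⁻¹ := by have := h.one_le; positivity
  exact_mod_cast pos_of_mul_pos_right hn hl.le

theorem IsPerron.pow_nonneg (h : IsPerron M x lam) (n : ℕ) (i j : Letter d) : 0 ≤ (M ^ n) i j := by
  induction n generalizing i j with
  | zero => simp only [pow_zero, Matrix.one_apply]; split_ifs <;> norm_num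
  | succ n ih =>
    rw [pow_succ, Matrix.mul_apply]
    exact Finset.sum_nonneg fun k _ => mul_nonneg (ih _ _) (h.nonneg _ _)

theorem mulVec_nonneg {A : Matrix (Letter d) (Letter d) ℤ} {v : Letter d → ℤ}
    (hA : ∀ i j, 0 ≤ A i j) (hv : ∀ i, 0 ≤ v i) (i : Letter d) : 0 ≤ A.mulVec v i := by
  rw [Matrix.mulVec, dotProduct]
  exact Finset.sum_nonneg fun j _ => mul_nonneg (hA i j) (hv j)

theorem IsLeft.f_nonneg_of_nonneg (h : IsPerron M x lam) (hc : Contracts M x)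
    (hf : IsLeft M x lam f) {z : Letter d → ℤ} {n : ℕ} (hz : ∀ i, 0 ≤ (M ^ n).mulVec z i) :
    0 ≤ f (vec z) := by
  by_contra hneg
  push Not at hneg
  have h1 : 0 < f (vec (-z)) := by rw [vec_neg, map_neg]; linarith
  -- A later power would make `-z` positive, although powers of `M` preserve nonnegativity.
  obtain ⟨m, hm, hm1⟩ := ((hf.eventually_pos h hc h1).and (eventually_ge_atTop n)).exists
  have h2 := hm 0
  obtain ⟨k, rfl⟩ := Nat.exists_eq_add_of_le hm1
  rw [Matrix.mulVec_neg, Pi.neg_apply, add_comm n k, pow_add, ← Matrix.mulVec_mulVec] at h2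
  have h3 := mulVec_nonneg (h.pow_nonneg k) hz 0
  linarith

theorem IsLeft.f_single_pos (h : IsPerron M x lam) (hc : Contracts M x)
    (hf : IsLeft M x lam f) (b : Letter d) : 0 < f (Pi.single b 1) := by
  have h1 : 0 ≤ f (vec (Pi.single b 1)) := by
    refine hf.f_nonneg_of_nonneg h hc (n := 0) fun i => ?_
    simp only [pow_zero, Matrix.one_mulVec, Pi.single_apply]
    split_ifs <;> norm_num
  rw [vec_single] at h1
  refine lt_of_le_of_ne h1 fun h0 => ?_
  have := hf.f_int_ne_zero h hc (z := Pi.single b 1) (by rw [vec_single, ← h0])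
  simpa using congrFun this b

/-- If `lam = 1`, the integer vectors `M ^ n e_0` converge, so they are eventually constant and
`e_0` is fixed by `M`. Contraction then forces its projection to vanish, which no nonzero integer
vector allows. -/
theorem IsPerron.one_lt (h : IsPerron M x lam) (hc : Contracts M x) (hd : 1 ≤ d) : 1 < lam := by
  refine lt_of_le_of_ne h.one_le fun h1 => ?_
  obtain ⟨f, hf⟩ := h.exists_left hc
  have hb := hf.f_single_pos h hc 0
  have h2 := hf.tendsto_scaled h hc (Pi.single 0 1)
  have h3 : ∀ᶠ n in atTop, ∀ i, (M ^ (n + 1)).mulVec (Pi.single 0 1) i = (M ^ n).mulVec (Pi.single 0 1) i := by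
    refine eventually_all.2 fun i => ?_
    have h4 := (tendsto_pi_nhds.1 h2) i
    have h5 := ((tendsto_add_atTop_iff_nat 1).2 h4).sub h4
    rw [sub_self] at h5
    have h6 : Tendsto (fun n : ℕ => (((M ^ (n + 1)).mulVec (Pi.single 0 1) i -
        (M ^ n).mulVec (Pi.single 0 1) i : ℤ) : ℝ)) atTop (𝓝 0) := by
      refine h5.congr fun n => ?_
      rw [← vec_single, ← vec_mulVec_pow, ← vec_mulVec_pow]
      simp [← h1, vec]
    filter_upwards [eventually_eq_zero_of_tendsto h6] with n hn
    linarith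
  obtain ⟨n, hn⟩ := h3.exists
  have h7 : M.mulVec (Pi.single 0 1) = Pi.single 0 1 := by
    have h8 : (M ^ n).mulVec (M.mulVec (Pi.single 0 1) - Pi.single 0 1) = 0 := by
      rw [Matrix.mulVec_sub, Matrix.mulVec_mulVec, ← pow_succ, sub_eq_zero]
      exact funext hn
    exact sub_eq_zero.1 (h.mulVec_eq_zero h8)
  have h8 : ∀ n, (rl M ^ n).mulVec (Pi.single 0 1) = Pi.single 0 1 := by
    intro n
    rw [← vec_single, ← vec_mulVec_pow]
    congr 1
    induction n with
    | zero => rw [pow_zero, Matrix.one_mulVec]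
    | succ n ih => rw [pow_succ, ← Matrix.mulVec_mulVec, h7, ih]
  have h9 := hc (Pi.single 0 1)
  simp_rw [h8] at h9
  have := tendsto_nhds_unique h9 tendsto_const_nhds
  have := h.prj_int_ne_zero hc hd (z := Pi.single 0 1) (by rw [vec_single]; exact this.symm)
  simpa using congrFun this 0

/-- Values of a left eigenvector at integer vectors are dense. -/
theorem IsLeft.exists_between (h : IsPerron M x lam) (hc : Contracts M x) (hd : 1 ≤ d)
    (hf : IsLeft M x lam f) {a b : ℝ} (hab : a < b) :
    ∃ q : Letter d → ℤ, a < f (vec q) ∧ f (vec q) < b := by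
  have h0 := hf.f_single_pos h hc 0
  have h1 := h.one_lt hc hd
  obtain ⟨n, hn⟩ : ∃ n : ℕ, f (Pi.single 0 1) / (b - a) < lam ^ n := pow_unbounded_of_one_lt _ h1
  have hl : 0 < lam ^ n := by positivity
  have h6 : IsUnit (M ^ n).det := by rw [Matrix.det_pow]; exact h.det.pow n
  -- Unimodularity keeps this vector integral while its height shrinks by `lam ^ n`; the multiples
  -- of one short step meet every interval longer than it.
  set q₀ : Letter d → ℤ := (M ^ n)⁻¹.mulVec (Pi.single 0 1) with hq
  have h7 : lam ^ n * f (vec q₀) = f (Pi.single 0 1) := by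
    rw [← hf.f_pow, ← vec_mulVec_pow, hq, Matrix.mulVec_mulVec, Matrix.mul_nonsing_inv _ h6,
      Matrix.one_mulVec, vec_single]
  have h8 : 0 < f (vec q₀) := pos_of_mul_pos_right (h7 ▸ h0) hl.le
  have h9 : f (vec q₀) < b - a := by
    rw [div_lt_iff₀ (by linarith), ← h7] at hn
    exact lt_of_mul_lt_mul_left hn hl.le
  refine ⟨(⌊a / f (vec q₀)⌋ + 1) • q₀, ?_⟩
  have h10 : f (vec ((⌊a / f (vec q₀)⌋ + 1) • q₀)) = (⌊a / f (vec q₀)⌋ + 1) * f (vec q₀) := by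
    have : vec ((⌊a / f (vec q₀)⌋ + 1) • q₀) = ((⌊a / f (vec q₀)⌋ + 1 : ℝ)) • vec q₀ := by
      ext i; simp [vec]
    rw [this, map_smul, smul_eq_mul]
  rw [h10]
  have h11 := Int.lt_floor_add_one (a / f (vec q₀))
  have h12 := Int.floor_le (a / f (vec q₀))
  rw [div_lt_iff₀ h8] at h11
  rw [le_div_iff₀ h8] at h12
  constructor <;> linarith

end Lin

/-! ### Overlaps, and why interior forces coincidence -/

section Overlaps

variable {d : ℕ}

/-- The segments `(0, b)` and `(t, b')` overlap in height. -/
def Overlap (f : (Letter d → ℝ) →ₗ[ℝ] ℝ) (b : Letter d) (t : Letter d → ℤ) (b' : Letter d) : Prop :=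
  f (vec t) < f (Pi.single b 1) ∧ 0 < f (vec t) + f (Pi.single b' 1)

/-- The images of `(0, b)` and `(t, b')` under the `n`-th iterate share a segment. -/
def Coincide (g : Letter d → List (Letter d)) (n : ℕ) (b : Letter d) (t : Letter d → ℤ)
    (b' : Letter d) : Prop :=
  ∃ v c, (v, c) ∈ segs (morphPow g n b) ∧
    (v - (morphMatrix g ^ n).mulVec t, c) ∈ segs (morphPow g n b')

/-- The combinatorial substitute for non-empty interior of a worm. All integer offsets `t` are
allowed, whether or not they occur between positions in a given word. -/
def AllCoincide (g : Letter d → List (Letter d)) (f : (Letter d → ℝ) →ₗ[ℝ] ℝ) : Prop :=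
  ∀ b t b', Overlap f b t b' → ∃ n, Coincide g n b t b'

/-- A contracting morphism, with its Perron data. -/
structure IsPisot (g : Letter d → List (Letter d)) (x : Letter d → ℝ) (lam : ℝ)
    (f : (Letter d → ℝ) →ₗ[ℝ] ℝ) : Prop where
  perron : IsPerron (morphMatrix g) x lam
  contracts : Contracts (morphMatrix g) x
  left : IsLeft (morphMatrix g) x lam f
  one_le : 1 ≤ d

theorem IsPerron.ne_nil {g : Letter d → List (Letter d)} {x : Letter d → ℝ} {lam : ℝ}
    (h : IsPerron (morphMatrix g) x lam) (b : Letter d) : g b ≠ [] := by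
  intro hb
  have := h.one_le_col b
  simp [morphMatrix, hb, abWord_nil] at this

variable {g : Letter d → List (Letter d)} {x : Letter d → ℝ} {lam : ℝ}
  {f : (Letter d → ℝ) →ₗ[ℝ] ℝ}

theorem linear_bound (L : (Letter d → ℝ) →ₗ[ℝ] ℝ) : ∃ C, 0 ≤ C ∧ ∀ v, |L v| ≤ C * ‖v‖ :=
  ⟨‖LinearMap.toContinuousLinearMap L‖, norm_nonneg _,
    fun v => (LinearMap.toContinuousLinearMap L).le_opNorm v⟩

theorem linear_bound' (L : (Letter d → ℝ) →ₗ[ℝ] (Letter d → ℝ)) :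
    ∃ C, 0 ≤ C ∧ ∀ v, ‖L v‖ ≤ C * ‖v‖ :=
  ⟨‖LinearMap.toContinuousLinearMap L‖, norm_nonneg _,
    fun v => (LinearMap.toContinuousLinearMap L).le_opNorm v⟩

namespace IsPisot

theorem pos (h : IsPisot g x lam f) (b : Letter d) : 0 < f (Pi.single b 1) :=
  h.left.f_single_pos h.perron h.contracts b

theorem one_lt (h : IsPisot g x lam f) : 1 < lam := h.perron.one_lt h.contracts h.one_le

theorem f_abWord_cons (b : Letter d) (w : List (Letter d)) :
    f (vec (abWord (b :: w))) = f (Pi.single b 1) + f (vec (abWord w)) := by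
  rw [abWord_cons, vec_add, vec_single, map_add]

theorem f_abWord_append (w w' : List (Letter d)) :
    f (vec (abWord (w ++ w'))) = f (vec (abWord w)) + f (vec (abWord w')) := by
  rw [abWord_append, vec_add, map_add]

theorem f_abWord_nonneg (h : IsPisot g x lam f) (w : List (Letter d)) :
    0 ≤ f (vec (abWord w)) := by
  induction w with
  | nil => simp [abWord_nil, vec_zero]
  | cons b w ih => rw [f_abWord_cons]; have := h.pos b; linarith

theorem segs_bounds (h : IsPisot g x lam f) {w : List (Letter d)} {v : Letter d → ℤ} {c : Letter d}
    (hv : (v, c) ∈ segs w) :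
    0 ≤ f (vec v) ∧ f (vec v) + f (Pi.single c 1) ≤ f (vec (abWord w)) := by
  obtain ⟨p, s, rfl, rfl⟩ := mem_segs.1 hv
  rw [f_abWord_append, f_abWord_cons]
  have := h.f_abWord_nonneg p
  have := h.f_abWord_nonneg s
  constructor <;> linarith

/-- The heights of the successive segments tile the interval from zero to the height of the word. -/
theorem cover (w : List (Letter d)) {l : ℝ} (h0 : 0 ≤ l) (h1 : l < f (vec (abWord w))) :
    ∃ v c, (v, c) ∈ segs w ∧ f (vec v) ≤ l ∧ l < f (vec v) + f (Pi.single c 1) := by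
  induction w using List.reverseRecOn with
  | nil => simp only [abWord_nil, vec_zero, map_zero] at h1; linarith
  | append_singleton w b ih =>
    rw [f_abWord_append, abWord_singleton, vec_single] at h1
    by_cases h2 : l < f (vec (abWord w))
    · obtain ⟨v, c, h3, h4⟩ := ih h2
      exact ⟨v, c, segs_append.2 (Or.inl h3), h4⟩
    · exact ⟨abWord w, b, segs_append.2 (Or.inr (by simp [segs_singleton])), not_lt.1 h2, h1⟩

theorem f_morphPow (h : IsPisot g x lam f) (n : ℕ) (b : Letter d) :
    f (vec (abWord (morphPow g n b))) = lam ^ n * f (Pi.single b 1) := by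
  rw [abWord_morphPow, vec_mulVec_pow, h.left.f_pow, vec_single]

theorem f_mulVec (h : IsPisot g x lam f) (n : ℕ) (v : Letter d → ℤ) :
    f (vec ((morphMatrix g ^ n).mulVec v)) = lam ^ n * f (vec v) := by
  rw [vec_mulVec_pow, h.left.f_pow]

theorem exists_bound (h : IsPisot g x lam f) : ∃ F : ℝ, 0 < F ∧ ∀ b, f (Pi.single b 1) ≤ F :=
  ⟨∑ b, f (Pi.single b 1), Finset.sum_pos (fun b _ => h.pos b) Finset.univ_nonempty,
    fun b => Finset.single_le_sum (f := fun b => f (Pi.single b (1 : ℝ)))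
      (fun b _ => (h.pos b).le) (Finset.mem_univ b)⟩

theorem f_abWord_le {F : ℝ} (hF : ∀ b, f (Pi.single b 1) ≤ F) (w : List (Letter d)) :
    f (vec (abWord w)) ≤ F * w.length := by
  induction w with
  | nil => simp [abWord_nil, vec_zero]
  | cons b w ih =>
    rw [f_abWord_cons, List.length_cons]; push_cast; have := hF b; linarith

theorem growth (h : IsPisot g x lam f) (m : ℕ) : ∃ k, ∀ c, m < (morphPow g k c).length := by
  obtain ⟨F, hF0, hF⟩ := h.exists_bound
  have h1 : ∀ c : Letter d, ∀ᶠ k : ℕ in atTop, F * m < lam ^ k * f (Pi.single c 1) := fun c =>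
    ((tendsto_pow_atTop_atTop_of_one_lt h.one_lt).atTop_mul_const (h.pos c)).eventually_gt_atTop _
  obtain ⟨k, hk⟩ := (eventually_all.2 h1).exists
  refine ⟨k, fun c => ?_⟩
  have h2 := f_abWord_le hF (morphPow g k c)
  rw [h.f_morphPow] at h2
  have := lt_of_mul_lt_mul_left ((hk c).trans_le h2) hF0.le
  exact_mod_cast this

/-- Broken lines of all iterates stay near the line of `x`: a segment at level `m + N` is the image
under `M ^ N` of one at level `m`, with its distance halved, plus one of finitely many offsets. -/
theorem tube (h : IsPisot g x lam f) : ∃ R : ℝ, 0 ≤ R ∧ ∀ n b v c,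
    (v, c) ∈ segs (morphPow g n b) → ‖prj x (vec v)‖ ≤ R := by
  obtain ⟨N, hN, hN1⟩ := ((h.contracts.uniform_prj h.perron (ε := 1 / 2) (by norm_num)).and
    (eventually_ge_atTop 1)).exists
  have hfin : {y : (Letter d → ℤ) × Letter d | ∃ r ∈ Set.Iic N, ∃ b,
      y ∈ segs (morphPow g r b)}.Finite := by
    have : {y : (Letter d → ℤ) × Letter d | ∃ r ∈ Set.Iic N, ∃ b, y ∈ segs (morphPow g r b)} =
        ⋃ r ∈ Set.Iic N, ⋃ b, {y | y ∈ segs (morphPow g r b)} := by ext; simp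
    rw [this]
    exact (Set.finite_Iic N).biUnion fun r _ => Set.finite_iUnion fun b => List.finite_toSet _
  obtain ⟨B, hB⟩ := (hfin.image fun y => ‖prj x (vec y.1)‖).bddAbove
  have hB' : ∀ r ≤ N, ∀ b v c, (v, c) ∈ segs (morphPow g r b) → ‖prj x (vec v)‖ ≤ B :=
    fun r hr b v c hv => hB ⟨(v, c), ⟨r, hr, b, hv⟩, rfl⟩
  have hB0 : 0 ≤ B := (norm_nonneg _).trans (hB' 0 (Nat.zero_le _) 0 0 0
    (by simp [morphPow, segs_singleton]))
  -- The radius `R = 2 * B` is the fixed point of `R = R / 2 + B`.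
  refine ⟨2 * B, by positivity, fun n => ?_⟩
  induction n using Nat.strong_induction_on with
  | _ n ih =>
    intro b v c hv
    by_cases hn : n ≤ N
    · have := hB' n hn b v c hv; linarith
    · obtain ⟨m, rfl⟩ := Nat.exists_eq_add_of_le' (not_le.1 hn).le
      obtain ⟨v₁, c₁, u, h1, h2, rfl⟩ := segs_morphPow_add.1 hv
      have h3 := ih m (by omega) _ _ _ h1
      have h4 := hB' N le_rfl _ _ _ h2
      rw [vec_add, map_add, vec_mulVec_pow]
      refine (norm_add_le _ _).trans ?_
      have := hN (vec v₁)
      linarith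

variable {U : ℕ → ℕ → Letter d}

theorem morphPow_eq_prefix (hU : ∀ n, IsImage g (U (n + 1)) (U n)) (n k : ℕ) :
    ∃ l, morphPow g k (U (n + k) 0) = wordPrefix (U n) l := by
  obtain ⟨l, hl⟩ := IsImage.pow hU k n 1
  exact ⟨l, by rw [← hl]; simp [wordPrefix]⟩

/-- Every prefix of `U n` lies inside an iterated image of one letter, the first letter of a later
word; the bound is therefore uniform in `n`. -/
theorem infTube (h : IsPisot g x lam f) (hU : ∀ n, IsImage g (U (n + 1)) (U n)) :
    ∃ R : ℝ, 0 ≤ R ∧ ∀ n v c, InfSeg (U n) v c → ‖prj x (vec v)‖ ≤ R := by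
  obtain ⟨R, hR0, hR⟩ := h.tube
  refine ⟨R, hR0, fun n v c ⟨m, hm, hv⟩ => ?_⟩
  obtain ⟨k, hk⟩ := h.growth m
  obtain ⟨l, hl⟩ := morphPow_eq_prefix hU n k
  refine hR k (U (n + k) 0) v c ?_
  rw [hl]
  refine mem_segs_wordPrefix.2 ⟨m, ?_, hm, hv⟩
  have := hk (U (n + k) 0)
  rwa [hl, wordPrefix_length] at this

theorem exists_infSeg (h : IsPisot g x lam f) (hU : ∀ n, IsImage g (U (n + 1)) (U n)) (n : ℕ)
    (b : Letter d) : ∃ v, InfSeg (U n) v b := by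
  have h1 : ∀ c : Letter d, ∀ᶠ m in atTop, ∀ i, 0 < ((morphMatrix g ^ m).mulVec (Pi.single c 1)) i :=
    fun c => h.left.eventually_pos h.perron h.contracts (by rw [vec_single]; exact h.pos c)
  -- Some power of the matrix is positive, so `g ^ m` of any letter contains every letter.
  obtain ⟨m, hm⟩ := (eventually_all.2 h1).exists
  obtain ⟨l, hl⟩ := morphPow_eq_prefix hU n m
  have h2 := hm (U (n + m) 0) b
  rw [← abWord_morphPow, hl] at h2
  simp only [abWord, Nat.cast_pos, List.count_pos_iff] at h2
  obtain ⟨p, s, hs⟩ := List.append_of_mem h2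
  exact ⟨abWord p, InfSeg.of_prefix (k := l) (mem_segs.2 ⟨p, s, hs, rfl⟩)⟩

theorem f_prefix_le (h : IsPisot g x lam f) (U : ℕ → Letter d) {m k : ℕ} (hmk : m ≤ k) :
    f (vec (abWord (wordPrefix U m))) ≤ f (vec (abWord (wordPrefix U k))) := by
  obtain ⟨s, hs⟩ := wordPrefix_prefix U hmk
  rw [← hs, f_abWord_append]
  have := h.f_abWord_nonneg s
  linarith

theorem f_infSeg_nonneg (h : IsPisot g x lam f) {U : ℕ → Letter d} {v : Letter d → ℤ} {c : Letter d}
    (hv : InfSeg U v c) : 0 ≤ f (vec v) := by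
  obtain ⟨m, _, rfl⟩ := hv
  exact h.f_abWord_nonneg _

/-- Along one infinite word, height determines position: a segment whose starting height lies in the
range covered by the image of `(y, b)` must belong to that image. -/
theorem segs_of_infSeg (h : IsPisot g x lam f) {n : ℕ} {U U' : ℕ → Letter d}
    (hU : IsImage (morphPow g n) U U')
    {y w : Letter d → ℤ} {b a : Letter d} (hy : InfSeg U y b) (hw : InfSeg U' w a)
    (h1 : lam ^ n * f (vec y) ≤ f (vec w))
    (h2 : f (vec w) < lam ^ n * (f (vec y) + f (Pi.single b 1))) :
    (w - (morphMatrix g ^ n).mulVec y, a) ∈ segs (morphPow g n b) := by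
  obtain ⟨m, rfl, rfl⟩ := hy
  obtain ⟨k₀, hk₀⟩ := hU m
  obtain ⟨k₁, hk₁⟩ := hU (m + 1)
  have h3 : wordPrefix U' k₁ = wordPrefix U' k₀ ++ morphPow g n (U m) := by
    rw [← hk₁, ← hk₀, wordPrefix_succ]; simp
  have h4 : abWord (wordPrefix U' k₀) = (morphMatrix g ^ n).mulVec (abWord (wordPrefix U m)) := by
    rw [← hk₀, abWord_flatMap, morphMatrix_morphPow]
  have h5 : f (vec (abWord (wordPrefix U' k₀))) = lam ^ n * f (vec (abWord (wordPrefix U m))) := by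
    rw [h4, h.f_mulVec]
  have h6 : f (vec (abWord (wordPrefix U' k₁))) =
      lam ^ n * (f (vec (abWord (wordPrefix U m))) + f (Pi.single (U m) 1)) := by
    rw [h3, f_abWord_append, h5, h.f_morphPow]; ring
  obtain ⟨l, hl, rfl⟩ := hw
  have h7 : l < k₁ := by
    by_contra hlt
    have := h.f_prefix_le U' (not_lt.1 hlt)
    linarith
  have h8 : (abWord (wordPrefix U' l), a) ∈ segs (wordPrefix U' k₁) :=
    mem_segs_wordPrefix.2 ⟨l, h7, hl, rfl⟩
  rw [h3, segs_append, h4] at h8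
  rcases h8 with h8 | h8
  · obtain ⟨-, h9⟩ := h.segs_bounds h8
    have := h.pos a
    linarith
  · exact h8

theorem allCoincide_of_interior (h : IsPisot g x lam f) (hU : ∀ n, IsImage g (U (n + 1)) (U n))
    {a : Letter d} {z : Letter d → ℤ} {ε : ℝ} (hε : 0 < ε)
    (hz : ∀ w : Letter d → ℤ, 0 ≤ ∑ i, w i → ‖prj x (vec w) - prj x (vec z)‖ < ε →
      InfSeg (U 0) w a) : AllCoincide g f := by
  obtain ⟨R, hR0, hR⟩ := h.infTube hU
  obtain ⟨Cf, hCf0, hCf⟩ := linear_bound f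
  -- For large `n` the projection of `M ^ n (y + q)` is smaller than `ε`, uniformly in the position
  -- `y` by `infTube`, while `f q > 0` keeps the sum of the coordinates nonnegative.
  have near : ∀ q : Letter d → ℤ, 0 < f (vec q) → ∀ᶠ n in atTop, ∀ y b, InfSeg (U n) y b →
      InfSeg (U 0) (z + (morphMatrix g ^ n).mulVec (y + q)) a := by
    intro q hq
    set A := R + ‖prj x (vec q)‖ + 1 with hA
    have hA0 : 0 < A := by positivity
    have h1 := h.contracts.uniform_prj h.perron (ε := ε / (2 * A)) (by positivity)
    have h2 : ∀ᶠ n : ℕ in atTop, |ht (vec z)| + Cf * ε < lam ^ n * f (vec q) :=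
      ((tendsto_pow_atTop_atTop_of_one_lt h.one_lt).atTop_mul_const hq).eventually_gt_atTop _
    filter_upwards [h1, h2] with n hn1 hn2 y b hy
    have h3 : ‖prj x (vec ((morphMatrix g ^ n).mulVec (y + q)))‖ < ε := by
      rw [vec_mulVec_pow]
      refine (hn1 _).trans_lt ?_
      have h4 : ‖prj x (vec (y + q))‖ ≤ A := by
        rw [vec_add, map_add]
        refine (norm_add_le _ _).trans ?_
        have := hR n y b hy
        linarith
      calc ε / (2 * A) * ‖prj x (vec (y + q))‖ ≤ ε / (2 * A) * A := by gcongr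
        _ = ε / 2 := by field_simp
        _ < ε := by linarith
    refine hz _ ?_ ?_
    · have h4 := h.left.f_eq h.perron (vec ((morphMatrix g ^ n).mulVec (y + q)))
      rw [h.f_mulVec, vec_add, map_add] at h4
      have h5 := hCf (prj x (vec ((morphMatrix g ^ n).mulVec (y + q))))
      have h6 : Cf * ‖prj x (vec ((morphMatrix g ^ n).mulVec (y + q)))‖ ≤ Cf * ε := by gcongr
      have h7 := h.f_infSeg_nonneg hy
      have h8 : 0 ≤ lam ^ n * f (vec y) := mul_nonneg (by have := h.one_lt; positivity) h7
      have h9 : 0 ≤ ht (vec (z + (morphMatrix g ^ n).mulVec (y + q))) := by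
        rw [vec_add, map_add]
        have := abs_le.1 (h5.trans h6)
        have := neg_abs_le (ht (vec z))
        have : lam ^ n * (f (vec y) + f (vec q)) = lam ^ n * f (vec y) + lam ^ n * f (vec q) := by
          ring
        linarith
      rw [ht_vec] at h9
      exact_mod_cast h9
    · rw [vec_add, map_add, add_sub_cancel_left]; exact h3
  intro b t b' ⟨ho1, ho2⟩
  -- An integer point whose height lies strictly inside both segments. Seen from the second segment
  -- it is `q - t`, and both descriptions lead to the same point `z + M ^ n q`.
  obtain ⟨q, hq1, hq2⟩ := h.left.exists_between h.perron h.contracts h.one_le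
    (a := max 0 (f (vec t))) (b := min (f (Pi.single b 1)) (f (vec t) + f (Pi.single b' 1)))
    (by rw [max_lt_iff, lt_min_iff, lt_min_iff]
        exact ⟨⟨h.pos b, ho2⟩, ho1, by have := h.pos b'; linarith⟩)
  rw [max_lt_iff] at hq1
  rw [lt_min_iff] at hq2
  have hqt : f (vec (q - t)) = f (vec q) - f (vec t) := by rw [vec_sub, map_sub]
  have grow : ∀ (r s : ℝ), 0 < s → ∀ᶠ n : ℕ in atTop, r < lam ^ n * s := fun r s hs =>
    ((tendsto_pow_atTop_atTop_of_one_lt h.one_lt).atTop_mul_const hs).eventually_gt_atTop _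
  have key : ∀ (q : Letter d → ℤ) (b : Letter d), 0 < f (vec q) → f (vec q) < f (Pi.single b 1) →
      ∀ᶠ n in atTop, (z + (morphMatrix g ^ n).mulVec q, a) ∈ segs (morphPow g n b) := by
    intro q b h0 h1
    filter_upwards [near q h0, grow (-f (vec z)) _ h0, grow (f (vec z)) _ (sub_pos.2 h1)]
      with n hn1 hn2 hn3
    obtain ⟨y, hy⟩ := h.exists_infSeg hU n b
    have h2 := hn1 y b hy
    have h3 : f (vec (z + (morphMatrix g ^ n).mulVec (y + q))) =
        f (vec z) + lam ^ n * f (vec y) + lam ^ n * f (vec q) := by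
      rw [vec_add, map_add, h.f_mulVec, vec_add, map_add]; ring
    have hI := IsImage.pow hU n 0
    rw [zero_add] at hI
    have h4 := h.segs_of_infSeg hI hy h2 (by rw [h3]; linarith) (by rw [h3]; linarith)
    rw [Matrix.mulVec_add] at h4
    convert h4 using 2
    abel
  obtain ⟨n, hn1, hn2⟩ := ((key q b hq1.1 hq2.1).and
    (key (q - t) b' (by linarith) (by linarith))).exists
  refine ⟨n, _, _, hn1, ?_⟩
  rw [Matrix.mulVec_sub] at hn2
  convert hn2 using 2
  abel

end IsPisot

end Overlaps

/-! ### Coincidence forces interior -/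

section Interior

variable {d : ℕ} {g : Letter d → List (Letter d)} {x : Letter d → ℝ} {lam : ℝ}
  {f : (Letter d → ℝ) →ₗ[ℝ] ℝ}

namespace IsPisot

/-- Projection and height together bound the component along `x`, hence all coordinates. -/
theorem finite_bounded (h : IsPisot g x lam f) (A C : ℝ) :
    {t : Letter d → ℤ | ‖prj x (vec t)‖ ≤ A ∧ |f (vec t)| ≤ C}.Finite := by
  obtain ⟨Cf, hCf0, hCf⟩ := linear_bound f
  set B := ⌈C + Cf * A + A⌉ with hB
  refine (Set.finite_Icc (fun _ : Letter d => -B) (fun _ => B)).subset fun t ⟨h1, h2⟩ => ?_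
  have h3 := h.left.f_eq h.perron (vec t)
  have h4 := (hCf (prj x (vec t))).trans (mul_le_mul_of_nonneg_left h1 hCf0)
  have h5 : |ht (vec t)| ≤ C + Cf * A := by
    rw [show ht (vec t) = f (vec t) - f (prj x (vec t)) by linarith]
    exact (abs_sub _ _).trans (add_le_add h2 h4)
  have h6 : ∀ i, |(t i : ℝ)| ≤ C + Cf * A + A := by
    intro i
    have h7 : (t i : ℝ) = ht (vec t) * x i + prj x (vec t) i := by
      have := congrFun (h.perron.eq_add (vec t)) i
      simpa [vec] using this
    rw [h7]
    refine (abs_add_le _ _).trans (add_le_add ?_ ((norm_le_pi_norm _ i).trans h1))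
    rw [abs_mul, abs_of_nonneg (h.perron.x_nonneg i)]
    have := h.perron.x_le_one i
    have := h.perron.x_nonneg i
    nlinarith [abs_nonneg (ht (vec t))]
  have h8 : ∀ i, |t i| ≤ B := by
    intro i
    have := (h6 i).trans (Int.le_ceil _)
    exact_mod_cast this
  exact ⟨fun i => (abs_le.1 (h8 i)).1, fun i => (abs_le.1 (h8 i)).2⟩

/-- Simultaneous coincidence of one segment with all segments of a finite set that reach a suitable
interval of heights. -/
theorem sync (h : IsPisot g x lam f) (hall : AllCoincide g f) (b₀ : Letter d)
    (B : Finset ((Letter d → ℤ) × Letter d)) :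
    ∃ n z a j₀ j₁, (z, a) ∈ segs (morphPow g n b₀) ∧ j₀ < j₁ ∧ f (vec z) ≤ lam ^ n * j₀ ∧
      lam ^ n * j₁ ≤ f (vec z) + f (Pi.single a 1) ∧
      ∀ t b', (t, b') ∈ B → f (vec t) < j₁ → j₀ < f (vec t) + f (Pi.single b' 1) →
        (z - (morphMatrix g ^ n).mulVec t, a) ∈ segs (morphPow g n b') := by
  induction B using Finset.induction_on with
  | empty =>
    exact ⟨0, 0, b₀, 0, f (Pi.single b₀ 1), by simp [morphPow, segs_singleton], h.pos b₀,
      by simp [vec_zero], by simp [vec_zero], by simp⟩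
  | insert p B _ ih =>
    obtain ⟨t, b'⟩ := p
    obtain ⟨n, z, a, j₀, j₁, hz, hj, hj0, hj1, hB⟩ := ih
    -- The window `[j₀, j₁]`, in heights before applying `g ^ n`, only shrinks during the induction;
    -- a segment that misses it imposes no condition.
    by_cases hmeet : f (vec t) < j₁ ∧ j₀ < f (vec t) + f (Pi.single b' 1)
    swap
    · refine ⟨n, z, a, j₀, j₁, hz, hj, hj0, hj1, fun t' c' hm h1 h2 => ?_⟩
      rcases Finset.mem_insert.1 hm with hm | hm
      · obtain ⟨rfl, rfl⟩ := Prod.ext_iff.1 hm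
        exact absurd ⟨h1, h2⟩ hmeet
      · exact hB t' c' hm h1 h2
    obtain ⟨l₀, l₁, hl, hl0, hl0', hl1, hl1'⟩ : ∃ l₀ l₁, l₀ < l₁ ∧ j₀ ≤ l₀ ∧ f (vec t) ≤ l₀ ∧
        l₁ ≤ j₁ ∧ l₁ ≤ f (vec t) + f (Pi.single b' 1) :=
      ⟨max j₀ (f (vec t)), min j₁ (f (vec t) + f (Pi.single b' 1)), by
        rw [max_lt_iff, lt_min_iff, lt_min_iff]
        exact ⟨⟨hj, hmeet.2⟩, hmeet.1, by have := h.pos b'; linarith⟩,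
        le_max_left _ _, le_max_right _ _, min_le_left _ _, min_le_right _ _⟩
    obtain ⟨F, hF0, hF⟩ := h.exists_bound
    have hlam := h.one_lt
    obtain ⟨m, hm⟩ : ∃ m : ℕ, 2 * F < lam ^ m * (lam ^ n * (l₁ - l₀)) :=
      (((tendsto_pow_atTop_atTop_of_one_lt hlam).atTop_mul_const
        (by have := sub_pos.2 hl; positivity)).eventually_gt_atTop _).exists
    have hln : (0 : ℝ) < lam ^ n := by positivity
    have hlm : (0 : ℝ) < lam ^ m := by positivity
    -- After `m` more steps, `μ` is farther than the longest letter from both ends of the common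
    -- window. The two descendants covering `μ` overlap, and the one issued from `(z, a)` stays in
    -- the window.
    set μ := lam ^ m * (lam ^ n * ((l₀ + l₁) / 2)) with hμ
    have e1 : lam ^ m * (lam ^ n * l₀) + F < μ := by rw [hμ]; linarith
    have e2 : μ + F < lam ^ m * (lam ^ n * l₁) := by rw [hμ]; linarith
    have g1 : lam ^ n * j₀ ≤ lam ^ n * l₀ := by gcongr
    have g2 : lam ^ n * l₁ ≤ lam ^ n * j₁ := by gcongr
    have g3 : lam ^ n * f (vec t) ≤ lam ^ n * l₀ := by gcongr
    have g4 : lam ^ n * l₁ ≤ lam ^ n * (f (vec t) + f (Pi.single b' 1)) := by gcongr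
    have k1 : lam ^ m * f (vec z) ≤ lam ^ m * (lam ^ n * l₀) := by gcongr; linarith
    have k2 : lam ^ m * (lam ^ n * l₁) ≤ lam ^ m * (f (vec z) + f (Pi.single a 1)) := by
      gcongr; linarith
    have k3 := mul_le_mul_of_nonneg_left g3 hlm.le
    have k4 := mul_le_mul_of_nonneg_left g4 hlm.le
    obtain ⟨v₂, a₂, hv2, hv2a, hv2b⟩ := cover (f := f) (morphPow g m a) (l := μ - lam ^ m * f (vec z))
      (by linarith) (by rw [h.f_morphPow]; linarith)
    have hpow : lam ^ (n + m) = lam ^ m * lam ^ n := by rw [pow_add, mul_comm]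
    obtain ⟨t₂, b₂, ht2, ht2a, ht2b⟩ := cover (f := f) (morphPow g (n + m) b')
      (l := μ - lam ^ (n + m) * f (vec t))
      (by rw [hpow, mul_assoc]; linarith)
      (by rw [h.f_morphPow, hpow, mul_assoc, mul_assoc]; linarith)
    set z₂ := (morphMatrix g ^ m).mulVec z + v₂ with hz2
    set T := (morphMatrix g ^ (n + m)).mulVec t + t₂ - z₂ with hT
    have fz2 : f (vec z₂) = lam ^ m * f (vec z) + f (vec v₂) := by
      rw [hz2, vec_add, map_add, h.f_mulVec]
    have fT : f (vec T) = lam ^ (n + m) * f (vec t) + f (vec t₂) - f (vec z₂) := by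
      rw [hT, vec_sub, vec_add, map_sub, map_add, h.f_mulVec]
    obtain ⟨k, v₃, c, hv3, hv3'⟩ := hall a₂ T b₂ ⟨by linarith, by linarith⟩
    have hlk : (0 : ℝ) < lam ^ k := by positivity
    obtain ⟨s1, s2⟩ := h.segs_bounds hv3
    rw [h.f_morphPow] at s2
    set z' := (morphMatrix g ^ k).mulVec z₂ + v₃ with hz'
    have fz' : f (vec z') = lam ^ k * f (vec z₂) + f (vec v₃) := by
      rw [hz', vec_add, map_add, h.f_mulVec]
    have hFa := hF a₂
    have hpow' : lam ^ (n + m + k) = lam ^ k * (lam ^ m * lam ^ n) := by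
      rw [pow_add, hpow, mul_comm]
    have hbig : 0 < lam ^ (n + m + k) := by positivity
    have q1 : lam ^ (n + m + k) * l₀ ≤ f (vec z') := by
      rw [fz', hpow', mul_assoc, mul_assoc]
      have : lam ^ k * (lam ^ m * (lam ^ n * l₀)) ≤ lam ^ k * f (vec z₂) := by gcongr; linarith
      linarith
    have q2 : f (vec z') + f (Pi.single c 1) ≤ lam ^ (n + m + k) * l₁ := by
      rw [fz', hpow', mul_assoc, mul_assoc]
      have : lam ^ k * (f (vec z₂) + f (Pi.single a₂ 1)) ≤ lam ^ k * (lam ^ m * (lam ^ n * l₁)) := by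
        gcongr; linarith
      linarith
    have q3 := h.pos c
    -- The new window is exactly the pulled-back height range of the coincident segment. It is
    -- contained in the old one, so earlier synchronizations persist.
    refine ⟨n + m + k, z', c, f (vec z') / lam ^ (n + m + k),
      (f (vec z') + f (Pi.single c 1)) / lam ^ (n + m + k), ?_, ?_, ?_, ?_, ?_⟩
    · exact segs_morphPow_add.2 ⟨z₂, a₂, v₃, segs_morphPow_add.2 ⟨z, a, v₂, hz, hv2, rfl⟩, hv3, rfl⟩
    · gcongr; linarith
    · rw [mul_div_cancel₀ _ hbig.ne']
    · rw [mul_div_cancel₀ _ hbig.ne']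
    · intro t' c' hmem m1 m2
      have r0 : l₀ ≤ f (vec z') / lam ^ (n + m + k) := by
        rw [le_div_iff₀ hbig]; linarith
      have r1 : (f (vec z') + f (Pi.single c 1)) / lam ^ (n + m + k) ≤ l₁ := by
        rw [div_le_iff₀ hbig]; linarith
      rcases Finset.mem_insert.1 hmem with hm' | hm'
      · obtain ⟨rfl, rfl⟩ := Prod.ext_iff.1 hm'
        refine segs_morphPow_add.2 ⟨t₂, b₂, _, ht2, hv3', ?_⟩
        simp only [hz', hT, Matrix.mulVec_sub, Matrix.mulVec_add, Matrix.mulVec_mulVec, ← pow_add]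
        rw [show k + (n + m) = n + m + k by ring]
        abel
      · have := hB t' c' hm' (by linarith) (by linarith)
        refine segs_morphPow_add.2 ⟨_, a₂, v₃, segs_morphPow_add.2 ⟨_, a, v₂, this, hv2, rfl⟩, hv3, ?_⟩
        rw [hz', hz2, Matrix.mulVec_sub, Matrix.mulVec_mulVec, ← pow_add, Matrix.mulVec_add,
          Matrix.mulVec_add, Matrix.mulVec_sub, Matrix.mulVec_mulVec, Matrix.mulVec_mulVec,
          ← pow_add, ← pow_add, show k + (m + n) = n + m + k by ring]
        abel

variable {U : ℕ → ℕ → Letter d}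

theorem infCover (h : IsPisot g x lam f) (U : ℕ → Letter d) {l : ℝ} (hl : 0 ≤ l) :
    ∃ v c, InfSeg U v c ∧ f (vec v) ≤ l ∧ l < f (vec v) + f (Pi.single c 1) := by
  obtain ⟨e, he0, he⟩ : ∃ e : ℝ, 0 < e ∧ ∀ b, e ≤ f (Pi.single b 1) := by
    obtain ⟨b, -, hb⟩ := Finset.exists_min_image Finset.univ
      (fun b : Letter d => f (Pi.single b (1 : ℝ))) Finset.univ_nonempty
    exact ⟨_, h.pos b, fun c => hb c (Finset.mem_univ c)⟩
  obtain ⟨m, hm⟩ := exists_nat_gt (l / e)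
  rw [div_lt_iff₀ he0] at hm
  have h1 : ∀ w : List (Letter d), w.length * e ≤ f (vec (abWord w)) := by
    intro w
    induction w with
    | nil => simp [abWord_nil, vec_zero]
    | cons b w ih =>
      rw [f_abWord_cons, List.length_cons]; push_cast; have := he b; linarith
  have h2 := h1 (wordPrefix U m)
  rw [wordPrefix_length] at h2
  obtain ⟨v, c, h3, h4⟩ := cover (f := f) (wordPrefix U m) hl (by linarith)
  exact ⟨v, c, InfSeg.of_prefix h3, h4⟩

theorem interior_of_allCoincide (h : IsPisot g x lam f) (hU : ∀ n, IsImage g (U (n + 1)) (U n))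
    (hall : AllCoincide g f) : ∃ (a : Letter d) (z : Letter d → ℤ) (ε : ℝ), 0 ≤ ∑ i, z i ∧ 0 < ε ∧
      ∀ w : Letter d → ℤ, 0 ≤ ∑ i, w i → ‖prj x (vec w) - prj x (vec z)‖ < ε →
        InfSeg (U 0) w a := by
  obtain ⟨R, hR0, hR⟩ := h.infTube hU
  obtain ⟨Cf, hCf0, hCf⟩ := linear_bound f
  obtain ⟨F, hF0, hF⟩ := h.exists_bound
  have hlam := h.one_lt
  -- Two positions in the tube contribute `R` each, and the displacement `τ` below contributes at
  -- most one.
  have hfin : {p : (Letter d → ℤ) × Letter d | (‖prj x (vec p.1)‖ ≤ 2 * R + 1 ∧ |f (vec p.1)| ≤ F) ∧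
      p.2 ∈ Set.univ}.Finite :=
    (h.finite_bounded (2 * R + 1) F).prod Set.finite_univ
  obtain ⟨n, z, a, j₀, j₁, hz, hj, hj0, hj1, hB⟩ := h.sync hall 0 hfin.toFinset
  have hln : (0 : ℝ) < lam ^ n := by positivity
  obtain ⟨y₀, hy0⟩ := h.exists_infSeg hU n 0
  obtain ⟨sb0, sb1⟩ := h.segs_bounds hz
  rw [h.f_morphPow] at sb1
  have hI := IsImage.pow hU n 0
  rw [zero_add] at hI
  set z₀ := (morphMatrix g ^ n).mulVec y₀ + z with hz0
  have hz0seg : InfSeg (U 0) z₀ a := by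
    have := InfSeg.image hI hy0 hz
    rwa [morphMatrix_morphPow] at this
  have hdet : IsUnit (morphMatrix g ^ n).det := by
    rw [Matrix.det_pow]; exact h.perron.det.pow n
  have hinv : ∀ w : Letter d → ℤ, (morphMatrix g ^ n).mulVec (((morphMatrix g ^ n)⁻¹).mulVec w) = w := by
    intro w; rw [Matrix.mulVec_mulVec, Matrix.mul_nonsing_inv _ hdet, Matrix.one_mulVec]
  obtain ⟨Ci, hCi0, hCi⟩ := linear_bound' (prj x ∘ₗ (rl (morphMatrix g ^ n)⁻¹).mulVecLin)
  have hprj : ∀ w : Letter d → ℤ,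
      ‖prj x (vec ((morphMatrix g ^ n)⁻¹.mulVec w))‖ ≤ Ci * ‖prj x (vec w)‖ := by
    intro w
    have h1 := hCi (prj x (vec w))
    have h2 : (rl (morphMatrix g ^ n)⁻¹).mulVec x = (lam ^ n)⁻¹ • x := by
      have h3 := congrArg (fun v => (rl (morphMatrix g ^ n)⁻¹).mulVec v) (h.perron.eig_pow n)
      simp only [← rl_pow, Matrix.mulVec_mulVec, ← rl_mul, Matrix.nonsing_inv_mul _ hdet, rl_one,
        Matrix.one_mulVec, Matrix.mulVec_smul] at h3
      rw [eq_inv_smul_iff₀ hln.ne']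
      exact h3.symm
    rw [LinearMap.comp_apply, Matrix.mulVecLin_apply, prj_apply x (vec w), Matrix.mulVec_sub,
      Matrix.mulVec_smul, h2, map_sub, map_smul, map_smul, h.perron.prj_self, ← vec_mulVec] at h1
    simpa [prj_apply x (vec w)] using h1
  -- Half-space points near `z₀` but too low to be reached lie in this finite set. As the projection
  -- is injective on integer vectors, a small `ε` excludes all of them except possibly `z₀` itself.
  set Low := {w : Letter d → ℤ | ‖prj x (vec w)‖ ≤ ‖prj x (vec z₀)‖ + 1 ∧
    |f (vec w)| ≤ |f (vec z)| + Cf * (‖prj x (vec z₀)‖ + 1)} with hLow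
  have hLfin : Low.Finite := h.finite_bounded _ _
  have hev : ∀ᶠ ε in 𝓝[>] (0 : ℝ), ∀ w ∈ Low, w ≠ z₀ → ε < ‖prj x (vec w) - prj x (vec z₀)‖ := by
    refine (Filter.eventually_all_finite hLfin).2 fun w _ => ?_
    by_cases hw : w = z₀
    · simp [hw]
    have : 0 < ‖prj x (vec w) - prj x (vec z₀)‖ := by
      rw [norm_pos_iff, ← map_sub, ← vec_sub]
      intro h0
      exact hw (sub_eq_zero.1 (h.perron.prj_int_ne_zero h.contracts h.one_le h0))
    filter_upwards [nhdsWithin_le_nhds (Iio_mem_nhds this)] with ε hε _ using hε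
  have hev2 : ∀ᶠ ε in 𝓝[>] (0 : ℝ), Ci * ε < 1 := by
    have : Tendsto (fun ε : ℝ => Ci * ε) (𝓝[>] 0) (𝓝 (Ci * 0)) :=
      (tendsto_id.const_mul Ci).mono_left nhdsWithin_le_nhds
    rw [mul_zero] at this
    exact this.eventually_lt_const one_pos
  have hev3 : ∀ᶠ ε in 𝓝[>] (0 : ℝ), ε < 1 := nhdsWithin_le_nhds (Iio_mem_nhds one_pos)
  obtain ⟨ε, ⟨⟨hε1, hε2⟩, hε3⟩, hε0⟩ :=
    (((hev.and hev2).and hev3).and self_mem_nhdsWithin).exists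
  refine ⟨a, z₀, ε, ?_, hε0, fun w hw0 hw => ?_⟩
  · obtain ⟨m, _, hm⟩ := hz0seg
    rw [hm, sum_abWord]; positivity
  by_cases hwz : w = z₀
  · rw [hwz]; exact hz0seg
  have hprjw : ‖prj x (vec w)‖ ≤ ‖prj x (vec z₀)‖ + 1 := by
    have := norm_sub_norm_le (prj x (vec w)) (prj x (vec z₀))
    linarith
  have hfw : f (vec z) ≤ f (vec w) := by
    by_contra hlt
    push Not at hlt
    refine absurd (hε1 w ⟨hprjw, ?_⟩ hwz) (not_lt.2 hw.le)
    have h1 := h.left.f_eq h.perron (vec w)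
    have h2 : 0 ≤ ht (vec w) := by rw [ht_vec]; exact_mod_cast hw0
    have h3 := (hCf (prj x (vec w))).trans (mul_le_mul_of_nonneg_left hprjw hCf0)
    have h4 := (abs_le.1 h3).1
    have h5 : 0 ≤ Cf * (‖prj x (vec z₀)‖ + 1) := by positivity
    rw [abs_le]
    constructor
    · have := abs_nonneg (f (vec z)); linarith
    · have := le_abs_self (f (vec z)); linarith
  -- Moving from `z₀` to `w` amounts to moving by the small integer vector `τ` at level `n`; the
  -- segment found there at the right height has one of the synchronized offsets.
  set τ := (morphMatrix g ^ n)⁻¹.mulVec (w - z₀) with hτ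
  have hMτ : (morphMatrix g ^ n).mulVec τ = w - z₀ := hinv _
  have hτ1 : ‖prj x (vec τ)‖ ≤ 1 := by
    refine (hprj _).trans ?_
    rw [vec_sub, map_sub]
    have : Ci * ‖prj x (vec w) - prj x (vec z₀)‖ ≤ Ci * ε := by gcongr
    linarith
  have hfy : 0 ≤ f (vec (y₀ + τ)) := by
    have h1 : lam ^ n * f (vec (y₀ + τ)) = f (vec w) - f (vec z) := by
      rw [← h.f_mulVec, Matrix.mulVec_add, hMτ, hz0, ← map_sub, ← vec_sub]
      congr 2; abel
    refine nonneg_of_mul_nonneg_right (a := lam ^ n) ?_ hln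
    rw [h1]; linarith
  have hj0' : 0 ≤ j₀ := nonneg_of_mul_nonneg_right (sb0.trans hj0) hln
  have hj1' : j₁ ≤ F := by
    have : lam ^ n * j₁ ≤ lam ^ n * f (Pi.single 0 1) := by linarith
    exact (le_of_mul_le_mul_left this hln).trans (hF 0)
  -- The midpoint of the window ensures that the covering segment meets the window, as `sync`
  -- requires.
  obtain ⟨y₂, b₂, hy2, hy2a, hy2b⟩ := h.infCover (U n) (l := (j₀ + j₁) / 2 + f (vec (y₀ + τ)))
    (by linarith)
  have ft : f (vec (y₂ - (y₀ + τ))) = f (vec y₂) - f (vec (y₀ + τ)) := by rw [vec_sub, map_sub]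
  have hFb := hF b₂
  have hmem : (y₂ - (y₀ + τ), b₂) ∈ hfin.toFinset := by
    rw [Set.Finite.mem_toFinset]
    refine ⟨⟨?_, ?_⟩, Set.mem_univ _⟩
    · show ‖prj x (vec (y₂ - (y₀ + τ)))‖ ≤ _
      rw [vec_sub, vec_add, map_sub, map_add]
      refine (norm_sub_le _ _).trans ?_
      have := norm_add_le (prj x (vec y₀)) (prj x (vec τ))
      have := hR n _ _ hy0
      have := hR n _ _ hy2
      linarith
    · show |f (vec (y₂ - (y₀ + τ)))| ≤ F
      rw [ft, abs_le]
      constructor <;> linarith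
  have hseg := hB _ _ hmem (by rw [ft]; linarith) (by rw [ft]; linarith)
  have := InfSeg.image hI hy2 hseg
  rw [morphMatrix_morphPow, Matrix.mulVec_sub, Matrix.mulVec_add, hMτ] at this
  convert this using 1
  rw [hz0]; abel

end IsPisot

theorem interior_worm_nonempty_iff (x : stdSimplex ℝ (Letter d)) (u : ℕ → Letter d) (a : Letter d) :
    (@interior _ (halfSpaceTopology x) (worm u a)).Nonempty ↔
      ∃ (z : Letter d → ℤ) (ε : ℝ), 0 ≤ ∑ i, z i ∧ 0 < ε ∧ ∀ w : Letter d → ℤ, 0 ≤ ∑ i, w i →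
        ‖prj x.1 (vec w) - prj x.1 (vec z)‖ < ε → InfSeg u w a := by
  have hpr : ∀ w : Letter d → ℤ, (proj x (fun i => (w i : ℝ))).1 = prj x.1 (vec w) := by
    intro w; ext i; simp [proj, prj_apply, ht_apply, vec]
  have hdist : ∀ w z : Letter d → ℤ, dist (proj x (fun i => (w i : ℝ))) (proj x (fun i => (z i : ℝ)))
      = ‖prj x.1 (vec w) - prj x.1 (vec z)‖ := by
    intro w z; rw [Subtype.dist_eq, hpr, hpr, dist_eq_norm]
  let := halfSpaceTopology x
  constructor
  · rintro ⟨z, hz⟩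
    rw [mem_interior_iff_mem_nhds, nhds_induced, Filter.mem_comap] at hz
    obtain ⟨V, hV, hsub⟩ := hz
    obtain ⟨ε, hε, hball⟩ := Metric.mem_nhds_iff.1 hV
    refine ⟨z.1, ε, z.2, hε, fun w hw hwz => ?_⟩
    rw [← hdist] at hwz
    exact hsub (a := ⟨w, hw⟩) (hball hwz)
  · rintro ⟨z, ε, hz0, hε, hz⟩
    let z' : HalfSpace d := ⟨z, hz0⟩
    refine ⟨z', ?_⟩
    rw [mem_interior_iff_mem_nhds, nhds_induced, Filter.mem_comap]
    refine ⟨_, Metric.ball_mem_nhds _ hε, fun w hw => ?_⟩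
    refine hz w.1 w.2 ?_
    rw [← hdist]; exact hw

end Interior

/-! ### Contraction in terms of eigenvalues and traces -/

section Spectral

variable {d : ℕ}

open Polynomial in
-- Factor `p` into linear terms: each `det (A - r)` is, up to sign, the characteristic polynomial at
-- `r`. No triangularization is needed.
theorem det_aeval_eq_prod (A : Matrix (Letter d) (Letter d) ℂ) (p : ℂ[X]) :
    (aeval A p).det = (A.charpoly.roots.map fun r => p.eval r).prod := by
  have hs : A.charpoly.Splits := IsAlgClosed.splits _
  have hcard : A.charpoly.roots.card = d + 1 := by
    rw [splits_iff_card_roots.1 hs, Matrix.charpoly_natDegree_eq_dim]; simp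
  have hlin : ∀ r : ℂ, (aeval A (X - C r)).det =
      (A.charpoly.roots.map fun s => (X - C r).eval s).prod := by
    intro r
    have h1 : (A.charpoly).eval r = (A.charpoly.roots.map fun s => r - s).prod := by
      conv_lhs => rw [hs.eq_prod_roots_of_monic A.charpoly_monic]
      rw [eval_multiset_prod, Multiset.map_map]
      simp
    rw [Matrix.eval_charpoly] at h1
    have h2 : aeval A (X - C r) = -(Matrix.scalar (Letter d) r - A) := by
      simp [Algebra.algebraMap_eq_smul_one, Matrix.smul_one_eq_diagonal]
    rw [h2, Matrix.det_neg, h1]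
    have h3 : (fun s : ℂ => (X - C r).eval s) = fun s => (-1) * (r - s) := by
      funext s; simp
    rw [h3, Multiset.prod_map_mul]
    simp [hcard]
    rw [pow_succ]; ring
  rw [(IsAlgClosed.splits p).eq_prod_roots]
  generalize p.leadingCoeff = c
  induction p.roots using Multiset.induction_on with
  | empty =>
    simp [hcard, Algebra.algebraMap_eq_smul_one, pow_succ']
  | cons r s ih =>
    have h4 : C c * ((r ::ₘ s).map fun x => X - C x).prod =
        (X - C r) * (C c * (s.map fun x => X - C x).prod) := by
      rw [Multiset.map_cons, Multiset.prod_cons]; ring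
    rw [h4, map_mul, Matrix.det_mul, hlin, ih, ← Multiset.prod_map_mul]
    simp only [eval_mul]

open Polynomial in
-- Apply the determinant formula to `μ - X ^ n` and compare the polynomials at all `μ`.
-- Multiplicities are kept, as traces require.
theorem charpoly_pow_roots (A : Matrix (Letter d) (Letter d) ℂ) (n : ℕ) :
    (A ^ n).charpoly.roots = A.charpoly.roots.map (· ^ n) := by
  have h : (A ^ n).charpoly = ((A.charpoly.roots.map (· ^ n)).map fun r => X - C r).prod := by
    refine Polynomial.funext fun μ => ?_
    have h1 := det_aeval_eq_prod A (C μ - X ^ n)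
    have h2 : aeval A (C μ - X ^ n) = Matrix.scalar (Letter d) μ - A ^ n := by
      simp [Algebra.algebraMap_eq_smul_one, Matrix.smul_one_eq_diagonal]
    rw [Matrix.eval_charpoly, ← h2, h1, eval_multiset_prod, Multiset.map_map, Multiset.map_map]
    simp
  rw [h, roots_multiset_prod_X_sub_C]

/-- The eigenvalues of a complex matrix, with multiplicity. -/
theorem exists_eigenvalues (A : Matrix (Letter d) (Letter d) ℂ) : ∃ β : Letter d → ℂ,
    (∀ n, (A ^ n).trace = ∑ i, β i ^ n) ∧
      ∀ μ, (∃ i, β i = μ) ↔ (Matrix.scalar (Letter d) μ - A).det = 0 := by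
  have hs : A.charpoly.Splits := IsAlgClosed.splits _
  have hcard : A.charpoly.roots.card = d + 1 := by
    rw [Polynomial.splits_iff_card_roots.1 hs, Matrix.charpoly_natDegree_eq_dim]; simp
  have hl : A.charpoly.roots.toList.length = d + 1 := by rw [Multiset.length_toList, hcard]
  let β : Letter d → ℂ := fun i => A.charpoly.roots.toList.get (i.cast hl.symm)
  have hβ : List.ofFn β = A.charpoly.roots.toList := by
    refine List.ext_getElem (by simp [hl]) fun i h1 h2 => by
      rw [List.getElem_ofFn]; simp [β]
  have hβ' : A.charpoly.roots = (List.ofFn β : Multiset ℂ) := by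
    rw [hβ, Multiset.coe_toList]
  refine ⟨β, fun n => ?_, fun μ => ?_⟩
  · rw [Matrix.trace_eq_sum_roots_charpoly, charpoly_pow_roots, hβ', Multiset.map_coe,
      Multiset.sum_coe, List.map_ofFn, List.sum_ofFn]
    rfl
  · have h1 : (∃ i, β i = μ) ↔ μ ∈ A.charpoly.roots := by
      rw [hβ', Multiset.mem_coe, List.mem_ofFn]
    rw [h1, Polynomial.mem_roots A.charpoly_monic.ne_zero, Polynomial.IsRoot, Matrix.eval_charpoly]

/-- Simultaneous recurrence of finitely many rotations. -/
theorem exists_recurrence {ι : Type*} [Fintype ι] (ω : ι → ℂ) (hω : ∀ i, ‖ω i‖ = 1) (N : ℕ) {ε : ℝ}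
    (hε : 0 < ε) : ∃ n ≥ N, ∀ i, ‖ω i ^ n - 1‖ < ε := by
  have hc : IsCompact (Metric.closedBall (0 : ι → ℂ) 1) := isCompact_closedBall 0 1
  obtain ⟨a, -, φ, hφ, hlim⟩ := hc.tendsto_subseq (x := fun n i => ω i ^ n) (fun n => by
    rw [mem_closedBall_zero_iff]
    exact (pi_norm_le_iff_of_nonneg zero_le_one).2 fun i => by simp [hω])
  obtain ⟨K, hK⟩ := Metric.cauchySeq_iff.1 hlim.cauchySeq ε hε
  have h1 := hK (K + N) (by omega) K le_rfl
  have h2 : φ K + N ≤ φ (K + N) := by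
    induction N with
    | zero => simp
    | succ N ih =>
      have := hφ (show K + N < K + (N + 1) by omega)
      have := ih (hK (K + N) (by omega) K le_rfl)
      omega
  refine ⟨φ (K + N) - φ K, by omega, fun i => ?_⟩
  have h3 := (dist_le_pi_dist _ _ i).trans_lt h1
  simp only [Function.comp, dist_eq_norm] at h3
  have h4 : ω i ^ φ (K + N) = ω i ^ φ K * ω i ^ (φ (K + N) - φ K) := by
    rw [← pow_add]; congr 1; omega
  rw [h4, show ω i ^ φ K * ω i ^ (φ (K + N) - φ K) - ω i ^ φ K =
    ω i ^ φ K * (ω i ^ (φ (K + N) - φ K) - 1) by ring, norm_mul, norm_pow, hω, one_pow,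
    one_mul] at h3
  exact h3

/-- Arbitrarily large times at which all the `β iⁿ` are close to the positive half-line. -/
theorem exists_phase {ι : Type*} [Fintype ι] (β : ι → ℂ) (N : ℕ) : ∃ n ≥ N,
    (∀ i, 1 / 2 * ‖β i‖ ^ n ≤ (β i ^ n).re) ∧ ∀ i j, 0 ≤ (β i ^ n * β j ^ n).re := by
  let ω : ι → ℂ := fun i => if β i = 0 then 1 else β i / ‖β i‖
  have hω : ∀ i, ‖ω i‖ = 1 := by
    intro i
    by_cases h : β i = 0
    · simp [ω, h]
    · simp [ω, h]
  have hβ : ∀ i, β i = (‖β i‖ : ℂ) * ω i := by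
    intro i
    by_cases h : β i = 0
    · simp [h]
    · have : (‖β i‖ : ℂ) ≠ 0 := by simpa using h
      simp only [ω, h, if_false]; field_simp
  obtain ⟨n, hn, h⟩ := exists_recurrence ω hω N (ε := 1 / 4) (by norm_num)
  have hre : ∀ z : ℂ, 1 - ‖z - 1‖ ≤ z.re := by
    intro z
    have := (abs_le.1 (Complex.abs_re_le_norm (z - 1))).1
    simp at this; linarith
  refine ⟨n, hn, fun i => ?_, fun i j => ?_⟩
  · have h1 : β i ^ n = ((‖β i‖ ^ n : ℝ) : ℂ) * ω i ^ n := by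
      conv_lhs => rw [hβ i, mul_pow]
      push_cast; rfl
    rw [h1, Complex.re_ofReal_mul, mul_comm]
    have := hre (ω i ^ n)
    have := h i
    gcongr
    linarith
  · have h1 : β i ^ n * β j ^ n = ((‖β i‖ ^ n * ‖β j‖ ^ n : ℝ) : ℂ) * (ω i ^ n * ω j ^ n) := by
      conv_lhs => rw [hβ i, hβ j, mul_pow, mul_pow]
      push_cast; ring
    rw [h1, Complex.re_ofReal_mul]
    refine mul_nonneg (by positivity) ?_
    have h2 := hre (ω i ^ n * ω j ^ n)
    have h3 : ω i ^ n * ω j ^ n - 1 = ω i ^ n * (ω j ^ n - 1) + (ω i ^ n - 1) := by ring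
    have h4 : ‖ω i ^ n * ω j ^ n - 1‖ ≤ 1 / 4 + 1 / 4 := by
      rw [h3]
      refine (norm_add_le _ _).trans (add_le_add ?_ (h i).le)
      rw [norm_mul, norm_pow, hω, one_pow, one_mul]
      exact (h j).le
    linarith

section Radius
open scoped ENNReal NNReal
attribute [local instance] Matrix.linftyOpNormedRing Matrix.linftyOpNormedAlgebra

/-- Gelfand's formula: spectral radius below one gives a geometric bound on the powers. -/
theorem tendsto_pow_of_spectrum (A : Matrix (Letter d) (Letter d) ℂ)
    (h : ∀ μ ∈ spectrum ℂ A, ‖μ‖ < 1) (i j : Letter d) :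
    Tendsto (fun n : ℕ => (A ^ n) i j) atTop (𝓝 0) := by
  have : CompleteSpace (Matrix (Letter d) (Letter d) ℂ) := FiniteDimensional.complete ℂ _
  have h1 : spectralRadius ℂ A < ((1 : ℝ≥0) : ℝ≥0∞) :=
    spectrum.spectralRadius_lt_of_forall_lt A fun z hz => by
      have := h z hz
      exact_mod_cast this
  obtain ⟨r, hr1, hr2⟩ := ENNReal.lt_iff_exists_nnreal_btwn.1 h1
  have h2 := (spectrum.pow_nnnorm_pow_one_div_tendsto_nhds_spectralRadius A).eventually_lt_const hr1
  have hr3 : r < 1 := by exact_mod_cast hr2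
  have h3 : ∀ᶠ n : ℕ in atTop, ‖(A ^ n) i j‖ ≤ (r : ℝ) ^ n := by
    filter_upwards [h2, eventually_ge_atTop 1] with n hn hn1
    have hn0 : (n : ℝ) ≠ 0 := by positivity
    have h4 : (‖A ^ n‖₊ : ℝ≥0∞) ≤ (r : ℝ≥0∞) ^ n := by
      have := ENNReal.rpow_le_rpow hn.le (Nat.cast_nonneg n : (0 : ℝ) ≤ n)
      rwa [← ENNReal.rpow_mul, one_div_mul_cancel hn0, ENNReal.rpow_one, ENNReal.rpow_natCast]
        at this
    have h5 : ‖A ^ n‖₊ ≤ r ^ n := by exact_mod_cast h4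
    have h6 : ‖(A ^ n) i j‖₊ ≤ ‖A ^ n‖₊ := by
      rw [Matrix.linfty_opNNNorm_def]
      refine le_trans ?_ (Finset.le_sup (Finset.mem_univ i))
      exact Finset.single_le_sum (f := fun j => ‖(A ^ n) i j‖₊) (fun _ _ => zero_le)
        (Finset.mem_univ j)
    exact_mod_cast h6.trans h5
  exact squeeze_zero_norm' h3 (tendsto_pow_atTop_nhds_zero_of_lt_one r.2 (by exact_mod_cast hr3))

end Radius

variable {M : Matrix (Letter d) (Letter d) ℤ} {x : Letter d → ℝ} {lam : ℝ}

/-- The matrix of `v ↦ π_x(M v)`. -/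
noncomputable def prjMatrix (M : Matrix (Letter d) (Letter d) ℤ) (x : Letter d → ℝ) :
    Matrix (Letter d) (Letter d) ℝ := LinearMap.toMatrix' (prj x ∘ₗ (rl M).mulVecLin)

theorem prjMatrix_mulVec (v : Letter d → ℝ) :
    (prjMatrix M x).mulVec v = prj x ((rl M).mulVec v) := by
  simp [prjMatrix, LinearMap.toMatrix'_mulVec]

/-- The exponent is `n + 1` because the zeroth power is the identity, not the projection. -/
theorem IsPerron.prjMatrix_pow_mulVec (h : IsPerron M x lam) (n : ℕ) (v : Letter d → ℝ) :
    (prjMatrix M x ^ (n + 1)).mulVec v = prj x ((rl M ^ (n + 1)).mulVec v) := by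
  induction n generalizing v with
  | zero => simp [prjMatrix_mulVec]
  | succ n ih =>
    rw [pow_succ, ← Matrix.mulVec_mulVec, ih, prjMatrix_mulVec, h.prj_pow, Matrix.mulVec_mulVec,
      ← pow_succ]

/-- Projecting removes from the trace `∑ x i * ht (M ^ (n + 1) e_i) = ht (M ^ (n + 1) x) = lam ^ (n
+ 1)`. -/
theorem IsPerron.trace_pow (h : IsPerron M x lam) (n : ℕ) :
    ((M ^ (n + 1)).trace : ℝ) = lam ^ (n + 1) + (prjMatrix M x ^ (n + 1)).trace := by
  have h1 : ∀ i, (prjMatrix M x ^ (n + 1)) i i = (rl M ^ (n + 1)) i i -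
      x i * ht ((rl M ^ (n + 1)).mulVec (Pi.single i 1)) := by
    intro i
    have := congrFun (h.prjMatrix_pow_mulVec n (Pi.single i 1)) i
    rw [prj_apply] at this
    simpa [mul_comm] using this
  have h2 : ∑ i, x i * ht ((rl M ^ (n + 1)).mulVec (Pi.single i 1)) = lam ^ (n + 1) := by
    have h3 := h.eig_pow (n + 1)
    have h4 := congrArg ht h3
    rw [map_smul, h.ht_x, smul_eq_mul, mul_one] at h4
    rw [← h4]
    conv_rhs => rw [eq_sum_single x, Matrix.mulVec_sum, map_sum]
    simp_rw [Matrix.mulVec_smul, map_smul, smul_eq_mul]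
  simp only [Matrix.trace, Matrix.diag]
  simp_rw [h1, Finset.sum_sub_distrib, h2, ← rl_pow]
  simp [rl]

/-- The matrix of `Q ↦ Mᵀ Q M`. -/
def steinMatrix {R : Type*} [CommRing R] (M : Matrix (Letter d) (Letter d) R) :
    Matrix (Letter d × Letter d) (Letter d × Letter d) R :=
  Matrix.of fun p q => M q.1 p.1 * M q.2 p.2

theorem det_steinMatrix_sub_one {R : Type*} [CommRing R] [IsDomain R]
    (M : Matrix (Letter d) (Letter d) R) : (steinMatrix M - 1).det = 0 ↔
      ∃ Q : Matrix (Letter d) (Letter d) R, Q ≠ 0 ∧ M.transpose * Q * M = Q := by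
  have key : ∀ Q : Letter d × Letter d → R, (steinMatrix M - 1).mulVec Q = 0 ↔
      M.transpose * (Matrix.of fun i j => Q (i, j)) * M = Matrix.of fun i j => Q (i, j) := by
    intro Q
    rw [Matrix.sub_mulVec, Matrix.one_mulVec, sub_eq_zero, funext_iff, ← Matrix.ext_iff, Prod.forall]
    refine forall_congr' fun i => forall_congr' fun j => ?_
    have : (steinMatrix M).mulVec Q (i, j) =
        (M.transpose * (Matrix.of fun i j => Q (i, j)) * M) i j := by
      simp only [steinMatrix, Matrix.mulVec, dotProduct, Matrix.of_apply, Matrix.mul_apply,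
        Matrix.transpose_apply, Fintype.sum_prod_type, Finset.sum_mul]
      rw [Finset.sum_comm]
      exact Finset.sum_congr rfl fun l _ => Finset.sum_congr rfl fun k _ => by ring
    rw [this]; rfl
  rw [← Matrix.exists_mulVec_eq_zero_iff]
  constructor
  · rintro ⟨Q, hQ, h⟩
    refine ⟨Matrix.of fun i j => Q (i, j), fun h0 => hQ (funext fun p => ?_), (key Q).1 h⟩
    exact congrFun (congrFun h0 p.1) p.2
  · rintro ⟨Q, hQ, h⟩
    refine ⟨fun p => Q p.1 p.2, fun h0 => hQ (Matrix.ext fun i j => ?_), (key _).2 h⟩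
    exact congrFun h0 (i, j)

/-- The gap in the traces that an eigenvalue outside of the unit disc creates. -/
def TraceGap (M : Matrix (Letter d) (Letter d) ℤ) (n : ℕ) : Prop :=
  2 * ((d : ℤ) + 1) * |(M ^ (n + 1)).trace| + 4 * ((d : ℤ) + 1) ^ 2 <
    |(M ^ (n + 1)).trace ^ 2 - (M ^ (2 * n + 2)).trace|

/-- The eigenvalues of `prjMatrix`. -/
theorem IsPerron.exists_traces (h : IsPerron M x lam) : ∃ β : Letter d → ℂ,
    (∀ n, ((M ^ (n + 1)).trace : ℝ) = lam ^ (n + 1) + (∑ i, β i ^ (n + 1)).re) ∧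
    ∀ μ, (∃ i, β i = μ) ↔
      (Matrix.scalar (Letter d) μ - (prjMatrix M x).map ((↑) : ℝ → ℂ)).det = 0 := by
  obtain ⟨β, h1, h2⟩ := exists_eigenvalues ((prjMatrix M x).map ((↑) : ℝ → ℂ))
  refine ⟨β, fun n => ?_, h2⟩
  rw [h.trace_pow, ← h1]
  congr 1
  have : (prjMatrix M x).map ((↑) : ℝ → ℂ) ^ (n + 1) = (prjMatrix M x ^ (n + 1)).map ((↑) : ℝ → ℂ) :=
    (Matrix.map_pow (f := Complex.ofRealHom) (M := prjMatrix M x) (n + 1)).symm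
  rw [this]
  simp [Matrix.trace]

/-- An eigenvector of modulus at least one prevents the matrix powers from tending to zero; the
converse is the spectral radius bound. -/
theorem IsPerron.contracts_iff (h : IsPerron M x lam) {β : Letter d → ℂ}
    (hβ : ∀ μ, (∃ i, β i = μ) ↔
      (Matrix.scalar (Letter d) μ - (prjMatrix M x).map ((↑) : ℝ → ℂ)).det = 0) :
    Contracts M x ↔ ∀ i, ‖β i‖ < 1 := by
  have hpow : ∀ n, (prjMatrix M x).map ((↑) : ℝ → ℂ) ^ n = (prjMatrix M x ^ n).map ((↑) : ℝ → ℂ) :=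
    fun n => (Matrix.map_pow (f := Complex.ofRealHom) (M := prjMatrix M x) n).symm
  constructor
  · intro hc i
    obtain ⟨v, hv0, hv⟩ := Matrix.exists_mulVec_eq_zero_iff.2 ((hβ (β i)).1 ⟨i, rfl⟩)
    rw [Matrix.sub_mulVec, sub_eq_zero] at hv
    have hv' : ((prjMatrix M x).map ((↑) : ℝ → ℂ)).mulVec v = β i • v := by
      rw [← hv]; ext j; simp [Matrix.mulVec_diagonal]
    have hvn : ∀ n, ((prjMatrix M x).map ((↑) : ℝ → ℂ) ^ n).mulVec v = β i ^ n • v := by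
      intro n
      induction n with
      | zero => simp
      | succ n ih =>
        rw [pow_succ, ← Matrix.mulVec_mulVec, hv', Matrix.mulVec_smul, ih, smul_smul, pow_succ']
    obtain ⟨k, hk⟩ : ∃ k, v k ≠ 0 := by
      by_contra hne; push Not at hne; exact hv0 (funext hne)
    have h1 : ∀ j, Tendsto (fun n : ℕ => (prjMatrix M x ^ (n + 1)) k j) atTop (𝓝 0) := by
      intro j
      have := (tendsto_pi_nhds.1 ((tendsto_add_atTop_iff_nat 1).2 (hc (Pi.single j 1)))) k
      refine this.congr fun n => ?_
      rw [← h.prjMatrix_pow_mulVec]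
      simp
    have h2 : Tendsto (fun n : ℕ => ∑ j, (((prjMatrix M x ^ (n + 1)) k j : ℝ) : ℂ) * v j) atTop
        (𝓝 (∑ j, ((0 : ℝ) : ℂ) * v j)) :=
      tendsto_finsetSum _ fun j _ =>
        ((Complex.continuous_ofReal.tendsto 0).comp (h1 j)).mul_const _
    have h3 : ∀ n, ∑ j, (((prjMatrix M x ^ (n + 1)) k j : ℝ) : ℂ) * v j = β i ^ (n + 1) * v k := by
      intro n
      have := congrFun (hvn (n + 1)) k
      rw [hpow] at this
      simpa [Matrix.mulVec, dotProduct] using this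
    simp_rw [h3] at h2
    simp only [Complex.ofReal_zero, zero_mul, Finset.sum_const_zero] at h2
    by_contra hge
    push Not at hge
    have h4 := h2.norm
    rw [norm_zero] at h4
    have h5 : ‖v k‖ ≤ 0 := ge_of_tendsto' h4 fun n => by
      rw [norm_mul, norm_pow]
      have := one_le_pow₀ hge (n := n + 1)
      nlinarith [norm_nonneg (v k)]
    exact hk (norm_le_zero_iff.1 h5)
  · intro hlt
    have h1 : ∀ μ ∈ spectrum ℂ ((prjMatrix M x).map ((↑) : ℝ → ℂ)), ‖μ‖ < 1 := by
      intro μ hμ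
      rw [Matrix.mem_spectrum_iff_isRoot_charpoly, Polynomial.IsRoot, Matrix.eval_charpoly] at hμ
      obtain ⟨i, rfl⟩ := (hβ μ).2 hμ
      exact hlt i
    intro v
    refine (tendsto_add_atTop_iff_nat 1).1 (tendsto_pi_nhds.2 fun k => ?_)
    simp_rw [← h.prjMatrix_pow_mulVec]
    have h2 : ∀ j, Tendsto (fun n : ℕ => (prjMatrix M x ^ n) k j) atTop (𝓝 0) := by
      intro j
      have := (Complex.continuous_re.tendsto 0).comp (tendsto_pow_of_spectrum _ h1 k j)
      refine this.congr fun n => ?_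
      simp [hpow]
    have h3 : Tendsto (fun n : ℕ => ∑ j, (prjMatrix M x ^ (n + 1)) k j * v j) atTop
        (𝓝 (∑ j, 0 * v j)) :=
      tendsto_finsetSum _ fun j _ => ((tendsto_add_atTop_iff_nat 1).2 (h2 j)).mul_const _
    simpa [Matrix.mulVec, dotProduct] using h3

end Spectral

/-! ### Integer certificates against contraction -/

section NotContracting

variable {d : ℕ} {M : Matrix (Letter d) (Letter d) ℤ} {x : Letter d → ℝ} {lam : ℝ}

/-- A fixed nonzero integer vector would have nonzero height, forcing `lam = 1`. -/
theorem IsPerron.det_sub_one_ne_zero (h : IsPerron M x lam) (hc : Contracts M x) (hd : 1 ≤ d) :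
    (M - 1).det ≠ 0 := by
  intro h0
  obtain ⟨z, hz0, hz⟩ := Matrix.exists_mulVec_eq_zero_iff.2 h0
  obtain ⟨f, hf⟩ := h.exists_left hc
  rw [Matrix.sub_mulVec, Matrix.one_mulVec, sub_eq_zero] at hz
  have h1 := hf.f_mul (vec z)
  rw [← vec_mulVec, hz] at h1
  have h2 : f (vec z) ≠ 0 := fun h2 => hz0 (hf.f_int_ne_zero h hc h2)
  have h3 : lam = 1 := by
    have : (lam - 1) * f (vec z) = 0 := by linarith
    rcases mul_eq_zero.1 this with h4 | h4
    · linarith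
    · exact absurd h4 h2
  exact absurd h3 (h.one_lt hc hd).ne'

/-- An invariant integer form vanishes on the stable hyperplane and on `(x, x)`, hence is degenerate
when `2 ≤ d`. Its integer kernel is then spread by `M` to the direction `x`, and independence of the
coordinates of `x` kills it. For `d = 1` and determinant one the standard alternating form is
invariant, so the restriction is needed. -/
theorem IsPerron.det_stein_ne_zero (h : IsPerron M x lam) (hc : Contracts M x) (hd : 2 ≤ d) :
    (steinMatrix M - 1).det ≠ 0 := by
  intro h0
  obtain ⟨Q, hQ0, hQ⟩ := (det_steinMatrix_sub_one M).1 h0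
  obtain ⟨f, hf⟩ := h.exists_left hc
  have hlam := h.one_lt hc (by omega)
  let q : (Letter d → ℝ) →ₗ[ℝ] (Letter d → ℝ) →ₗ[ℝ] ℝ := Matrix.toLinearMap₂' ℝ (rl Q)
  have hq : ∀ v w, q v w = v ⬝ᵥ (rl Q).mulVec w := fun v w =>
    Matrix.toLinearMap₂'_apply' (rl Q) v w
  have hqM : ∀ v w, q ((rl M).mulVec v) ((rl M).mulVec w) = q v w := by
    intro v w
    have h1 : (rl M).transpose * rl Q * rl M = rl Q := by
      conv_rhs => rw [← hQ]
      rw [rl_mul, rl_mul]; rfl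
    rw [hq, hq, ← Matrix.vecMul_transpose, ← Matrix.dotProduct_mulVec, Matrix.mulVec_mulVec,
      Matrix.mulVec_mulVec, h1]
  have hqn : ∀ n v w, q ((rl M ^ n).mulVec v) ((rl M ^ n).mulVec w) = q v w := by
    intro n v w
    induction n with
    | zero => simp
    | succ n ih => rw [pow_succ', ← Matrix.mulVec_mulVec, ← Matrix.mulVec_mulVec, hqM, ih]
  have hcont : Continuous fun p : (Letter d → ℝ) × (Letter d → ℝ) => q p.1 p.2 := by
    simp_rw [hq]
    exact continuous_fst.dotProduct (continuous_const.matrix_mulVec continuous_snd)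
  have hker : ∀ v w, f v = 0 → f w = 0 → q v w = 0 := by
    intro v w hv hw
    have h1 := (hcont.tendsto (0, 0)).comp ((hf.tendsto_of_f_eq_zero h hc hv).prodMk_nhds
      (hf.tendsto_of_f_eq_zero h hc hw))
    simp only [Function.comp_def, hqn, map_zero] at h1
    exact tendsto_nhds_unique tendsto_const_nhds h1
  have hxx : q x x = 0 := by
    have h1 := hqM x x
    rw [h.eig, map_smul, map_smul, LinearMap.smul_apply, smul_eq_mul, smul_eq_mul] at h1
    have : (lam * lam - 1) * q x x = 0 := by linarith
    rcases mul_eq_zero.1 this with h2 | h2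
    · nlinarith
    · exact h2
  -- Two linear conditions on a space of dimension `d + 1 > 2`.
  obtain ⟨v, hv0, hfv, hqv⟩ : ∃ v ≠ 0, f v = 0 ∧ q v x = 0 := by
    have h1 : (f.prod (q.flip x)).ker ≠ ⊥ := by
      refine LinearMap.ker_ne_bot_of_finrank_lt ?_
      simp; omega
    obtain ⟨v, hv, hv0⟩ := (Submodule.ne_bot_iff _).1 h1
    rw [LinearMap.mem_ker] at hv
    exact ⟨v, hv0, congrArg Prod.fst hv, congrArg Prod.snd hv⟩
  have hqv' : ∀ w, q v w = 0 := by
    intro w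
    have h1 : w = f w • x + (w - f w • x) := by abel
    rw [h1, map_add, map_smul, hqv, hker v _ hfv (by rw [map_sub, map_smul, hf.f_x]; simp)]
    simp
  have hdet : Q.det = 0 := by
    have h1 : (rl Q).det = 0 := Matrix.exists_vecMul_eq_zero_iff.1 ⟨v, hv0, by
      ext j
      have := hqv' (Pi.single j 1)
      rw [hq, Matrix.dotProduct_mulVec] at this
      simpa using this⟩
    rw [det_rl] at h1
    exact_mod_cast h1
  -- Degeneracy of an integer matrix yields an integer kernel vector, whose height is nonzero; its
  -- scaled orbit therefore tends to a nonzero multiple of `x`.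
  obtain ⟨c, hc0, hcQ⟩ := Matrix.exists_vecMul_eq_zero_iff.2 hdet
  have hqc : ∀ w, q (vec c) w = 0 := by
    intro w
    rw [hq, Matrix.dotProduct_mulVec]
    have : Matrix.vecMul (vec c) (rl Q) = 0 := by
      ext j
      have := congrArg (Int.cast : ℤ → ℝ) (congrFun hcQ j)
      simpa [Matrix.vecMul, dotProduct, vec, rl] using this
    rw [this, zero_dotProduct]
  have hfc : f (vec c) ≠ 0 := fun h2 => hc0 (hf.f_int_ne_zero h hc h2)
  have hqx : ∀ w, q x w = 0 := by
    intro w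
    have h1 : ∀ n, q ((rl M ^ n).mulVec (vec c)) w = 0 := by
      intro n
      have h2 : IsUnit (rl M ^ n).det := by rw [Matrix.det_pow]; exact h.isUnit_rl.pow n
      have h3 : w = (rl M ^ n).mulVec (((rl M ^ n)⁻¹).mulVec w) := by
        rw [Matrix.mulVec_mulVec, Matrix.mul_nonsing_inv _ h2, Matrix.one_mulVec]
      rw [h3, hqn, hqc]
    have h2 := tendsto_functional (q.flip w) (hf.tendsto_scaled h hc (vec c))
    simp only [map_smul, LinearMap.flip_apply, h1, smul_eq_mul, mul_zero] at h2
    have h3 := tendsto_nhds_unique tendsto_const_nhds h2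
    exact (mul_eq_zero.1 h3.symm).resolve_left hfc
  refine hQ0 (Matrix.ext fun i j => ?_)
  have h1 := hqx (Pi.single j 1)
  rw [hq] at h1
  have h2 := h.int_independent hc (c := fun i => Q i j) (by
    rw [← h1]
    simp [dotProduct, rl, mul_comm])
  exact congrFun h2 i

/-- With `L = lam ^ (n + 1)` and the remaining traces `s`, `t` bounded by `D = d + 1`, the
difference is `2 * L * s + s ^ 2 - t`, at most linear in `L`, and `L` is at most `|tr| + D`. -/
theorem IsPerron.not_traceGap (h : IsPerron M x lam) (hc : Contracts M x) (n : ℕ) :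
    ¬ TraceGap M n := by
  obtain ⟨β, hT, hβ⟩ := h.exists_traces
  have hlt := (h.contracts_iff hβ).1 hc
  have hs : ∀ m, |(∑ i, β i ^ m).re| ≤ (d : ℝ) + 1 := by
    intro m
    refine (Complex.abs_re_le_norm _).trans ((norm_sum_le _ _).trans ?_)
    calc ∑ i, ‖β i ^ m‖ ≤ ∑ _i : Letter d, (1 : ℝ) := Finset.sum_le_sum fun i _ => by
          rw [norm_pow]; exact pow_le_one₀ (norm_nonneg _) (hlt i).le
      _ = _ := by simp
  intro hg
  have hg' : 2 * ((d : ℝ) + 1) * |((M ^ (n + 1)).trace : ℝ)| + 4 * ((d : ℝ) + 1) ^ 2 <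
    |((M ^ (n + 1)).trace : ℝ) ^ 2 - ((M ^ (2 * n + 2)).trace : ℝ)| := by
    unfold TraceGap at hg; exact_mod_cast hg
  have h2 := hT (2 * n + 1)
  rw [show 2 * n + 1 + 1 = 2 * n + 2 by ring] at h2
  rw [h2, hT n, show lam ^ (2 * n + 2) = (lam ^ (n + 1)) ^ 2 by rw [← pow_mul]; ring_nf] at hg'
  have hs1 := hs (n + 1)
  have hs2 := hs (2 * n + 2)
  generalize (∑ i, β i ^ (n + 1)).re = s at *
  generalize (∑ i, β i ^ (2 * n + 2)).re = t at *
  have hL : 1 ≤ lam ^ (n + 1) := one_le_pow₀ h.one_le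
  generalize lam ^ (n + 1) = L at *
  have hD : (1 : ℝ) ≤ (d : ℝ) + 1 := by simp
  generalize (d : ℝ) + 1 = D at *
  have h3 : L - D ≤ |L + s| := by
    have := le_abs_self (L + s)
    have := (abs_le.1 hs1).1
    linarith
  have h4 : |(L + s) ^ 2 - (L ^ 2 + t)| ≤ 2 * L * D + D ^ 2 + D := by
    rw [show (L + s) ^ 2 - (L ^ 2 + t) = 2 * L * s + s ^ 2 - t by ring]
    have h5 : |2 * L * s| ≤ 2 * L * D := by
      rw [abs_mul, abs_of_nonneg (by positivity : 0 ≤ 2 * L)]; gcongr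
    have h6 : |s ^ 2| ≤ D ^ 2 := by rw [abs_pow]; gcongr
    exact (abs_sub _ _).trans (add_le_add ((abs_add_le _ _).trans (add_le_add h5 h6)) hs2)
  nlinarith

/-- At recurrent times all `β i ^ n` point nearly in the positive direction, so the remaining trace
`s` is large and `t ≤ s ^ 2`. The difference is then at least `2 * L * s`, a product of two large
factors. -/
theorem exists_traceGap (hlam : 1 < lam) {β : Letter d → ℂ}
    (hT : ∀ n, ((M ^ (n + 1)).trace : ℝ) = lam ^ (n + 1) + (∑ i, β i ^ (n + 1)).re)
    {i₀ : Letter d} (hi : 1 < ‖β i₀‖) : ∃ n, TraceGap M n := by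
  have hlarge : ∀ ρ : ℝ, 1 < ρ → ∀ᶠ n : ℕ in atTop, 8 * ((d : ℝ) + 1) ≤ ρ ^ n := fun ρ hρ =>
    (tendsto_pow_atTop_atTop_of_one_lt hρ).eventually_ge_atTop _
  obtain ⟨N, hN⟩ := eventually_atTop.1 ((hlarge lam hlam).and (hlarge _ hi))
  obtain ⟨m, hm, hre, hprod⟩ := exists_phase β (N + 1)
  obtain ⟨n, rfl⟩ : ∃ n, m = n + 1 := ⟨m - 1, by omega⟩
  obtain ⟨hL, hR⟩ := hN (n + 1) (by omega)
  refine ⟨n, ?_⟩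
  have hs : 4 * ((d : ℝ) + 1) ≤ (∑ i, β i ^ (n + 1)).re := by
    rw [Complex.re_sum]
    refine le_trans ?_ (Finset.single_le_sum (f := fun i => (β i ^ (n + 1)).re)
      (fun i _ => le_trans (by positivity) (hre i)) (Finset.mem_univ i₀))
    have := hre i₀
    linarith
  have hst : (∑ i, β i ^ (2 * n + 2)).re ≤ (∑ i, β i ^ (n + 1)).re ^ 2 := by
    have h1 : (∑ i, β i ^ (n + 1)).re ^ 2 ≥ ((∑ i, β i ^ (n + 1)) * (∑ i, β i ^ (n + 1))).re := by
      rw [Complex.mul_re]; nlinarith [sq_nonneg (∑ i, β i ^ (n + 1)).im]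
    refine le_trans ?_ h1
    -- The trace at twice the time is the diagonal part of the squared sum; the off-diagonal
    -- products have nonnegative real part.
    rw [Finset.sum_mul_sum, Complex.re_sum, Complex.re_sum]
    refine Finset.sum_le_sum fun i _ => ?_
    rw [Complex.re_sum, show β i ^ (2 * n + 2) = β i ^ (n + 1) * β i ^ (n + 1) by ring]
    exact Finset.single_le_sum (f := fun j => (β i ^ (n + 1) * β j ^ (n + 1)).re)
      (fun j _ => hprod i j) (Finset.mem_univ i)
  suffices hg : 2 * ((d : ℝ) + 1) * |((M ^ (n + 1)).trace : ℝ)| + 4 * ((d : ℝ) + 1) ^ 2 <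
      |((M ^ (n + 1)).trace : ℝ) ^ 2 - ((M ^ (2 * n + 2)).trace : ℝ)| by
    unfold TraceGap; exact_mod_cast hg
  have h2 := hT (2 * n + 1)
  rw [show 2 * n + 1 + 1 = 2 * n + 2 by ring] at h2
  rw [h2, hT n, show lam ^ (2 * n + 2) = (lam ^ (n + 1)) ^ 2 by rw [← pow_mul]; ring_nf]
  generalize (∑ i, β i ^ (n + 1)).re = s at *
  generalize (∑ i, β i ^ (2 * n + 2)).re = t at *
  generalize lam ^ (n + 1) = L at *
  have hD : (1 : ℝ) ≤ (d : ℝ) + 1 := by simp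
  generalize (d : ℝ) + 1 = D at *
  refine lt_of_lt_of_le ?_ (le_abs_self _)
  rw [abs_of_nonneg (by linarith)]
  nlinarith [mul_nonneg (by linarith : 0 ≤ L - 4 * D) (by linarith : 0 ≤ s - 4 * D)]

/-- A left eigenvector of `π_x M` with nonzero eigenvalue kills `x`, hence ignores the projection
and is a left eigenvector of `M` itself. -/
theorem IsPerron.exists_left_of_eigenvalue (h : IsPerron M x lam) {μ : ℂ} (hμ : μ ≠ 0)
    (hdet : (Matrix.scalar (Letter d) μ - (prjMatrix M x).map ((↑) : ℝ → ℂ)).det = 0) :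
    ∃ l : Letter d → ℂ, l ≠ 0 ∧ Matrix.vecMul l (M.map (Int.cast : ℤ → ℂ)) = μ • l := by
  obtain ⟨l, hl0, hl⟩ := Matrix.exists_vecMul_eq_zero_iff.2 hdet
  rw [Matrix.vecMul_sub, sub_eq_zero] at hl
  have hl' : Matrix.vecMul l ((prjMatrix M x).map ((↑) : ℝ → ℂ)) = μ • l := by
    rw [← hl]; ext j; simp [Matrix.vecMul_diagonal, mul_comm]
  have hmul : ∀ v : Letter d → ℝ, ∑ j, l j * (((prjMatrix M x).mulVec v j : ℝ) : ℂ) =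
      μ * ∑ j, l j * ((v j : ℝ) : ℂ) := by
    intro v
    have h1 := congrArg (fun w => w ⬝ᵥ fun j => ((v j : ℝ) : ℂ)) hl'
    rw [smul_dotProduct, ← Matrix.dotProduct_mulVec] at h1
    simpa [dotProduct, Matrix.mulVec] using h1
  have hlx : ∑ j, l j * ((x j : ℝ) : ℂ) = 0 := by
    have h1 := hmul x
    rw [prjMatrix_mulVec, h.eig, map_smul, h.prj_self] at h1
    simpa [hμ, eq_comm] using h1
  refine ⟨l, hl0, funext fun k => ?_⟩
  have h1 := hmul (Pi.single k 1)
  rw [prjMatrix_mulVec, prj_apply] at h1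
  simp only [Pi.sub_apply, Pi.smul_apply, smul_eq_mul, Complex.ofReal_sub, Complex.ofReal_mul,
    mul_sub, Finset.sum_sub_distrib] at h1
  have h2 : ∀ a : ℂ, ∑ j, l j * (a * ((x j : ℝ) : ℂ)) = 0 := by
    intro a
    have : ∀ j, l j * (a * ((x j : ℝ) : ℂ)) = a * (l j * ((x j : ℝ) : ℂ)) := fun j => by ring
    simp_rw [this, ← Finset.mul_sum, hlx, mul_zero]
  rw [h2, sub_zero] at h1
  have h3 : ∑ j, l j * (((Pi.single k 1 : Letter d → ℝ) j : ℝ) : ℂ) = l k := by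
    rw [Finset.sum_eq_single k] <;> simp +contextual
  rw [h3] at h1
  rw [Pi.smul_apply, smul_eq_mul, ← h1]
  simp [Matrix.vecMul, dotProduct, rl]

/-- The form `conj l ⊗ l` is multiplied by `|μ| ^ 2 = 1`, hence invariant. The determinant is an
integer, so its vanishing over `ℂ` suffices. -/
theorem det_stein_of_norm_one {μ : ℂ} (hμ : ‖μ‖ = 1) {l : Letter d → ℂ} (hl0 : l ≠ 0)
    (hl : Matrix.vecMul l (M.map (Int.cast : ℤ → ℂ)) = μ • l) : (steinMatrix M - 1).det = 0 := by
  have h1 : (steinMatrix (M.map (Int.cast : ℤ → ℂ)) - 1).det = 0 := by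
    obtain ⟨k, hk⟩ : ∃ k, l k ≠ 0 := by
      by_contra hne; push Not at hne; exact hl0 (funext hne)
    refine (det_steinMatrix_sub_one _).2
      ⟨Matrix.vecMulVec (fun i => (starRingEnd ℂ) (l i)) l, fun h0 => ?_, ?_⟩
    · have := congrFun (congrFun h0 k) k
      simp [Matrix.vecMulVec_apply, hk] at this
    · rw [Matrix.mul_vecMulVec, Matrix.vecMulVec_mul, hl]
      ext i j
      have h2 : (M.map (Int.cast : ℤ → ℂ)).transpose.mulVec (fun i => (starRingEnd ℂ) (l i)) i =
          (starRingEnd ℂ) (μ * l i) := by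
        have := congrArg (starRingEnd ℂ) (congrFun hl i)
        rw [Pi.smul_apply, smul_eq_mul] at this
        rw [← this]
        simp [Matrix.vecMul, Matrix.mulVec, dotProduct, mul_comm]
      rw [Matrix.vecMulVec_apply, Matrix.vecMulVec_apply, h2, map_mul, Pi.smul_apply, smul_eq_mul]
      have h3 : (starRingEnd ℂ) μ * μ = 1 := by
        rw [mul_comm, Complex.mul_conj, Complex.normSq_eq_norm_sq, hμ]; simp
      linear_combination (starRingEnd ℂ) (l i) * l j * h3
  have h2 : (steinMatrix (M.map (Int.cast : ℤ → ℂ)) - 1) =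
      (Int.castRingHom ℂ).mapMatrix (steinMatrix M - 1) := by
    ext p q
    by_cases hpq : p = q <;> simp [steinMatrix, hpq]
  rw [h2, ← RingHom.map_det] at h1
  simpa using h1

theorem IsPerron.norm_lt_of_d_eq_one {M : Matrix (Letter 1) (Letter 1) ℤ} {x : Letter 1 → ℝ}
    (h : IsPerron M x lam) (hlam : 1 < lam) {μ : ℂ} (hμ : ‖μ‖ = 1) {l : Letter 1 → ℂ} (hl0 : l ≠ 0)
    (hl : Matrix.vecMul l (M.map (Int.cast : ℤ → ℂ)) = μ • l) : False := by
  have hdet : ∀ ν : ℂ, (ν • (1 : Matrix (Letter 1) (Letter 1) ℂ) -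
      (M.map (Int.cast : ℤ → ℂ))).det = 0 →
      ν ^ 2 - (M 0 0 + M 1 1) * ν + (M.det : ℂ) = 0 := by
    intro ν hν
    rw [Matrix.det_fin_two] at hν
    rw [Matrix.det_fin_two]
    simp at hν
    push_cast
    linear_combination hν
  have h1 := hdet μ (Matrix.exists_vecMul_eq_zero_iff.1 ⟨l, hl0, by
    rw [Matrix.vecMul_sub, hl, Matrix.vecMul_smul, Matrix.vecMul_one, sub_self]⟩)
  have h2 := hdet lam (Matrix.exists_mulVec_eq_zero_iff.1 ⟨fun i => x i, fun h0 => by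
    have hx : x = 0 := funext fun i => by simpa using congrFun h0 i
    have := h.ht_x
    simp [hx] at this, by
    ext i
    have := congrArg ((↑) : ℝ → ℂ) (congrFun h.eig i)
    simp only [Matrix.mulVec, dotProduct, rl, Matrix.map_apply, Complex.ofReal_sum,
      Complex.ofReal_mul, Complex.ofReal_intCast, Pi.smul_apply, smul_eq_mul] at this
    rw [Matrix.sub_mulVec, Matrix.smul_mulVec, Matrix.one_mulVec, Pi.sub_apply, Pi.smul_apply,
      smul_eq_mul, ← this]
    simp [Matrix.mulVec, dotProduct]⟩)
  have hne : μ - lam ≠ 0 := by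
    intro h0
    have : ‖μ‖ = lam := by
      rw [sub_eq_zero.1 h0, Complex.norm_real, Real.norm_of_nonneg (by linarith)]
    linarith
  -- Distinct roots of a monic quadratic have the constant term as product, here `±1`, against `‖μ‖
  -- = 1 < lam`.
  have h3 : μ * lam = (M.det : ℂ) := by
    refine mul_left_cancel₀ hne ?_
    linear_combination lam * h1 - μ * h2
  have h4 := congrArg norm h3
  rw [norm_mul, hμ, Complex.norm_real, Real.norm_of_nonneg (by linarith), one_mul] at h4
  rcases Int.isUnit_iff.1 h.det with h5 | h5 <;> rw [h5] at h4 <;> simp at h4 <;> linarith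

/-- A finitary description of the eigenvectors that do not attract. -/
theorem IsPerron.not_contracts_iff (h : IsPerron M x lam) (hd : 1 ≤ d) : ¬ Contracts M x ↔
    (M - 1).det = 0 ∨ (2 ≤ d ∧ (steinMatrix M - 1).det = 0) ∨ ∃ n, TraceGap M n := by
  constructor
  · intro hc
    rcases h.one_le.eq_or_lt with hlam | hlam
    · left
      have h1 : (rl (M - 1)).det = 0 := Matrix.exists_mulVec_eq_zero_iff.1 ⟨x, fun h0 => by
        have := h.ht_x
        simp [h0] at this, by
        have h2 : rl (M - 1) = rl M - 1 := by
          ext i j; by_cases hij : i = j <;> simp [rl, hij]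
        rw [h2, Matrix.sub_mulVec, h.eig, ← hlam, one_smul, Matrix.one_mulVec, sub_self]⟩
      rw [det_rl] at h1
      exact_mod_cast h1
    right
    obtain ⟨β, hT, hβ⟩ := h.exists_traces
    rw [h.contracts_iff hβ] at hc
    push Not at hc
    obtain ⟨i, hi⟩ := hc
    rcases hi.eq_or_lt with hi | hi
    · have h0 : β i ≠ 0 := by rw [← norm_pos_iff]; linarith
      obtain ⟨l, hl0, hl⟩ := h.exists_left_of_eigenvalue h0 ((hβ (β i)).1 ⟨i, rfl⟩)
      left
      refine ⟨?_, det_stein_of_norm_one hi.symm hl0 hl⟩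
      by_contra hd2
      obtain rfl : d = 1 := by omega
      exact h.norm_lt_of_d_eq_one hlam hi.symm hl0 hl
    · exact Or.inr (exists_traceGap hlam hT hi)
  · rintro (h1 | ⟨h1, h2⟩ | ⟨n, h1⟩) hc
    · exact h.det_sub_one_ne_zero hc hd h1
    · exact h.det_stein_ne_zero hc h1 h2
    · exact h.not_traceGap hc n h1

end NotContracting

/-! ### Finite certificates for contraction, overlap and coincidence -/

section Evidence

variable {d : ℕ} {M : Matrix (Letter d) (Letter d) ℤ} {x : Letter d → ℝ} {lam : ℝ}

def colSum (B : Matrix (Letter d) (Letter d) ℤ) (i : Letter d) : ℤ := ∑ l, B l i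

def entrySum (B : Matrix (Letter d) (Letter d) ℤ) : ℤ := ∑ i, colSum B i

/-- A finite witness of contraction: the columns of `M ^ k`, which enclose the eigenvector, are
nearly proportional to those of `M ^ N`. -/
def ContractionWitness (M : Matrix (Letter d) (Letter d) ℤ) (N k : ℕ) : Prop :=
  1 ≤ N ∧ (∀ i j, 1 ≤ (M ^ k) i j) ∧ ∀ i j l, 2 * ((d : ℤ) + 1) *
    |(M ^ N) l j * colSum (M ^ k) i - colSum (M ^ N) j * (M ^ k) l i| ≤ colSum (M ^ k) i

theorem ht_rl_single (B : Matrix (Letter d) (Letter d) ℤ) (i : Letter d) :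
    ht ((rl B).mulVec (Pi.single i 1)) = colSum B i := by
  simp [ht_apply, rl, colSum]

theorem IsPerron.sum_colSum (h : IsPerron M x lam) (k : ℕ) :
    ∑ i, (colSum (M ^ k) i : ℝ) * x i = lam ^ k := by
  have h1 := congrArg ht (h.eig_pow k)
  rw [map_smul, h.ht_x, smul_eq_mul, mul_one] at h1
  rw [← h1]
  conv_rhs => rw [eq_sum_single x, Matrix.mulVec_sum, map_sum]
  refine Finset.sum_congr rfl fun i _ => ?_
  rw [Matrix.mulVec_smul, map_smul, ← rl_pow, ht_rl_single, smul_eq_mul, mul_comm]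

theorem IsPerron.mulVec_pow_apply (h : IsPerron M x lam) (k : ℕ) (l : Letter d) :
    ∑ i, ((M ^ k) l i : ℝ) * x i = lam ^ k * x l := by
  have h1 := congrFun (h.eig_pow k) l
  rw [← rl_pow] at h1
  simpa [Matrix.mulVec, dotProduct, rl] using h1

/-- Since `lam ^ k • x` is the combination of the columns of `M ^ k` with weights `x i`, averaging
the witness inequalities bounds each entry of `π_x M ^ N` by `1 / (2 * (d + 1))` without knowing
`x`. -/
theorem ContractionWitness.half {N k : ℕ} (hw : ContractionWitness M N k) (h : IsPerron M x lam)
    (v : Letter d → ℝ) : ‖prj x ((rl M ^ N).mulVec v)‖ ≤ 1 / 2 * ‖v‖ := by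
  refine linear_norm_le (prjPow M x N) (fun j => ?_) v
  have hS : 0 < lam ^ k := pow_pos (by linarith [h.one_le]) k
  refine (pi_norm_le_iff_of_nonneg (by positivity)).2 fun l => ?_
  rw [prjPow_apply, prj_apply, ← rl_pow, ht_rl_single]
  simp only [Pi.sub_apply, Pi.smul_apply, smul_eq_mul, Real.norm_eq_abs, Matrix.mulVec_single_one,
    Matrix.col_apply, rl, Matrix.map_apply]
  have h1 : lam ^ k * (((M ^ N) l j : ℝ) - colSum (M ^ N) j * x l) = ∑ i, x i *
      ((((M ^ N) l j * colSum (M ^ k) i - colSum (M ^ N) j * (M ^ k) l i : ℤ)) : ℝ) := by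
    have h2 : ∀ i, x i *
        ((((M ^ N) l j * colSum (M ^ k) i - colSum (M ^ N) j * (M ^ k) l i : ℤ)) : ℝ) =
        ((M ^ N) l j : ℝ) * ((colSum (M ^ k) i : ℝ) * x i) -
          colSum (M ^ N) j * (((M ^ k) l i : ℝ) * x i) := by
      intro i; push_cast; ring
    simp_rw [h2, Finset.sum_sub_distrib, ← Finset.mul_sum, h.sum_colSum, h.mulVec_pow_apply]
    ring
  have h3 : lam ^ k * |((M ^ N) l j : ℝ) - colSum (M ^ N) j * x l| ≤
      lam ^ k * (1 / 2 / ((d : ℝ) + 1)) := by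
    rw [← abs_of_pos hS, ← abs_mul, abs_of_pos hS, h1]
    refine (Finset.abs_sum_le_sum_abs _ _).trans ?_
    rw [← h.sum_colSum k, Finset.sum_mul]
    refine Finset.sum_le_sum fun i _ => ?_
    rw [abs_mul, abs_of_nonneg (h.x_nonneg i), mul_comm _ (x i), mul_assoc]
    refine mul_le_mul_of_nonneg_left ?_ (h.x_nonneg i)
    have h4 : 2 * ((d : ℝ) + 1) *
        |((((M ^ N) l j * colSum (M ^ k) i - colSum (M ^ N) j * (M ^ k) l i : ℤ)) : ℝ)| ≤
        colSum (M ^ k) i := by exact_mod_cast hw.2.2 i j l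
    rw [div_div, mul_one_div, le_div_iff₀ (by positivity)]
    linarith
  exact le_of_mul_le_mul_left h3 hS

theorem ContractionWitness.contracts {N k : ℕ} (hw : ContractionWitness M N k)
    (h : IsPerron M x lam) : Contracts M x :=
  h.contracts_of_half hw.1 (hw.half h)

/-- Positivity of `M ^ k` gives a computable lower bound on the coordinates of `x`, and hence an
upper bound on letter heights. -/
theorem ContractionWitness.one_le_mul {N k : ℕ} (hw : ContractionWitness M N k)
    (h : IsPerron M x lam) (l : Letter d) : 1 ≤ (entrySum (M ^ k) : ℝ) * x l := by
  have h1 : 1 ≤ lam ^ k * x l := by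
    rw [← h.mulVec_pow_apply, ← h.ht_x, ht_apply]
    refine Finset.sum_le_sum fun i _ => ?_
    have : (1 : ℝ) ≤ (M ^ k) l i := by exact_mod_cast hw.2.1 l i
    nlinarith [h.x_nonneg i]
  have h2 : lam ^ k ≤ entrySum (M ^ k) := by
    rw [← h.sum_colSum, entrySum]
    push_cast
    refine Finset.sum_le_sum fun i _ => ?_
    have h3 : (0 : ℝ) ≤ colSum (M ^ k) i := by
      exact_mod_cast Finset.sum_nonneg fun l _ => h.pow_nonneg k l i
    exact mul_le_of_le_one_right h3 (h.x_le_one i)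
  exact h1.trans (mul_le_mul_of_nonneg_right h2 (h.x_nonneg l))

theorem IsPerron.exists_contractionWitness (h : IsPerron M x lam) (hc : Contracts M x) :
    ∃ N k, ContractionWitness M N k := by
  obtain ⟨f, hf⟩ := h.exists_left hc
  -- Half of the tolerance in the witness, so that the limit inequality in `k` is strict and holds
  -- eventually.
  obtain ⟨N, hN, hN1⟩ := ((hc.uniform (ε := 1 / (4 * ((d : ℝ) + 1))) (by positivity)).and
    (eventually_ge_atTop 1)).exists
  have hN' : ∀ l j, |((M ^ N) l j : ℝ) - colSum (M ^ N) j * x l| ≤ 1 / (4 * ((d : ℝ) + 1)) := by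
    intro l j
    have h1 := hN (Pi.single j 1)
    rw [Pi.norm_single, norm_one, mul_one] at h1
    have h2 := (norm_le_pi_norm _ l).trans h1
    rw [prj_apply, ← rl_pow, ht_rl_single] at h2
    simpa [rl] using h2
  have hlam : ∀ k : ℕ, 0 < (lam ^ k)⁻¹ := fun k => by
    have := h.one_le; positivity
  have hB : ∀ i l, Tendsto (fun k : ℕ => (lam ^ k)⁻¹ * ((M ^ k) l i : ℝ)) atTop
      (𝓝 (f (Pi.single i 1) * x l)) := by
    intro i l
    have h1 := (tendsto_pi_nhds.1 (hf.tendsto_scaled h hc (Pi.single i 1))) l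
    simp_rw [← rl_pow] at h1
    simpa [rl] using h1
  have hS : ∀ i, Tendsto (fun k : ℕ => (lam ^ k)⁻¹ * (colSum (M ^ k) i : ℝ)) atTop
      (𝓝 (f (Pi.single i 1))) := by
    intro i
    have h1 := tendsto_finsetSum Finset.univ fun l (_ : l ∈ Finset.univ) => hB i l
    have h2 : ∑ l, f (Pi.single i 1) * x l = f (Pi.single i 1) := by
      rw [← Finset.mul_sum, ← ht_apply, h.ht_x, mul_one]
    rw [h2] at h1
    refine h1.congr fun k => ?_
    rw [colSum, ← Finset.mul_sum]; push_cast; rfl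
  have hpos : ∀ᶠ k in atTop, ∀ i j, 1 ≤ (M ^ k) i j := by
    refine eventually_all.2 fun i => eventually_all.2 fun j => ?_
    have h1 := hf.eventually_pos h hc (z := Pi.single j 1)
      (by rw [vec_single]; exact hf.f_single_pos h hc j)
    filter_upwards [h1] with k hk
    have h2 : 0 < (M ^ k) i j := by simpa using hk i
    omega
  have hlim : ∀ᶠ k in atTop, ∀ i j l, 2 * ((d : ℤ) + 1) *
      |(M ^ N) l j * colSum (M ^ k) i - colSum (M ^ N) j * (M ^ k) l i| ≤ colSum (M ^ k) i := by
    refine eventually_all.2 fun i => eventually_all.2 fun j => eventually_all.2 fun l => ?_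
    have h1 := (((((hS i).const_mul ((M ^ N) l j : ℝ)).sub
      ((hB i l).const_mul (colSum (M ^ N) j : ℝ))).abs).const_mul (2 * ((d : ℝ) + 1))).sub (hS i)
    have h2 : 2 * ((d : ℝ) + 1) * |((M ^ N) l j : ℝ) * f (Pi.single i 1) -
        colSum (M ^ N) j * (f (Pi.single i 1) * x l)| - f (Pi.single i 1) < 0 := by
      have hfi := hf.f_single_pos h hc i
      rw [show ((M ^ N) l j : ℝ) * f (Pi.single i 1) - colSum (M ^ N) j * (f (Pi.single i 1) * x l)
        = f (Pi.single i 1) * (((M ^ N) l j : ℝ) - colSum (M ^ N) j * x l) by ring, abs_mul,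
        abs_of_pos hfi]
      have h3 := hN' l j
      rw [le_div_iff₀ (by positivity)] at h3
      nlinarith
    filter_upwards [h1.eventually_lt_const h2] with k hk
    have h4 : ((M ^ N) l j : ℝ) * ((lam ^ k)⁻¹ * (colSum (M ^ k) i : ℝ)) -
        colSum (M ^ N) j * ((lam ^ k)⁻¹ * ((M ^ k) l i : ℝ)) = (lam ^ k)⁻¹ *
        ((((M ^ N) l j * colSum (M ^ k) i - colSum (M ^ N) j * (M ^ k) l i : ℤ)) : ℝ) := by
      push_cast; ring
    rw [h4, abs_mul, abs_of_pos (hlam k)] at hk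
    have h5 : (lam ^ k)⁻¹ * (2 * ((d : ℝ) + 1) *
        |((((M ^ N) l j * colSum (M ^ k) i - colSum (M ^ N) j * (M ^ k) l i : ℤ)) : ℝ)|) <
        (lam ^ k)⁻¹ * colSum (M ^ k) i := by linarith
    have h6 := (lt_of_mul_lt_mul_left h5 (hlam k).le).le
    exact_mod_cast h6
  obtain ⟨k, hk1, hk2⟩ := (hpos.and hlim).exists
  exact ⟨N, k, hN1, hk1, hk2⟩

/-- A finite witness that two segments do not overlap. -/
def DisjointWitness (M : Matrix (Letter d) (Letter d) ℤ) (n : ℕ) (b : Letter d) (t : Letter d → ℤ)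
    (b' : Letter d) : Prop :=
  (∀ i, 0 ≤ (M ^ n).mulVec (t - Pi.single b 1) i) ∨ ∀ i, 0 ≤ (M ^ n).mulVec (-t - Pi.single b' 1) i

/-- A finite witness that two segments overlap. -/
def OverlapWitness (M : Matrix (Letter d) (Letter d) ℤ) (n : ℕ) (b : Letter d) (t : Letter d → ℤ)
    (b' : Letter d) : Prop :=
  (∀ i, 0 < (M ^ n).mulVec (Pi.single b 1 - t) i) ∧ ∀ i, 0 < (M ^ n).mulVec (t + Pi.single b' 1) i

variable {g : Letter d → List (Letter d)} {f : (Letter d → ℝ) →ₗ[ℝ] ℝ}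

namespace IsPisot

theorem not_overlap (h : IsPisot g x lam f) {n : ℕ} {b : Letter d} {t : Letter d → ℤ}
    {b' : Letter d} (hw : DisjointWitness (morphMatrix g) n b t b') : ¬ Overlap f b t b' := by
  rintro ⟨h1, h2⟩
  rcases hw with hw | hw
  · have := h.left.f_nonneg_of_nonneg h.perron h.contracts hw
    rw [vec_sub, vec_single, map_sub] at this; linarith
  · have := h.left.f_nonneg_of_nonneg h.perron h.contracts hw
    rw [vec_sub, vec_neg, vec_single, map_sub, map_neg] at this; linarith

theorem pos_of_witness (h : IsPisot g x lam f) {n : ℕ} {z : Letter d → ℤ}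
    (hz : ∀ i, 0 < (morphMatrix g ^ n).mulVec z i) : 0 < f (vec z) := by
  refine lt_of_le_of_ne (h.left.f_nonneg_of_nonneg h.perron h.contracts fun i => (hz i).le)
    fun h0 => ?_
  have := h.left.f_int_ne_zero h.perron h.contracts h0.symm
  have h1 := hz 0
  simp [this] at h1

theorem overlap_of_witness (h : IsPisot g x lam f) {n : ℕ} {b : Letter d} {t : Letter d → ℤ}
    {b' : Letter d} (hw : OverlapWitness (morphMatrix g) n b t b') : Overlap f b t b' := by
  have h1 := h.pos_of_witness hw.1
  have h2 := h.pos_of_witness hw.2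
  rw [vec_sub, vec_single, map_sub] at h1
  rw [vec_add, vec_single, map_add] at h2
  exact ⟨by linarith, h2⟩

/-- Non-overlap includes touching endpoints, but a height difference equal to zero forces the
integer vector itself to be zero, so nonnegativity is still witnessed. -/
theorem eventually_disjointWitness (h : IsPisot g x lam f) {b : Letter d} {t : Letter d → ℤ}
    {b' : Letter d} (ho : ¬ Overlap f b t b') :
    ∀ᶠ n in atTop, DisjointWitness (morphMatrix g) n b t b' := by
  have key : ∀ z : Letter d → ℤ, 0 ≤ f (vec z) →
      ∀ᶠ n in atTop, ∀ i, 0 ≤ (morphMatrix g ^ n).mulVec z i := by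
    intro z hz
    rcases hz.eq_or_lt with h0 | h0
    · rw [h.left.f_int_ne_zero h.perron h.contracts h0.symm]
      simp
    · exact (h.left.eventually_pos h.perron h.contracts h0).mono fun n hn i => (hn i).le
  by_cases h1 : f (vec t) < f (Pi.single b 1)
  · have h2 : f (vec t) + f (Pi.single b' 1) ≤ 0 := not_lt.1 fun h2 => ho ⟨h1, h2⟩
    exact (key (-t - Pi.single b' 1) (by
      rw [vec_sub, vec_neg, vec_single, map_sub, map_neg]; linarith)).mono fun n hn => Or.inr hn
  · exact (key (t - Pi.single b 1) (by
      rw [vec_sub, vec_single, map_sub]; linarith)).mono fun n hn => Or.inl hn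

theorem eventually_overlapWitness (h : IsPisot g x lam f) {b : Letter d} {t : Letter d → ℤ}
    {b' : Letter d} (ho : Overlap f b t b') :
    ∀ᶠ n in atTop, OverlapWitness (morphMatrix g) n b t b' :=
  (h.left.eventually_pos h.perron h.contracts (z := Pi.single b 1 - t) (by
    rw [vec_sub, vec_single, map_sub]; linarith [ho.1])).and
  (h.left.eventually_pos h.perron h.contracts (z := t + Pi.single b' 1) (by
    rw [vec_add, vec_single, map_add]; exact ho.2))

end IsPisot

/-- A finite witness of an overlap without coincidences: a set of overlaps that contains its
descendants and no coincidence. -/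
def NonCoincidenceWitness (g : Letter d → List (Letter d)) (n : ℕ)
    (Q : List (Letter d × (Letter d → ℤ) × Letter d)) : Prop :=
  (∃ q ∈ Q, OverlapWitness (morphMatrix g) n q.1 q.2.1 q.2.2) ∧
    ∀ q ∈ Q, ¬ (q.1 = q.2.2 ∧ q.2.1 = 0) ∧ ∀ y ∈ segs (g q.1), ∀ y' ∈ segs (g q.2.2),
      (y.2, (morphMatrix g).mulVec q.2.1 + y'.1 - y.1, y'.2) ∈ Q ∨
        DisjointWitness (morphMatrix g) n y.2 ((morphMatrix g).mulVec q.2.1 + y'.1 - y.1) y'.2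

namespace IsPisot

theorem segs_bounds_morphPow (h : IsPisot g x lam f) {n : ℕ} {b c : Letter d} {v : Letter d → ℤ}
    (hv : (v, c) ∈ segs (morphPow g n b)) :
    0 ≤ f (vec v) ∧ f (vec v) + f (Pi.single c 1) ≤ lam ^ n * f (Pi.single b 1) := by
  have := h.segs_bounds hv
  rwa [h.f_morphPow] at this

/-- Descendants occupy subintervals of the scaled ranges of their ancestors, so a descendant pair
can overlap only if the ancestors do. -/
theorem overlap_of_descendant (h : IsPisot g x lam f) {n : ℕ} {b b' c c' : Letter d}
    {t v v' : Letter d → ℤ} (hv : (v, c) ∈ segs (morphPow g n b))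
    (hv' : (v', c') ∈ segs (morphPow g n b'))
    (ho : Overlap f c ((morphMatrix g ^ n).mulVec t + v' - v) c') : Overlap f b t b' := by
  obtain ⟨h1, h2⟩ := ho
  rw [vec_sub, vec_add, map_sub, map_add, h.f_mulVec] at h1 h2
  obtain ⟨h3, h4⟩ := h.segs_bounds_morphPow hv
  obtain ⟨h5, h6⟩ := h.segs_bounds_morphPow hv'
  have hl : 0 < lam ^ n := pow_pos (by linarith [h.one_lt]) n
  constructor
  · refine lt_of_mul_lt_mul_left (a := lam ^ n) ?_ hl.le; linarith
  · refine pos_of_mul_pos_right (a := lam ^ n) ?_ hl.le; linarith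

/-- All overlapping descendants of the initial overlap remain in `Q`, by induction on the level; a
coincidence would be a descendant with equal letters and zero offset, which `Q` excludes. -/
theorem not_allCoincide_of_witness (h : IsPisot g x lam f) {n : ℕ}
    {Q : List (Letter d × (Letter d → ℤ) × Letter d)} (hw : NonCoincidenceWitness g n Q) :
    ¬ AllCoincide g f := by
  obtain ⟨⟨⟨b, t, b'⟩, hq, ho⟩, hQ⟩ := hw
  intro hall
  have key : ∀ m c c' v v', (v, c) ∈ segs (morphPow g m b) → (v', c') ∈ segs (morphPow g m b') →
      Overlap f c ((morphMatrix g ^ m).mulVec t + v' - v) c' →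
      (c, (morphMatrix g ^ m).mulVec t + v' - v, c') ∈ Q := by
    intro m
    induction m with
    | zero =>
      intro c c' v v' hv hv' _
      simp only [morphPow, segs_singleton] at hv hv'
      obtain ⟨rfl, rfl⟩ := hv
      obtain ⟨rfl, rfl⟩ := hv'
      simpa using hq
    | succ m ih =>
      intro c c' v v' hv hv' ho
      obtain ⟨v₁, c₁, u, h1, h2, rfl⟩ := segs_morphPow_add.1 hv
      obtain ⟨v₁', c₁', u', h1', h2', rfl⟩ := segs_morphPow_add.1 hv'
      have e : (morphMatrix g ^ (m + 1)).mulVec t + ((morphMatrix g ^ 1).mulVec v₁' + u') -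
          ((morphMatrix g ^ 1).mulVec v₁ + u) = (morphMatrix g ^ 1).mulVec
            ((morphMatrix g ^ m).mulVec t + v₁' - v₁) + u' - u := by
        rw [Matrix.mulVec_sub, Matrix.mulVec_add, Matrix.mulVec_mulVec, ← pow_add, add_comm 1 m]
        abel
      rw [e] at ho ⊢
      have h3 := ih _ _ _ _ h1 h1' (h.overlap_of_descendant h2 h2' ho)
      rw [morphPow_one] at h2 h2'
      rw [pow_one] at ho ⊢
      exact ((hQ _ h3).2 _ h2 _ h2').resolve_right fun h4 => h.not_overlap h4 ho
  obtain ⟨m, v, c, h1, h2⟩ := hall b t b' (h.overlap_of_witness ho)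
  have e : (morphMatrix g ^ m).mulVec t + (v - (morphMatrix g ^ m).mulVec t) - v = 0 := by abel
  have h3 := key m c c v _ h1 h2 (by
    rw [e]
    exact ⟨by simpa [vec_zero] using h.pos c, by simpa [vec_zero] using h.pos c⟩)
  rw [e] at h3
  exact (hQ _ h3).1 ⟨rfl, rfl⟩

theorem exists_nonCoincidenceWitness (h : IsPisot g x lam f) (hall : ¬ AllCoincide g f) :
    ∃ n Q, NonCoincidenceWitness g n Q := by
  unfold AllCoincide at hall
  push Not at hall
  obtain ⟨b, t, b', ho, hno⟩ := hall
  -- All overlapping descendants of an overlap that never coincides. Their offsets have bounded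
  -- height, and bounded projection by contraction and `tube`, so there are finitely many.
  let S : Set (Letter d × (Letter d → ℤ) × Letter d) := {q | ∃ m v v',
    (v, q.1) ∈ segs (morphPow g m b) ∧ (v', q.2.2) ∈ segs (morphPow g m b') ∧
    q.2.1 = (morphMatrix g ^ m).mulVec t + v' - v ∧ Overlap f q.1 q.2.1 q.2.2}
  obtain ⟨R, hR0, hR⟩ := h.tube
  obtain ⟨F, hF0, hF⟩ := h.exists_bound
  obtain ⟨C, ρ, hC, hρ0, hρ1, hCρ⟩ := h.perron.exponential_of_contracts h.contracts
  have hS : S.Finite := by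
    have h1 := h.finite_bounded (C * ‖vec t‖ + R + R) F
    refine (Set.finite_univ.prod (h1.prod Set.finite_univ)).subset ?_
    rintro ⟨c, s, c'⟩ ⟨m, v, v', hv, hv', rfl, ho'⟩
    refine ⟨trivial, ⟨?_, ?_⟩, trivial⟩
    · simp only
      rw [vec_sub, vec_add, map_sub, map_add, vec_mulVec_pow]
      refine (norm_sub_le _ _).trans (add_le_add ((norm_add_le _ _).trans (add_le_add ?_ ?_)) ?_)
      · refine (hCρ m (vec t)).trans ?_
        have := pow_le_one₀ hρ0.le hρ1.le (n := m)
        gcongr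
        nlinarith
      · exact hR _ _ _ _ hv'
      · exact hR _ _ _ _ hv
    · obtain ⟨h2, h3⟩ := ho'
      have := hF c
      have := hF c'
      exact abs_le.2 ⟨by simp only at *; linarith, by simp only at *; linarith⟩
  let Q := hS.toFinset.toList
  have hQ : ∀ q, q ∈ Q ↔ q ∈ S := fun q => by simp [Q]
  have h1 : ∀ᶠ n in atTop, ∀ q ∈ hS.toFinset, ∀ y ∈ (segs (g q.1)).toFinset,
      ∀ y' ∈ (segs (g q.2.2)).toFinset,
      ¬ Overlap f y.2 ((morphMatrix g).mulVec q.2.1 + y'.1 - y.1) y'.2 →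
        DisjointWitness (morphMatrix g) n y.2 ((morphMatrix g).mulVec q.2.1 + y'.1 - y.1) y'.2 := by
    refine (eventually_all_finset _).2 fun q _ => (eventually_all_finset _).2 fun y _ =>
      (eventually_all_finset _).2 fun y' _ => ?_
    by_cases ho' : Overlap f y.2 ((morphMatrix g).mulVec q.2.1 + y'.1 - y.1) y'.2
    · exact Eventually.of_forall fun n h => absurd ho' h
    · exact (h.eventually_disjointWitness ho').mono fun n hn _ => hn
  obtain ⟨n, hn1, hn2⟩ := (h1.and (h.eventually_overlapWitness ho)).exists
  refine ⟨n, Q, ⟨(b, t, b'), (hQ _).2 ⟨0, 0, 0, by simp [morphPow, segs_singleton],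
    by simp [morphPow, segs_singleton], by simp, ho⟩, hn2⟩, ?_⟩
  rintro ⟨c, s, c'⟩ hq
  obtain ⟨m, v, v', hv, hv', hs, ho'⟩ := (hQ _).1 hq
  simp only at hv hv' hs
  refine ⟨?_, fun y hy y' hy' => ?_⟩
  · simp only
    rintro ⟨rfl, rfl⟩
    refine hno m ⟨v, c, hv, ?_⟩
    rwa [← sub_eq_zero.1 hs.symm, add_sub_cancel_left]
  · simp only at hy hy' ⊢
    by_cases ho2 : Overlap f y.2 ((morphMatrix g).mulVec s + y'.1 - y.1) y'.2
    · left
      refine (hQ _).2 ⟨m + 1, (morphMatrix g).mulVec v + y.1, (morphMatrix g).mulVec v' + y'.1,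
        ?_, ?_, ?_, ho2⟩
      · exact segs_morphPow_add.2 ⟨v, c, y.1, hv, by rwa [morphPow_one], by rw [pow_one]⟩
      · exact segs_morphPow_add.2 ⟨v', c', y'.1, hv', by rwa [morphPow_one], by rw [pow_one]⟩
      · rw [hs, Matrix.mulVec_sub, Matrix.mulVec_add, Matrix.mulVec_mulVec, ← pow_succ']
        abel_nf
    · exact Or.inr (hn1 _ (hS.mem_toFinset.2 ((hQ _).1 hq)) y (List.mem_toFinset.2 hy) y'
        (List.mem_toFinset.2 hy') ho2)

end IsPisot

/-- A bound for the overlaps in the attractor. -/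
def attractorBound (M : Matrix (Letter d) (Letter d) ℤ) (N k : ℕ) : ℕ :=
  (entrySum (M ^ k) + ((d : ℤ) + 1) * entrySum (M ^ k) * (2 * ((d : ℤ) + 2) * entrySum (M ^ N) + 1) +
    (2 * ((d : ℤ) + 2) * entrySum (M ^ N) + 1)).toNat

/-- The vectors with coordinates in `[-H, H]`, enumerated. -/
def boxVector (H m : ℕ) (i : Letter d) : ℤ := ((m / (2 * H + 1) ^ (i : ℕ) % (2 * H + 1) : ℕ) : ℤ) - H

/-- The number `m` has the shifted coordinates `t i + H` as digits in base `2 * H + 1`. -/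
theorem exists_boxVector {H : ℕ} {t : Letter d → ℤ} (ht : ∀ i, |t i| ≤ H) :
    ∃ m < (2 * H + 1) ^ (d + 1), boxVector H m = t := by
  let e : Letter d → Fin (2 * H + 1) := fun i => ⟨(t i + H).toNat, by
    have := abs_le.1 (ht i); omega⟩
  refine ⟨finFunctionFinEquiv e, (finFunctionFinEquiv e).2, funext fun i => ?_⟩
  have h1 : ((finFunctionFinEquiv.symm (finFunctionFinEquiv e)) i : ℕ) = (t i + H).toNat := by
    rw [Equiv.symm_apply_apply]
  rw [finFunctionFinEquiv_symm_apply_val] at h1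
  rw [boxVector, h1]
  have := abs_le.1 (ht i)
  omega

/-- A finite witness of coincidence for all overlaps. -/
def CoincidenceWitness (g : Letter d → List (Letter d)) (N k n : ℕ) : Prop :=
  ∀ m < (2 * attractorBound (morphMatrix g) N k + 1) ^ (d + 1), ∀ b b',
    DisjointWitness (morphMatrix g) n b (boxVector (attractorBound (morphMatrix g) N k) m) b' ∨
      Coincide g n b (boxVector (attractorBound (morphMatrix g) N k) m) b'

theorem Coincide.descend {n m : ℕ} {b b' c c' : Letter d} {t v v' : Letter d → ℤ}
    (hv : (v, c) ∈ segs (morphPow g n b)) (hv' : (v', c') ∈ segs (morphPow g n b'))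
    (hc : Coincide g m c ((morphMatrix g ^ n).mulVec t + v' - v) c') : Coincide g (n + m) b t b' := by
  obtain ⟨u, a, h1, h2⟩ := hc
  refine ⟨(morphMatrix g ^ m).mulVec v + u, a, segs_morphPow_add.2 ⟨v, c, u, hv, h1, rfl⟩,
    segs_morphPow_add.2 ⟨v', c', _, hv', h2, ?_⟩⟩
  rw [Matrix.mulVec_sub, Matrix.mulVec_add, Matrix.mulVec_mulVec, ← pow_add, add_comm n m]
  abel

namespace IsPisot

/-- A shared segment produces shared images; the first letter of its image exists because no image
is empty. -/
theorem coincide_mono (h : IsPisot g x lam f) {n m : ℕ} (hnm : n ≤ m) {b b' : Letter d}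
    {t : Letter d → ℤ} (hc : Coincide g n b t b') : Coincide g m b t b' := by
  obtain ⟨k, rfl⟩ := Nat.exists_eq_add_of_le hnm
  obtain ⟨v, c, h1, h2⟩ := hc
  refine Coincide.descend h1 h2 ?_
  rw [show (morphMatrix g ^ n).mulVec t + (v - (morphMatrix g ^ n).mulVec t) - v = 0 by abel]
  obtain ⟨a, w, hw⟩ := List.exists_cons_of_ne_nil (morphPow_ne_nil h.perron.ne_nil k c)
  have h3 : (0, a) ∈ segs (morphPow g k c) := mem_segs.2 ⟨[], w, hw, abWord_nil.symm⟩
  exact ⟨0, a, h3, by simpa using h3⟩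

/-- Among the descendants of an overlap there are overlaps. -/
theorem exists_descendant (h : IsPisot g x lam f) (n : ℕ) {b b' : Letter d} {t : Letter d → ℤ}
    (ho : Overlap f b t b') : ∃ v c v' c', (v, c) ∈ segs (morphPow g n b) ∧
      (v', c') ∈ segs (morphPow g n b') ∧
      Overlap f c ((morphMatrix g ^ n).mulVec t + v' - v) c' := by
  have hl : 0 < lam ^ n := pow_pos (by linarith [h.one_lt]) n
  obtain ⟨h1, h2⟩ := ho
  have hm : max 0 (f (vec t)) < f (Pi.single b 1) := max_lt (h.pos b) h1
  have hm' : max 0 (f (vec t)) < f (vec t) + f (Pi.single b' 1) :=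
    max_lt h2 (by linarith [h.pos b'])
  generalize hs : max 0 (f (vec t)) = s at hm hm'
  have hs0 : 0 ≤ s := hs ▸ le_max_left _ _
  have hst : f (vec t) ≤ s := hs ▸ le_max_right _ _
  obtain ⟨v, c, hv, h3, h4⟩ := cover (f := f) (morphPow g n b) (l := lam ^ n * s) (by positivity)
    (by rw [h.f_morphPow]; gcongr)
  obtain ⟨v', c', hv', h5, h6⟩ := cover (f := f) (morphPow g n b') (l := lam ^ n * (s - f (vec t)))
    (mul_nonneg hl.le (by linarith)) (by rw [h.f_morphPow]; gcongr; linarith)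
  refine ⟨v, c, v', c', hv, hv', ?_, ?_⟩ <;>
    rw [vec_sub, vec_add, map_sub, map_add, h.f_mulVec] <;> linarith

/-- Every overlap has an overlapping descendant in the computable box, where the certificate
provides a coincidence; coincidences of descendants pass back to the ancestor. -/
theorem allCoincide_of_witness (h : IsPisot g x lam f) {N k n : ℕ}
    (hw : ContractionWitness (morphMatrix g) N k) (hn : CoincidenceWitness g N k n) :
    AllCoincide g f := by
  set L : ℝ := ((entrySum (morphMatrix g ^ N) : ℤ) : ℝ) with hL
  set F : ℝ := ((entrySum (morphMatrix g ^ k) : ℤ) : ℝ) with hF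
  have hL0 : 0 ≤ L := by
    rw [hL]
    exact_mod_cast Finset.sum_nonneg fun i _ => Finset.sum_nonneg fun l _ =>
      h.perron.pow_nonneg N l i
  have hFx : ∀ l, 1 ≤ F * x l := hw.one_le_mul h.perron
  have hF0 : 0 ≤ F := by
    rw [hF]
    exact_mod_cast Finset.sum_nonneg fun i _ => Finset.sum_nonneg fun l _ =>
      h.perron.pow_nonneg k l i
  have hfF : ∀ b, f (Pi.single b 1) ≤ F := by
    intro b
    -- One term of `f x = 1`; with `1 ≤ F * x b` this bounds the letter height by the integer `F`.
    have h1 : x b * f (Pi.single b 1) ≤ f x := by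
      conv_rhs => rw [eq_sum_single x, map_sum]
      simp_rw [map_smul, smul_eq_mul]
      exact Finset.single_le_sum (f := fun j => x j * f (Pi.single j 1))
        (fun j _ => mul_nonneg (h.perron.x_nonneg j) (h.pos j).le) (Finset.mem_univ b)
    rw [h.left.f_x] at h1
    have h2 := mul_le_mul_of_nonneg_left h1 hF0
    have h3 := mul_le_mul_of_nonneg_right (hFx b) (h.pos b).le
    linarith
  have hseg : ∀ b v c, (v, c) ∈ segs (morphPow g N b) → ∀ i, 0 ≤ v i ∧ (v i : ℝ) ≤ L := by
    intro b v c hv i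
    obtain ⟨p, s, h1, rfl⟩ := mem_segs.1 hv
    refine ⟨abWord_nonneg _ _, ?_⟩
    have h2 : abWord p i ≤ abWord (morphPow g N b) i := by
      rw [h1, abWord_append, Pi.add_apply]; linarith [abWord_nonneg (c :: s) i]
    have h3 : abWord (morphPow g N b) i = (morphMatrix g ^ N) i b := by
      rw [abWord_morphPow]; simp
    have h4 : (morphMatrix g ^ N) i b ≤ entrySum (morphMatrix g ^ N) :=
      (Finset.single_le_sum (f := fun l => (morphMatrix g ^ N) l b)
        (fun l _ => h.perron.pow_nonneg N l b) (Finset.mem_univ i)).trans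
      (Finset.single_le_sum (f := fun j => colSum (morphMatrix g ^ N) j)
        (fun j _ => Finset.sum_nonneg fun l _ => h.perron.pow_nonneg N l j) (Finset.mem_univ b))
    rw [hL]
    exact_mod_cast h2.trans (h3.trans_le h4)
  have hbase : ∀ b t b', Overlap f b t b' → ‖prj x (vec t)‖ ≤ 2 * (d + 2) * L + 1 →
      Coincide g n b t b' := by
    intro b t b' ho hp
    have hbox : ∀ i, |t i| ≤ attractorBound (morphMatrix g) N k := by
      intro i
      have h1 : |f (vec t)| ≤ F := abs_le.2 ⟨by linarith [ho.2, hfF b'], by linarith [ho.1, hfF b]⟩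
      have h2 : |f (prj x (vec t))| ≤ (d + 1) * F * (2 * (d + 2) * L + 1) := by
        rw [eq_sum_single (prj x (vec t)), map_sum]
        refine (Finset.abs_sum_le_sum_abs _ _).trans ?_
        calc ∑ j, |f (prj x (vec t) j • Pi.single j 1)|
            ≤ ∑ _j : Letter d, (2 * (d + 2) * L + 1) * F := by
              refine Finset.sum_le_sum fun j _ => ?_
              rw [map_smul, smul_eq_mul, abs_mul, abs_of_pos (h.pos j)]
              exact mul_le_mul ((norm_le_pi_norm _ j).trans hp) (hfF j) (h.pos j).le (by positivity)
          _ = _ := by simp; ring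
      have h3 : |ht (vec t)| ≤ F + (d + 1) * F * (2 * (d + 2) * L + 1) := by
        rw [show ht (vec t) = f (vec t) - f (prj x (vec t)) by
          rw [h.left.f_eq h.perron]; ring]
        exact (abs_sub _ _).trans (add_le_add h1 h2)
      have h4 : |(t i : ℝ)| ≤ F + (d + 1) * F * (2 * (d + 2) * L + 1) + (2 * (d + 2) * L + 1) := by
        have h5 := congrFun (h.perron.eq_add (vec t)) i
        rw [Pi.add_apply, Pi.smul_apply, smul_eq_mul] at h5
        rw [show (t i : ℝ) = vec t i from rfl, h5]
        refine (abs_add_le _ _).trans (add_le_add ?_ ((norm_le_pi_norm _ i).trans hp))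
        rw [abs_mul, abs_of_nonneg (h.perron.x_nonneg i)]
        exact (mul_le_of_le_one_right (abs_nonneg _) (h.perron.x_le_one i)).trans h3
      refine le_trans ?_ (Int.self_le_toNat _)
      rw [hL, hF] at h4
      exact_mod_cast h4
    obtain ⟨m, hm, rfl⟩ := exists_boxVector hbox
    exact (hn m hm b b').resolve_left fun h1 => h.not_overlap h1 ho
  -- One descent by `N` levels halves the projection and adds at most `(d + 2) * L`. The attracting
  -- radius is `2 * (d + 2) * L`; the extra one makes the box reachable in finitely many descents.
  have hstep : ∀ j : ℕ, ∀ b t b', Overlap f b t b' → ‖prj x (vec t)‖ ≤ 2 * (d + 2) * L + 1 + j / 2 →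
      ∃ n, Coincide g n b t b' := by
    intro j
    induction j with
    | zero => intro b t b' ho hp; exact ⟨n, hbase b t b' ho (by simpa using hp)⟩
    | succ j ih =>
      intro b t b' ho hp
      obtain ⟨v, c, v', c', hv, hv', ho'⟩ := h.exists_descendant N ho
      obtain ⟨m, hm⟩ := ih c _ c' ho' (by
        rw [add_sub_assoc, vec_add, map_add, vec_mulVec_pow]
        refine (norm_add_le _ _).trans ?_
        have h1 : ‖prj x ((rl (morphMatrix g) ^ N).mulVec (vec t))‖ ≤ 1 / 2 * ‖prj x (vec t)‖ := by
          rw [← h.perron.prj_pow]; exact hw.half h.perron _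
        have h2 : ‖prj x (vec (v' - v))‖ ≤ (d + 2) * L := by
          refine (h.perron.norm_prj_le _).trans (mul_le_mul_of_nonneg_left ?_ (by positivity))
          refine (pi_norm_le_iff_of_nonneg hL0).2 fun i => ?_
          obtain ⟨h3, h4⟩ := hseg _ _ _ hv i
          obtain ⟨h5, h6⟩ := hseg _ _ _ hv' i
          have h3' : (0 : ℝ) ≤ v i := by exact_mod_cast h3
          have h5' : (0 : ℝ) ≤ v' i := by exact_mod_cast h5
          simp only [vec, Pi.sub_apply, Int.cast_sub, Real.norm_eq_abs]
          exact abs_le.2 ⟨by linarith, by linarith⟩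
        push_cast at hp
        have : (0 : ℝ) ≤ j := Nat.cast_nonneg j
        linarith)
      exact ⟨N + m, Coincide.descend hv hv' hm⟩
  intro b t b' ho
  obtain ⟨j, hj⟩ := exists_nat_ge (2 * ‖prj x (vec t)‖)
  refine hstep j b t b' ho ?_
  have : 0 ≤ 2 * ((d : ℝ) + 2) * L := by positivity
  linarith

/-- The box is finite and both alternatives persist when `n` grows, so one `n` serves all offsets.
-/
theorem exists_coincidenceWitness (h : IsPisot g x lam f) (hall : AllCoincide g f) (N k : ℕ) :
    ∃ n, CoincidenceWitness g N k n := by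
  unfold CoincidenceWitness
  generalize attractorBound (morphMatrix g) N k = H
  have h1 : ∀ᶠ n in atTop, ∀ m ∈ Finset.range ((2 * H + 1) ^ (d + 1)), ∀ b b',
      DisjointWitness (morphMatrix g) n b (boxVector H m) b' ∨
        Coincide g n b (boxVector H m) b' := by
    refine (eventually_all_finset _).2 fun m _ => eventually_all.2 fun b => eventually_all.2 fun b' => ?_
    by_cases ho : Overlap f b (boxVector H m) b'
    · obtain ⟨n, hn⟩ := hall _ _ _ ho
      exact (eventually_ge_atTop n).mono fun l hl => Or.inr (h.coincide_mono hl hn)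
    · exact (h.eventually_disjointWitness ho).mono fun n hn => Or.inl hn
  obtain ⟨n, hn⟩ := h1.exists
  exact ⟨n, fun m hm => hn m (Finset.mem_range.2 hm)⟩

end IsPisot

end Evidence

/-! ### Primitive recursive integer arithmetic and bounded quantifiers -/

section PrimrecInt

variable {α : Type*} [Primcodable α]

theorem encode_natCast_int (n : ℕ) : Encodable.encode (n : ℤ) = 2 * n := rfl

theorem encode_negSucc_int (n : ℕ) : Encodable.encode (Int.negSucc n) = 2 * n + 1 := rfl

theorem Primrec.int_natCast {f : α → ℕ} (hf : Primrec f) : Primrec fun a => (f a : ℤ) :=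
  Primrec.encode_iff.1 ((Primrec.nat_double.comp hf).of_eq fun _ => (encode_natCast_int _).symm)

theorem Primrec.int_negSucc {f : α → ℕ} (hf : Primrec f) : Primrec fun a => Int.negSucc (f a) :=
  Primrec.encode_iff.1 ((Primrec.nat_double_succ.comp hf).of_eq fun _ => (encode_negSucc_int _).symm)

theorem Primrec.int_toNat {f : α → ℤ} (hf : Primrec f) : Primrec fun a => (f a).toNat := by
  have h1 : Primrec fun n : ℕ => if n % 2 = 0 then n / 2 else 0 :=
    Primrec.ite (Primrec.eq.comp (Primrec.nat_mod.comp Primrec.id (Primrec.const 2))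
      (Primrec.const 0)) (Primrec.nat_div.comp Primrec.id (Primrec.const 2)) (Primrec.const 0)
  refine (h1.comp (Primrec.encode.comp hf)).of_eq fun a => ?_
  cases f a with
  | ofNat n =>
    rw [Int.ofNat_eq_natCast, encode_natCast_int]; simp
  | negSucc n =>
    rw [encode_negSucc_int, if_neg (by omega)]; rfl

theorem Primrec.int_subNatNat {f g : α → ℕ} (hf : Primrec f) (hg : Primrec g) :
    Primrec fun a => (f a : ℤ) - g a := by
  -- As `Int.negSucc k` is `-(k + 1)`, the negative case subtracts one more.
  refine (Primrec.ite (Primrec.nat_le.comp hg hf) (Primrec.nat_sub.comp hf hg).int_natCast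
    (Primrec.int_negSucc (Primrec.nat_sub.comp (Primrec.nat_sub.comp hg hf)
      (Primrec.const 1)))).of_eq fun a => ?_
  split_ifs <;> omega

theorem Primrec.int_neg {f : α → ℤ} (hf : Primrec f) : Primrec fun a => -f a := by
  have h1 : Primrec fun n : ℕ => if n % 2 = 0 then (-((n / 2 : ℕ) : ℤ)) else ((n / 2 + 1 : ℕ) : ℤ) :=
    Primrec.ite (Primrec.eq.comp (Primrec.nat_mod.comp Primrec.id (Primrec.const 2))
      (Primrec.const 0))
      ((Primrec.int_subNatNat (Primrec.const 0)
        (Primrec.nat_div.comp Primrec.id (Primrec.const 2))).of_eq fun n => by simp)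
      (Primrec.int_natCast (Primrec.succ.comp (Primrec.nat_div.comp Primrec.id (Primrec.const 2))))
  refine (h1.comp (Primrec.encode.comp hf)).of_eq fun a => ?_
  cases f a with
  | ofNat n =>
    rw [Int.ofNat_eq_natCast, encode_natCast_int, if_pos (by omega)]; omega
  | negSucc n =>
    rw [encode_negSucc_int, if_neg (by omega)]; omega

theorem Primrec.int_add {f g : α → ℤ} (hf : Primrec f) (hg : Primrec g) :
    Primrec fun a => f a + g a :=
  (Primrec.int_subNatNat (Primrec.nat_add.comp hf.int_toNat hg.int_toNat)
    (Primrec.nat_add.comp hf.int_neg.int_toNat hg.int_neg.int_toNat)).of_eq fun a => by omega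

theorem Primrec.int_sub {f g : α → ℤ} (hf : Primrec f) (hg : Primrec g) :
    Primrec fun a => f a - g a :=
  (hf.int_add hg.int_neg).of_eq fun _ => (sub_eq_add_neg _ _).symm

theorem Primrec.int_mul {f g : α → ℤ} (hf : Primrec f) (hg : Primrec g) :
    Primrec fun a => f a * g a := by
  have h1 := hf.int_toNat
  have h2 := hf.int_neg.int_toNat
  have h3 := hg.int_toNat
  have h4 := hg.int_neg.int_toNat
  refine (Primrec.int_subNatNat
    (Primrec.nat_add.comp (Primrec.nat_mul.comp h1 h3) (Primrec.nat_mul.comp h2 h4))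
    (Primrec.nat_add.comp (Primrec.nat_mul.comp h1 h4) (Primrec.nat_mul.comp h2 h3))).of_eq
      fun a => ?_
  have e : ∀ z : ℤ, z = (z.toNat : ℤ) - ((-z).toNat : ℤ) := fun z => by omega
  conv_rhs => rw [e (f a), e (g a)]
  push_cast
  ring

theorem Primrec.int_abs {f : α → ℤ} (hf : Primrec f) : Primrec fun a => |f a| :=
  (Primrec.int_natCast (Primrec.nat_add.comp hf.int_toNat hf.int_neg.int_toNat)).of_eq fun a => by
    rcases abs_cases (f a) with h | h <;> omega

theorem PrimrecPred.int_le {f g : α → ℤ} (hf : Primrec f) (hg : Primrec g) :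
    PrimrecPred fun a => f a ≤ g a :=
  (Primrec.eq.comp (hf.int_sub hg).int_toNat (Primrec.const 0)).of_eq fun a => by omega

theorem PrimrecPred.int_lt {f g : α → ℤ} (hf : Primrec f) (hg : Primrec g) :
    PrimrecPred fun a => f a < g a :=
  (PrimrecPred.int_le hg hf).not.of_eq fun _ => not_le

theorem PrimrecPred.eq {β : Type*} [Primcodable β] {f g : α → β} (hf : Primrec f) (hg : Primrec g) :
    PrimrecPred fun a => f a = g a := Primrec.eq.comp hf hg

/-- The index set is fixed, so the sum is a fixed finite composition and no uniformity in the index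
is required. -/
theorem Primrec.int_sum {ι : Type*} (s : Finset ι) {f : α → ι → ℤ}
    (hf : ∀ i, Primrec fun a => f a i) : Primrec fun a => ∑ i ∈ s, f a i := by
  induction s using Finset.cons_induction with
  | empty => simpa using Primrec.const (0 : ℤ)
  | cons i s hi ih => simpa only [Finset.sum_cons] using (hf i).int_add ih

theorem Primrec.int_prod {ι : Type*} (s : Finset ι) {f : α → ι → ℤ}
    (hf : ∀ i, Primrec fun a => f a i) : Primrec fun a => ∏ i ∈ s, f a i := by
  induction s using Finset.cons_induction with
  | empty => simpa using Primrec.const (1 : ℤ)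
  | cons i s hi ih => simpa only [Finset.prod_cons] using (hf i).int_mul ih

theorem Primrec.int_pow {f : α → ℤ} (hf : Primrec f) (n : ℕ) : Primrec fun a => f a ^ n :=
  (Primrec.int_prod (Finset.range n) fun _ => hf).of_eq fun a => by simp

theorem Primrec.nat_pow_const {f : α → ℕ} (hf : Primrec f) (n : ℕ) : Primrec fun a => f a ^ n :=
  (hf.int_natCast.int_pow n).int_toNat.of_eq fun a => by
    rw [← Nat.cast_pow, Int.toNat_natCast]

theorem PrimrecPred.const (p : Prop) : PrimrecPred fun _ : α => p := by
  exact ⟨fun _ => Classical.dec p, Primrec.const (@decide p (Classical.dec p))⟩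

theorem PrimrecPred.forall_fin {n : ℕ} {p : α → Fin n → Prop}
    (hp : ∀ i, PrimrecPred fun a => p a i) : PrimrecPred fun a => ∀ i, p a i := by
  induction n with
  | zero => exact (PrimrecPred.const True).of_eq fun a => by simp
  | succ n ih =>
    exact ((hp 0).and (ih fun i => hp i.succ)).of_eq fun _ => (Fin.forall_fin_succ).symm

theorem PrimrecPred.forall_mem {β : Type*} [Primcodable β] {L : α → List β} {p : α → β → Prop}
    (hL : Primrec L) (hp : PrimrecPred fun q : α × β => p q.1 q.2) :
    PrimrecPred fun a => ∀ b ∈ L a, p a b := by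
  have h : PrimrecRel fun (b : β) (a : α) => p a b := hp.comp (Primrec.snd.pair Primrec.fst)
  exact h.forall_mem_list.comp hL Primrec.id

theorem PrimrecPred.exists_mem {β : Type*} [Primcodable β] {L : α → List β} {p : α → β → Prop}
    (hL : Primrec L) (hp : PrimrecPred fun q : α × β => p q.1 q.2) :
    PrimrecPred fun a => ∃ b ∈ L a, p a b := by
  have h : PrimrecRel fun (b : β) (a : α) => p a b := hp.comp (Primrec.snd.pair Primrec.fst)
  exact h.exists_mem_list.comp hL Primrec.id

theorem PrimrecPred.mem {β : Type*} [Primcodable β] {L : α → List β} {f : α → β}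
    (hL : Primrec L) (hf : Primrec f) : PrimrecPred fun a => f a ∈ L a :=
  (PrimrecPred.exists_mem hL (p := fun a b => f a = b)
    (PrimrecPred.eq (hf.comp Primrec.fst) Primrec.snd)).of_eq fun a => by simp

theorem PrimrecPred.forall_lt' {f : α → ℕ} {p : α → ℕ → Prop}
    (hf : Primrec f) (hp : PrimrecPred fun q : α × ℕ => p q.1 q.2) :
    PrimrecPred fun a => ∀ m < f a, p a m :=
  (PrimrecPred.forall_mem (Primrec.list_range.comp hf) hp).of_eq fun a => by simp

theorem Primrec.pi_iff {β : Type*} [Primcodable β] {n : ℕ} {f : α → Fin n → β} :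
    Primrec f ↔ ∀ i, Primrec fun a => f a i := by
  rw [Primrec.fin_curry]
  exact ⟨fun h => Primrec.fin_curry₁.1 h.swap, fun h => (Primrec.fin_curry₁.2 h).swap⟩

theorem Primrec.pi_apply {β : Type*} [Primcodable β] {n : ℕ} {f : α → Fin n → β} {i : α → Fin n}
    (hf : Primrec f) (hi : Primrec i) : Primrec fun a => f a (i a) :=
  Primrec.fin_app.comp hf hi

end PrimrecInt

/-! ### The certificates are primitive recursive predicates -/

section PrimrecMatrix

variable {α : Type*} [Primcodable α] {d : ℕ}

theorem Primrec.matrix_mul {A B : α → Matrix (Letter d) (Letter d) ℤ}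
    (hA : ∀ i j, Primrec fun a => A a i j) (hB : ∀ i j, Primrec fun a => B a i j) (i j : Letter d) :
    Primrec fun a => (A a * B a) i j :=
  (Primrec.int_sum Finset.univ fun k => (hA i k).int_mul (hB k j)).of_eq fun _ =>
    (Matrix.mul_apply).symm

theorem Primrec.mulVec {A : α → Matrix (Letter d) (Letter d) ℤ} {v : α → Letter d → ℤ}
    (hA : ∀ i j, Primrec fun a => A a i j) (hv : ∀ i, Primrec fun a => v a i) (i : Letter d) :
    Primrec fun a => (A a).mulVec (v a) i :=
  Primrec.int_sum Finset.univ fun k => (hA i k).int_mul (hv k)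

/-- Here the exponent varies with the input, so a genuine primitive recursion is needed, on matrices
seen as functions of two indices. -/
theorem Primrec.matrix_pow {A : α → Matrix (Letter d) (Letter d) ℤ} {n : α → ℕ}
    (hA : ∀ i j, Primrec fun a => A a i j) (hn : Primrec n) (i j : Letter d) :
    Primrec fun a => (A a ^ n a) i j := by
  let f : α → Letter d → Letter d → ℤ := fun _ i j => (1 : Matrix (Letter d) (Letter d) ℤ) i j
  let g : α → ℕ × (Letter d → Letter d → ℤ) → Letter d → Letter d → ℤ :=
    fun a p i j => ∑ k, p.2 i k * A a k j
  have hf : Primrec f := Primrec.const _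
  have hg : Primrec₂ g := by
    refine Primrec.pi_iff.2 fun i => Primrec.pi_iff.2 fun j => Primrec.int_sum Finset.univ fun k => ?_
    refine Primrec.int_mul ?_ ((hA k j).comp Primrec.fst)
    exact Primrec.pi_iff.1 (Primrec.pi_iff.1 (Primrec.snd.comp Primrec.snd) i) k
  have h := (Primrec.nat_rec hf hg).comp Primrec.id hn
  refine (Primrec.pi_iff.1 (Primrec.pi_iff.1 h i) j).of_eq fun a => ?_
  have key : ∀ m, (Nat.rec (f a) (fun n IH => g a (n, IH)) m : Letter d → Letter d → ℤ) =
      fun i j => (A a ^ m) i j := by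
    intro m
    induction m with
    | zero => simp [f]
    | succ m ih =>
      show g a (m, _) = _
      funext i j
      simp only [g]
      rw [pow_succ, Matrix.mul_apply]
      exact Finset.sum_congr rfl fun k _ => by rw [ih]
  simp only [id]
  rw [key]

/-- The Leibniz formula, over a fixed group of permutations. -/
theorem Primrec.det {ι : Type*} [Fintype ι] [DecidableEq ι] {A : α → Matrix ι ι ℤ}
    (hA : ∀ i j, Primrec fun a => A a i j) : Primrec fun a => (A a).det :=
  (Primrec.int_sum Finset.univ fun σ : Equiv.Perm ι =>
    (Primrec.const ((Equiv.Perm.sign σ : ℤˣ) : ℤ)).int_mul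
      (Primrec.int_prod Finset.univ fun i => hA (σ i) i)).of_eq fun _ => (Matrix.det_apply' _).symm

theorem Primrec.trace {A : α → Matrix (Letter d) (Letter d) ℤ}
    (hA : ∀ i j, Primrec fun a => A a i j) : Primrec fun a => (A a).trace :=
  Primrec.int_sum Finset.univ fun i => hA i i

theorem Primrec.abWord {w : α → List (Letter d)} (hw : Primrec w) :
    Primrec fun a => _root_.abWord (w a) := by
  refine Primrec.pi_iff.2 fun i => Primrec.int_natCast ?_
  have h1 : PrimrecPred fun j : Letter d => j = i := PrimrecPred.eq Primrec.id (Primrec.const i)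
  refine (Primrec.list_length.comp ((Primrec.listFilter h1).comp hw)).of_eq fun a => ?_
  rw [List.count_eq_length_filter]
  rfl

theorem Primrec.segs {w : α → List (Letter d)} (hw : Primrec w) :
    Primrec fun a => _root_.segs (w a) := by
  refine Primrec.list_map (Primrec.list_range.comp (Primrec.list_length.comp hw)) ?_
  refine Primrec.pair (Primrec.abWord ?_) ?_
  · exact Primrec.list_take.comp Primrec.snd (hw.comp Primrec.fst)
  · exact (Primrec.list_getD 0).comp (hw.comp Primrec.fst) Primrec.snd

theorem Primrec.morphMatrix {g : α → Letter d → List (Letter d)} (hg : Primrec g) (i j : Letter d) :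
    Primrec fun a => _root_.morphMatrix (g a) i j :=
  Primrec.pi_iff.1 (Primrec.abWord (Primrec.pi_iff.1 hg j)) i

theorem Primrec.morphPow {g : α → Letter d → List (Letter d)} {n : α → ℕ} {b : α → Letter d}
    (hg : Primrec g) (hn : Primrec n) (hb : Primrec b) :
    Primrec fun a => _root_.morphPow (g a) (n a) (b a) := by
  have h1 : Primrec fun a => [b a] := Primrec.list_cons.comp hb (Primrec.const [])
  have h2 : Primrec₂ fun (a : α) (p : ℕ × List (Letter d)) => p.2.flatMap (g a) := by
    refine Primrec.list_flatMap (Primrec.snd.comp Primrec.snd) ?_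
    exact Primrec.pi_apply (hg.comp (Primrec.fst.comp Primrec.fst)) Primrec.snd
  refine ((Primrec.nat_rec h1 h2).comp Primrec.id hn).of_eq fun a => ?_
  have key : ∀ m, (Nat.rec [b a] (fun n IH => IH.flatMap (g a)) m : List (Letter d)) =
      _root_.morphPow (g a) m (b a) := by
    intro m
    induction m with
    | zero => rfl
    | succ m ih => simp only [_root_.morphPow, ih]
  exact key _

theorem Primrec.morphComp {l : α → List (Letter d → List (Letter d))} (hl : Primrec l) :
    Primrec fun a => _root_.morphComp (l a) := by
  refine Primrec.pi_iff.2 fun b => ?_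
  refine Primrec.list_foldr (h := fun _ q => q.2.flatMap q.1) hl (Primrec.const [b]) ?_
  refine Primrec.list_flatMap (Primrec.snd.comp Primrec.snd) ?_
  exact Primrec.pi_apply (Primrec.fst.comp (Primrec.snd.comp Primrec.fst)) Primrec.snd

theorem PrimrecPred.traceGap {M : α → Matrix (Letter d) (Letter d) ℤ} {n : α → ℕ}
    (hM : ∀ i j, Primrec fun a => M a i j) (hn : Primrec n) :
    PrimrecPred fun a => TraceGap (M a) (n a) := by
  have h1 := Primrec.trace (Primrec.matrix_pow hM (Primrec.succ.comp hn))
  have h2 := Primrec.trace (Primrec.matrix_pow hM (Primrec.nat_add.comp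
    (Primrec.nat_mul.comp (Primrec.const 2) hn) (Primrec.const 2)))
  exact PrimrecPred.int_lt (((Primrec.const (2 * ((d : ℤ) + 1))).int_mul h1.int_abs).int_add
    (Primrec.const _)) ((h1.int_pow 2).int_sub h2).int_abs

theorem PrimrecPred.det_sub_one {ι : Type*} [Fintype ι] [DecidableEq ι] {A : α → Matrix ι ι ℤ}
    (hA : ∀ i j, Primrec fun a => A a i j) : PrimrecPred fun a => (A a - 1).det = 0 :=
  PrimrecPred.eq (Primrec.det fun i j => (hA i j).int_sub (Primrec.const _)) (Primrec.const 0)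

theorem Primrec.steinMatrix {A : α → Matrix (Letter d) (Letter d) ℤ}
    (hA : ∀ i j, Primrec fun a => A a i j) (p q : Letter d × Letter d) :
    Primrec fun a => _root_.steinMatrix (A a) p q := (hA _ _).int_mul (hA _ _)

theorem Primrec.colSum {A : α → Matrix (Letter d) (Letter d) ℤ}
    (hA : ∀ i j, Primrec fun a => A a i j) (i : Letter d) :
    Primrec fun a => _root_.colSum (A a) i := Primrec.int_sum _ fun l => hA l i

theorem Primrec.entrySum {A : α → Matrix (Letter d) (Letter d) ℤ}
    (hA : ∀ i j, Primrec fun a => A a i j) :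
    Primrec fun a => _root_.entrySum (A a) := Primrec.int_sum _ fun i => Primrec.colSum hA i

theorem PrimrecPred.contractionWitness {M : α → Matrix (Letter d) (Letter d) ℤ} {N k : α → ℕ}
    (hM : ∀ i j, Primrec fun a => M a i j) (hN : Primrec N) (hk : Primrec k) :
    PrimrecPred fun a => ContractionWitness (M a) (N a) (k a) := by
  have hA := Primrec.matrix_pow hM hN
  have hB := Primrec.matrix_pow hM hk
  refine (Primrec.nat_le.comp (Primrec.const 1) hN).and (PrimrecPred.and ?_ ?_)
  · exact .forall_fin fun i => .forall_fin fun j => .int_le (Primrec.const 1) (hB i j)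
  · exact .forall_fin fun i => .forall_fin fun j => .forall_fin fun l =>
      .int_le ((Primrec.const _).int_mul (((hA l j).int_mul (Primrec.colSum hB i)).int_sub
        ((Primrec.colSum hA j).int_mul (hB l i))).int_abs) (Primrec.colSum hB i)

theorem Primrec.pi_single {b : α → Letter d} (hb : Primrec b) (i : Letter d) :
    Primrec fun a => (Pi.single (b a) 1 : Letter d → ℤ) i :=
  (Primrec.ite (PrimrecPred.eq (Primrec.const i) hb) (Primrec.const (1 : ℤ)) (Primrec.const 0)).of_eq
    fun a => by rw [Pi.single_apply]

theorem PrimrecPred.disjointWitness {M : α → Matrix (Letter d) (Letter d) ℤ} {n : α → ℕ}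
    {b b' : α → Letter d} {t : α → Letter d → ℤ} (hM : ∀ i j, Primrec fun a => M a i j)
    (hn : Primrec n) (hb : Primrec b) (ht : ∀ i, Primrec fun a => t a i) (hb' : Primrec b') :
    PrimrecPred fun a => DisjointWitness (M a) (n a) (b a) (t a) (b' a) := by
  have hA := Primrec.matrix_pow hM hn
  refine PrimrecPred.or ?_ ?_
  · exact .forall_fin fun i => .int_le (Primrec.const 0)
      (Primrec.mulVec hA (fun i => (ht i).int_sub (Primrec.pi_single hb i)) i)
  · exact .forall_fin fun i => .int_le (Primrec.const 0)
      (Primrec.mulVec hA (fun i => (ht i).int_neg.int_sub (Primrec.pi_single hb' i)) i)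

theorem PrimrecPred.overlapWitness {M : α → Matrix (Letter d) (Letter d) ℤ} {n : α → ℕ}
    {b b' : α → Letter d} {t : α → Letter d → ℤ} (hM : ∀ i j, Primrec fun a => M a i j)
    (hn : Primrec n) (hb : Primrec b) (ht : ∀ i, Primrec fun a => t a i) (hb' : Primrec b') :
    PrimrecPred fun a => OverlapWitness (M a) (n a) (b a) (t a) (b' a) := by
  have hA := Primrec.matrix_pow hM hn
  refine PrimrecPred.and ?_ ?_
  · exact .forall_fin fun i => .int_lt (Primrec.const 0)
      (Primrec.mulVec hA (fun i => (Primrec.pi_single hb i).int_sub (ht i)) i)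
  · exact .forall_fin fun i => .int_lt (Primrec.const 0)
      (Primrec.mulVec hA (fun i => (ht i).int_add (Primrec.pi_single hb' i)) i)

theorem PrimrecPred.coincide {g : α → Letter d → List (Letter d)} {n : α → ℕ}
    {b b' : α → Letter d} {t : α → Letter d → ℤ} (hg : Primrec g)
    (hn : Primrec n) (hb : Primrec b) (ht : ∀ i, Primrec fun a => t a i) (hb' : Primrec b') :
    PrimrecPred fun a => Coincide (g a) (n a) (b a) (t a) (b' a) := by
  have h1 : PrimrecPred fun a => ∃ y ∈ segs (morphPow (g a) (n a) (b a)),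
      (y.1 - (morphMatrix (g a) ^ n a).mulVec (t a), y.2) ∈ segs (morphPow (g a) (n a) (b' a)) := by
    refine .exists_mem (Primrec.segs (Primrec.morphPow hg hn hb)) (.mem
      ((Primrec.segs (Primrec.morphPow hg hn hb')).comp Primrec.fst) (Primrec.pair ?_
        (Primrec.snd.comp Primrec.snd)))
    refine Primrec.pi_iff.2 fun i => Primrec.int_sub ?_ ?_
    · exact Primrec.pi_iff.1 (Primrec.fst.comp Primrec.snd) i
    · exact (Primrec.mulVec (Primrec.matrix_pow (Primrec.morphMatrix hg) hn) ht i).comp Primrec.fst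
  refine h1.of_eq fun a => ⟨?_, ?_⟩
  · rintro ⟨⟨v, c⟩, h1, h2⟩; exact ⟨v, c, h1, h2⟩
  · rintro ⟨v, c, h1, h2⟩; exact ⟨⟨v, c⟩, h1, h2⟩

theorem Primrec.attractorBound {M : α → Matrix (Letter d) (Letter d) ℤ} {N k : α → ℕ}
    (hM : ∀ i j, Primrec fun a => M a i j) (hN : Primrec N) (hk : Primrec k) :
    Primrec fun a => _root_.attractorBound (M a) (N a) (k a) := by
  have hA := Primrec.entrySum (Primrec.matrix_pow hM hN)
  have hB := Primrec.entrySum (Primrec.matrix_pow hM hk)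
  have hR := ((Primrec.const (α := α) (2 * ((d : ℤ) + 2))).int_mul hA).int_add (Primrec.const 1)
  exact ((hB.int_add (((Primrec.const ((d : ℤ) + 1)).int_mul hB).int_mul hR)).int_add hR).int_toNat

theorem Primrec.boxVector {H m : α → ℕ} (hH : Primrec H) (hm : Primrec m) (i : Letter d) :
    Primrec fun a => _root_.boxVector (H a) (m a) i := by
  have h1 : Primrec fun a => 2 * H a + 1 :=
    Primrec.succ.comp (Primrec.nat_mul.comp (Primrec.const 2) hH)
  exact Primrec.int_subNatNat (Primrec.nat_mod.comp
    (Primrec.nat_div.comp hm (h1.nat_pow_const _)) h1) hH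

theorem PrimrecPred.coincidenceWitness {g : α → Letter d → List (Letter d)} {N k n : α → ℕ}
    (hg : Primrec g) (hN : Primrec N) (hk : Primrec k) (hn : Primrec n) :
    PrimrecPred fun a => CoincidenceWitness (g a) (N a) (k a) (n a) := by
  have hM := Primrec.morphMatrix hg
  have hH := Primrec.attractorBound hM hN hk
  refine .forall_lt' (Primrec.nat_pow_const (Primrec.succ.comp
    (Primrec.nat_mul.comp (Primrec.const 2) hH)) (d + 1)) (.forall_fin fun b => .forall_fin fun b' => ?_)
  have ht := Primrec.boxVector (d := d) (hH.comp (Primrec.fst (β := ℕ))) Primrec.snd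
  exact (PrimrecPred.disjointWitness (fun i j => (hM i j).comp Primrec.fst) (hn.comp Primrec.fst)
    (Primrec.const b) ht (Primrec.const b')).or
    (PrimrecPred.coincide (hg.comp Primrec.fst) (hn.comp Primrec.fst) (Primrec.const b) ht
      (Primrec.const b'))

theorem PrimrecPred.nonCoincidenceWitness {g : α → Letter d → List (Letter d)} {n : α → ℕ}
    {Q : α → List (Letter d × (Letter d → ℤ) × Letter d)}
    (hg : Primrec g) (hn : Primrec n) (hQ : Primrec Q) :
    PrimrecPred fun a => NonCoincidenceWitness (g a) (n a) (Q a) := by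
  have hM := Primrec.morphMatrix hg
  refine PrimrecPred.and (.exists_mem hQ ?_) (.forall_mem hQ (PrimrecPred.and ?_ ?_))
  · exact .overlapWitness (fun i j => (hM i j).comp Primrec.fst) (hn.comp Primrec.fst)
      (Primrec.fst.comp Primrec.snd)
      (Primrec.pi_iff.1 (Primrec.fst.comp (Primrec.snd.comp Primrec.snd)))
      (Primrec.snd.comp (Primrec.snd.comp Primrec.snd))
  · exact (PrimrecPred.and (.eq (Primrec.fst.comp Primrec.snd)
      (Primrec.snd.comp (Primrec.snd.comp Primrec.snd)))
      (.eq (Primrec.fst.comp (Primrec.snd.comp Primrec.snd)) (Primrec.const 0))).not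
  · refine .forall_mem (Primrec.segs (Primrec.pi_apply (hg.comp Primrec.fst)
      (Primrec.fst.comp Primrec.snd))) (.forall_mem (Primrec.segs (Primrec.pi_apply
        (hg.comp (Primrec.fst.comp Primrec.fst))
        (Primrec.snd.comp (Primrec.snd.comp (Primrec.snd.comp Primrec.fst))))) ?_)
    have e0 : Primrec fun p : ((α × (Letter d × (Letter d → ℤ) × Letter d)) ×
      ((Letter d → ℤ) × Letter d)) × ((Letter d → ℤ) × Letter d) => p.1.1.1 :=
      Primrec.fst.comp (Primrec.fst.comp Primrec.fst)
    have et : ∀ i, Primrec fun p : ((α × (Letter d × (Letter d → ℤ) × Letter d)) ×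
        ((Letter d → ℤ) × Letter d)) × ((Letter d → ℤ) × Letter d) =>
        ((_root_.morphMatrix (g p.1.1.1)).mulVec p.1.1.2.2.1 + p.2.1 - p.1.2.1) i := by
      intro i
      refine Primrec.int_sub (Primrec.int_add ?_ ?_) ?_
      · refine Primrec.mulVec (fun i j => (hM i j).comp e0) (fun i => ?_) i
        exact Primrec.pi_iff.1 (Primrec.fst.comp (Primrec.snd.comp (Primrec.snd.comp
          (Primrec.fst.comp Primrec.fst)))) i
      · exact Primrec.pi_iff.1 (Primrec.fst.comp Primrec.snd) i
      · exact Primrec.pi_iff.1 (Primrec.fst.comp (Primrec.snd.comp Primrec.fst)) i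
    have ec := Primrec.snd.comp (Primrec.snd.comp (Primrec.fst (α := (α × (Letter d × (Letter d → ℤ)
      × Letter d)) × ((Letter d → ℤ) × Letter d)) (β := (Letter d → ℤ) × Letter d)))
    have ec' := Primrec.snd.comp (Primrec.snd (α := (α × (Letter d × (Letter d → ℤ)
      × Letter d)) × ((Letter d → ℤ) × Letter d)) (β := (Letter d → ℤ) × Letter d))
    refine PrimrecPred.or (.mem (hQ.comp e0) (ec.pair ((Primrec.pi_iff.2 et).pair ec'))) ?_
    exact .disjointWitness (fun i j => (hM i j).comp e0) (hn.comp e0) ec et ec'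

end PrimrecMatrix

/-! ### The search that decides contraction and coincidence -/

section Decider

variable {d : ℕ}

/-- The candidates for a finite witness. -/
abbrev Witness (d : ℕ) : Type := ℕ × ℕ × ℕ × List (Letter d × (Letter d → ℤ) × Letter d)

/-- The criterion of `not_contracts_iff` with the unbounded `n` supplied by the candidate, so that
it can be checked. -/
def RefutesContraction (M : Matrix (Letter d) (Letter d) ℤ) (n : ℕ) : Prop :=
  (M - 1).det = 0 ∨ (2 ≤ d ∧ (steinMatrix M - 1).det = 0) ∨ TraceGap M n

def RefutesCoincidence (g : Letter d → List (Letter d)) (e : Witness d) : Prop :=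
  ContractionWitness (morphMatrix g) e.1 e.2.1 ∧ NonCoincidenceWitness g e.2.2.1 e.2.2.2

def ProvesCoincidence (g : Letter d → List (Letter d)) (e : Witness d) : Prop :=
  ContractionWitness (morphMatrix g) e.1 e.2.1 ∧ CoincidenceWitness g e.1 e.2.1 e.2.2.1

open Classical in
/-- The answer that a candidate justifies. -/
noncomputable def verdict (g : Letter d → List (Letter d)) (e : Witness d) : Option Bool :=
  if RefutesContraction (morphMatrix g) e.2.2.1 ∨ RefutesCoincidence g e then some false
  else if ProvesCoincidence g e then some true else none

theorem primrec₂_verdict : Primrec₂ (verdict (d := d)) := by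
  classical
  have hg : Primrec fun p : (Letter d → List (Letter d)) × Witness d => p.1 := Primrec.fst
  have hM := Primrec.morphMatrix hg
  have hN : Primrec fun p : (Letter d → List (Letter d)) × Witness d => p.2.1 :=
    Primrec.fst.comp Primrec.snd
  have hk : Primrec fun p : (Letter d → List (Letter d)) × Witness d => p.2.2.1 :=
    Primrec.fst.comp (Primrec.snd.comp Primrec.snd)
  have hn : Primrec fun p : (Letter d → List (Letter d)) × Witness d => p.2.2.2.1 :=
    Primrec.fst.comp (Primrec.snd.comp (Primrec.snd.comp Primrec.snd))
  have hQ : Primrec fun p : (Letter d → List (Letter d)) × Witness d => p.2.2.2.2 :=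
    Primrec.snd.comp (Primrec.snd.comp (Primrec.snd.comp Primrec.snd))
  have hc := PrimrecPred.contractionWitness hM hN hk
  have h1 : PrimrecPred fun p : (Letter d → List (Letter d)) × Witness d =>
      RefutesContraction (morphMatrix p.1) p.2.2.2.1 :=
    (PrimrecPred.det_sub_one hM).or (((PrimrecPred.const _).and
      (PrimrecPred.det_sub_one (Primrec.steinMatrix hM))).or (.traceGap hM hn))
  have h2 : PrimrecPred fun p : (Letter d → List (Letter d)) × Witness d =>
      RefutesCoincidence p.1 p.2 := hc.and (.nonCoincidenceWitness hg hn hQ)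
  have h3 : PrimrecPred fun p : (Letter d → List (Letter d)) × Witness d =>
      ProvesCoincidence p.1 p.2 := hc.and (.coincidenceWitness hg hN hk hn)
  exact Primrec.ite (h1.or h2) (Primrec.const _) (Primrec.ite h3 (Primrec.const _) (Primrec.const _))

/-- Unbounded search. -/
theorem exists_search {α β : Type*} [Primcodable α] [Primcodable β] {v : α → β → Option Bool}
    (hv : Primrec₂ v) : ∃ G : α →. Bool, Partrec G ∧ ∀ a, (∃ e b, v a e = some b) →
      ∃ e, ∃ b ∈ G a, v a e = some b := by
  let s : α → ℕ → Option Bool := fun a m => (Encodable.decode (α := β) m).bind (v a)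
  have hs : Primrec₂ s := Primrec.option_bind (Primrec.decode.comp Primrec.snd)
    (hv.comp (Primrec.fst.comp Primrec.fst) Primrec.snd)
  refine ⟨fun a => Nat.rfindOpt (s a), Partrec.rfindOpt hs.to_comp, fun a ⟨e, b, he⟩ => ?_⟩
  have hdom : (Nat.rfindOpt (s a)).Dom := by
    rw [Nat.rfindOpt_dom]
    exact ⟨Encodable.encode e, b, by simp [s, he]⟩
  obtain ⟨b', hb'⟩ := Part.dom_iff_mem.1 hdom
  obtain ⟨m, hm⟩ := Nat.rfindOpt_spec hb'
  obtain ⟨e', -, he'⟩ := Option.mem_bind_iff.1 hm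
  exact ⟨e', b', hb', he'⟩

/-- Each kind of certificate is valid whatever candidate provides it, so the search may stop at the
first answer. -/
theorem verdict_sound (hd : 1 ≤ d) {g : Letter d → List (Letter d)} {x : Letter d → ℝ} {lam : ℝ}
    (h : IsPerron (morphMatrix g) x lam) {e : Witness d} {b : Bool} (he : verdict g e = some b) :
    b = true ↔ Contracts (morphMatrix g) x ∧
      ∃ f, IsLeft (morphMatrix g) x lam f ∧ AllCoincide g f := by
  unfold verdict at he
  split_ifs at he with h1 h2
  · obtain rfl : false = b := Option.some.inj he
    simp only [Bool.false_eq_true, false_iff]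
    rintro ⟨hc, f, hf, hall⟩
    rcases h1 with h1 | h1
    · refine (h.not_contracts_iff hd).2 ?_ hc
      rcases h1 with h1 | h1 | h1
      exacts [Or.inl h1, Or.inr (Or.inl h1), Or.inr (Or.inr ⟨_, h1⟩)]
    · exact (IsPisot.mk h hc hf hd).not_allCoincide_of_witness h1.2 hall
  · obtain rfl : true = b := Option.some.inj he
    simp only [true_iff]
    have hc := h2.1.contracts h
    obtain ⟨f, hf⟩ := h.exists_left hc
    exact ⟨hc, f, hf, (IsPisot.mk h hc hf hd).allCoincide_of_witness h2.1 h2.2⟩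

/-- Termination: failure of contraction, failure of coincidence and the conjunction of both
properties each have a certificate. -/
theorem exists_verdict (hd : 1 ≤ d) {g : Letter d → List (Letter d)} {x : Letter d → ℝ} {lam : ℝ}
    (h : IsPerron (morphMatrix g) x lam) : ∃ e b, verdict g e = some b := by
  suffices hex : ∃ e, RefutesContraction (morphMatrix g) e.2.2.1 ∨ RefutesCoincidence g e ∨
      ProvesCoincidence g e by
    obtain ⟨e, he⟩ := hex
    refine ⟨e, ?_⟩
    unfold verdict
    split_ifs with h1 h2
    exacts [⟨_, rfl⟩, ⟨_, rfl⟩, by tauto]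
  by_cases hc : Contracts (morphMatrix g) x
  · obtain ⟨f, hf⟩ := h.exists_left hc
    obtain ⟨N, k, hNk⟩ := h.exists_contractionWitness hc
    have hp := IsPisot.mk h hc hf hd
    by_cases hall : AllCoincide g f
    · obtain ⟨n, hn⟩ := hp.exists_coincidenceWitness hall N k
      exact ⟨(N, k, n, []), Or.inr (Or.inr ⟨hNk, hn⟩)⟩
    · obtain ⟨n, Q, hQ⟩ := hp.exists_nonCoincidenceWitness hall
      exact ⟨(N, k, n, Q), Or.inr (Or.inl ⟨hNk, hQ⟩)⟩
  · rcases (h.not_contracts_iff hd).1 hc with h1 | h1 | ⟨n, h1⟩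
    · exact ⟨(0, 0, 0, []), Or.inl (Or.inl h1)⟩
    · exact ⟨(0, 0, 0, []), Or.inl (Or.inr (Or.inl h1))⟩
    · exact ⟨(0, 0, n, []), Or.inl (Or.inr (Or.inr h1))⟩

/-- Contraction and coincidence of all overlaps are decidable. -/
theorem exists_decider (hd : 1 ≤ d) : ∃ G : (Letter d → List (Letter d)) →. Bool, Partrec G ∧
    ∀ g x lam, IsPerron (morphMatrix g) x lam → ∃ b ∈ G g, (b = true ↔
      Contracts (morphMatrix g) x ∧ ∃ f, IsLeft (morphMatrix g) x lam f ∧ AllCoincide g f) := by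
  obtain ⟨G, hG, h⟩ := exists_search (primrec₂_verdict (d := d))
  refine ⟨G, hG, fun g x lam hp => ?_⟩
  obtain ⟨e, b, hb, he⟩ := h g (exists_verdict hd hp)
  exact ⟨b, hb, verdict_sound hd hp he⟩

end Decider

/-! ### Matrix and substitution products along a periodic orbit -/

namespace ExtendedCFA

variable {d : ℕ} (K : ExtendedCFA d)

theorem ab_det (x : K.X) : IsUnit (K.s₀ x).ab.det :=
  Int.isUnit_iff_abs_eq.2 (K.S_unimodular _ (K.s₀_mem x))

theorem ab_nonneg (σ : Subst d) (i j : Letter d) : 0 ≤ σ.ab i j := abWord_nonneg _ _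

theorem one_le_ab_col (σ : Subst d) (j : Letter d) : 1 ≤ ∑ i, σ.ab i j := by
  have h := List.length_pos_iff.2 (σ.nonerasing j)
  have h1 : ∑ i, σ.ab i j = (σ.image j).length := sum_abWord _
  omega

theorem ht_coe (x : K.X) : ht x.1 = 1 := by
  rw [ht_apply]; exact (K.X_subset x.2).2

theorem coe_nonneg (x : K.X) (i : Letter d) : 0 ≤ x.1 i := (K.X_subset x.2).1 i

theorem ab_mulVec_F (x : K.X) :
    ∃ c : ℝ, 0 < c ∧ (rl (K.s₀ x).ab).mulVec (K.F x).1 = c • x.1 := by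
  have hu : IsUnit (rl (K.s₀ x).ab).det := by
    rw [det_rl]; exact (K.ab_det x).map (Int.castRingHom ℝ)
  set y := invMulVec (K.s₀ x).ab x.1 with hy
  have h1 : (rl (K.s₀ x).ab).mulVec y = x.1 := by
    rw [hy, invMulVec, Matrix.mulVec_mulVec]
    change ((rl (K.s₀ x).ab) * (rl (K.s₀ x).ab)⁻¹).mulVec x.1 = x.1
    rw [Matrix.mul_nonsing_inv _ hu, Matrix.one_mulVec]
  -- The preimage is nonnegative and nonzero, so its normalization is not the degenerate case of
  -- inverting zero.
  have h2 : 0 < ∑ i, y i := by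
    refine lt_of_le_of_ne (Finset.sum_nonneg fun i _ => (K.maps_to x).1 i) fun h0 => ?_
    have h3 : y = 0 := funext fun i =>
      (Finset.sum_eq_zero_iff_of_nonneg fun i _ => (K.maps_to x).1 i).1 h0.symm i (Finset.mem_univ i)
    rw [h3, Matrix.mulVec_zero] at h1
    have := K.ht_coe x
    rw [← h1, map_zero] at this
    exact zero_ne_one this
  refine ⟨(∑ i, y i)⁻¹, inv_pos.2 h2, ?_⟩
  show (rl (K.s₀ x).ab).mulVec ((∑ i, y i)⁻¹ • y) = _
  rw [Matrix.mulVec_smul, h1]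

theorem iterate_succ (n : ℕ) (x : K.X) : K.F^[n + 1] x = K.F (K.F^[n] x) :=
  Function.iterate_succ_apply' K.F n x

theorem matProd_mulVec (x : K.X) (n : ℕ) :
    ∃ c : ℝ, 0 < c ∧ (rl (K.matProd x n)).mulVec (K.F^[n] x).1 = c • x.1 := by
  induction n with
  | zero => exact ⟨1, one_pos, by simp [matProd, rl_one]⟩
  | succ n ih =>
    obtain ⟨c, hc, h⟩ := ih
    obtain ⟨e, he, h'⟩ := K.ab_mulVec_F (K.F^[n] x)
    refine ⟨e * c, mul_pos he hc, ?_⟩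
    rw [iterate_succ, matProd, rl_mul, ← Matrix.mulVec_mulVec]
    change (rl (K.matProd x n)).mulVec ((rl (K.s₀ (K.F^[n] x)).ab).mulVec _) = _
    rw [h', Matrix.mulVec_smul, h, smul_smul]

theorem det_matProd (x : K.X) (n : ℕ) : IsUnit (K.matProd x n).det := by
  induction n with
  | zero => simp [matProd]
  | succ n ih => rw [matProd, Matrix.det_mul]; exact ih.mul (K.ab_det _)

theorem matProd_nonneg (x : K.X) (n : ℕ) (i j : Letter d) : 0 ≤ K.matProd x n i j := by
  induction n generalizing i j with
  | zero => simp only [matProd, Matrix.one_apply]; split_ifs <;> norm_num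
  | succ n ih =>
    rw [matProd, Matrix.mul_apply]
    exact Finset.sum_nonneg fun k _ => mul_nonneg (ih _ _) (ab_nonneg _ _ _)

theorem one_le_matProd_col (x : K.X) (n : ℕ) (j : Letter d) : 1 ≤ ∑ i, K.matProd x n i j := by
  induction n generalizing j with
  | zero => simp [matProd, Matrix.one_apply]
  | succ n ih =>
    simp_rw [matProd, Matrix.mul_apply]
    rw [Finset.sum_comm]
    simp_rw [← Finset.sum_mul]
    refine (one_le_ab_col (K.directive x n) j).trans (Finset.sum_le_sum fun k _ => ?_)
    exact le_mul_of_one_le_left (ab_nonneg _ _ _) (ih k)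

theorem directive_add (x : K.X) (m n : ℕ) : K.directive x (m + n) = K.directive (K.F^[m] x) n := by
  rw [directive, directive, add_comm, Function.iterate_add_apply]

theorem matProd_add (x : K.X) (m n : ℕ) :
    K.matProd x (m + n) = K.matProd x m * K.matProd (K.F^[m] x) n := by
  induction n with
  | zero => simp [matProd]
  | succ n ih => rw [← add_assoc, matProd, matProd, ih, directive_add, mul_assoc]

/-- The images of the letters under the first `n` substitutions of the directive sequence. -/
noncomputable def images (x : K.X) (n : ℕ) : List (Letter d → List (Letter d)) :=
  (List.range n).map fun k => (K.directive x k).image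

theorem images_succ (x : K.X) (n : ℕ) :
    K.images x (n + 1) = K.images x n ++ [(K.directive x n).image] := by
  simp [images, List.range_succ]

theorem morphMatrix_images (x : K.X) (n : ℕ) :
    morphMatrix (morphComp (K.images x n)) = K.matProd x n := by
  induction n with
  | zero =>
    ext i j
    simp [images, morphComp, morphMatrix, matProd, abWord_singleton, Matrix.one_apply,
      Pi.single_apply]
  | succ n ih =>
    have h : morphComp (K.images x (n + 1)) =
        fun b => ((K.directive x n).image b).flatMap (morphComp (K.images x n)) := by
      funext b; rw [images_succ, morphComp_append_singleton]
    rw [h, morphMatrix_comp, ih, matProd]; rfl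

theorem images_drop (x : K.X) (m n : ℕ) :
    (K.images x (m + n)).drop m = K.images (K.F^[m] x) n := by
  refine List.ext_getElem (by simp [images]) fun i h1 h2 => ?_
  simp [images, directive_add]

theorem isImage_images {x : K.X} {u : ℕ → ℕ → Letter d} (hu : IsFixedPoint (K.directive x) u)
    (m n : ℕ) : IsImage (morphComp (K.images (K.F^[m] x) n)) (u (m + n)) (u m) := by
  induction n with
  | zero =>
    have : morphComp (K.images (K.F^[m] x) 0) = fun b => [b] := by
      funext b; simp [images, morphComp]
    rw [this]; exact IsImage.refl _
  | succ n ih =>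
    have h : morphComp (K.images (K.F^[m] x) (n + 1)) =
        fun b => ((K.directive x (m + n)).image b).flatMap (morphComp (K.images (K.F^[m] x) n)) := by
      funext b; rw [images_succ, morphComp_append_singleton, directive_add]
    rw [h]
    refine IsImage.comp ?_ ih
    rw [← hu (m + n)]
    exact Subst.isImage_onInfinite _ _

section Periodic

variable {K} {x : K.X} {p : ℕ}

theorem isPerron (hx : K.F^[p] x = x) : ∃ lam, IsPerron (K.matProd x p) x.1 lam := by
  obtain ⟨c, -, h⟩ := K.matProd_mulVec x p
  rw [hx] at h
  exact ⟨c, K.matProd_nonneg x p, K.one_le_matProd_col x p, K.det_matProd x p, K.coe_nonneg x,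
    K.ht_coe x, h⟩

theorem iterate_mul (hx : K.F^[p] x = x) (k : ℕ) : K.F^[p * k] x = x := by
  rw [Function.iterate_mul]
  exact Function.iterate_fixed hx k

theorem matProd_mul (hx : K.F^[p] x = x) (k : ℕ) : K.matProd x (p * k) = K.matProd x p ^ k := by
  induction k with
  | zero => simp [matProd]
  | succ k ih => rw [Nat.mul_succ, matProd_add, ih, iterate_mul hx, pow_succ]

variable {lam : ℝ}

theorem linearIndependent_of_contracts (h : IsPerron (K.matProd x p) x.1 lam)
    (hc : Contracts (K.matProd x p) x.1) : LinearIndependent ℚ (fun i => x.1 i) := by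
  rw [← LinearIndependent.iff_fractionRing ℤ ℚ, Fintype.linearIndependent_iff]
  intro c h0 i
  exact congrFun (h.int_independent hc (c := c) (by simpa using h0)) i

/-- Only the words at multiples of the period are used; each is the image of the next by the same
composed morphism. -/
theorem exists_interior_iff (hd : 1 ≤ d) (hx : K.F^[p] x = x) (h : IsPerron (K.matProd x p) x.1 lam)
    (hc : Contracts (K.matProd x p) x.1) :
    (∃ (a : Letter d) (u : ℕ → ℕ → Letter d), IsFixedPoint (K.directive x) u ∧
      (@interior _ (halfSpaceTopology (K.toSimplex x)) (worm (u 0) a)).Nonempty) ↔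
    ∃ f, IsLeft (K.matProd x p) x.1 lam f ∧ AllCoincide (morphComp (K.images x p)) f := by
  obtain ⟨f, hf⟩ := h.exists_left hc
  have hM := K.morphMatrix_images x p
  have hp : ∀ f, IsLeft (K.matProd x p) x.1 lam f →
      IsPisot (morphComp (K.images x p)) x.1 lam f := fun f hf =>
    ⟨by rwa [hM], by rwa [hM], by rwa [hM], hd⟩
  have himg : ∀ {u : ℕ → ℕ → Letter d}, IsFixedPoint (K.directive x) u →
      ∀ n, IsImage (morphComp (K.images x p)) (u (p * (n + 1))) (u (p * n)) := by
    intro u hu n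
    have := K.isImage_images hu (p * n) p
    rwa [iterate_mul hx] at this
  constructor
  · rintro ⟨a, u, hu, hint⟩
    obtain ⟨z, ε, -, hε, hz⟩ := (interior_worm_nonempty_iff _ _ _).1 hint
    exact ⟨f, hf, (hp f hf).allCoincide_of_interior (U := fun n => u (p * n)) (himg hu) hε hz⟩
  · rintro ⟨f, hf, hall⟩
    obtain ⟨u, hu⟩ := exists_isFixedPoint (K.directive x)
    obtain ⟨a, z, ε, hz0, hε, hz⟩ :=
      (hp f hf).interior_of_allCoincide (U := fun n => u (p * n)) (himg hu) hall
    exact ⟨a, u, hu, (interior_worm_nonempty_iff _ _ _).2 ⟨z, ε, hz0, hε, hz⟩⟩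

end Periodic

/-! Continuity and branches. -/

theorem matProd_finite (n : ℕ) : (Set.range fun y : K.X => K.matProd y n).Finite := by
  induction n with
  | zero => exact (Set.finite_singleton 1).subset (by rintro _ ⟨y, rfl⟩; rfl)
  | succ n ih =>
    refine (ih.image2 (fun A B => A * B) (K.S_finite.image Subst.ab)).subset ?_
    rintro _ ⟨y, rfl⟩
    exact ⟨_, ⟨y, rfl⟩, _, ⟨_, K.s₀_mem _, rfl⟩, rfl⟩

theorem rl_matProd_eq (y : K.X) (n : ℕ) : (rl (K.matProd y n)).mulVec (K.F^[n] y).1 =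
    ht ((rl (K.matProd y n)).mulVec (K.F^[n] y).1) • y.1 := by
  obtain ⟨c, -, h⟩ := K.matProd_mulVec y n
  rw [h, map_smul, K.ht_coe]; simp

theorem ht_matProd_pos (y x : K.X) (n : ℕ) : 0 < ht ((rl (K.matProd y n)).mulVec x.1) := by
  have h1 : (1 : ℝ) ≤ ht ((rl (K.matProd y n)).mulVec x.1) := by
    rw [← K.ht_coe x, ht_apply, ht_apply]
    simp only [Matrix.mulVec, dotProduct]
    rw [Finset.sum_comm]
    refine Finset.sum_le_sum fun j _ => ?_
    rw [← Finset.sum_mul]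
    have : (1 : ℝ) ≤ ∑ i, rl (K.matProd y n) i j := by
      have := K.one_le_matProd_col y n j
      simp only [rl, Matrix.map_apply]
      exact_mod_cast this
    exact le_mul_of_one_le_left (K.coe_nonneg x j) this
  linarith

/-- Near `x` only finitely many projective maps `y ↦ M⁻¹ y` occur, namely the branches. Continuity
means that each of them sends `x` to the direction `F^n x`, that is, `M (F^n x)` is proportional to
`x`. -/
theorem continuousAt_iterate_iff (n : ℕ) (x : K.X) : ContinuousAt (K.F^[n]) x ↔
    ∀ M, K.IsBranch n x M → prj x.1 ((rl M).mulVec (K.F^[n] x).1) = 0 := by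
  constructor
  · intro hcont M hM
    have h1 : Tendsto (fun y : K.X => (rl M).mulVec (K.F^[n] y).1 -
        ht ((rl M).mulVec (K.F^[n] y).1) • y.1) (𝓝[{y : K.X | K.matProd y n = M}] x)
        (𝓝 ((rl M).mulVec (K.F^[n] x).1 - ht ((rl M).mulVec (K.F^[n] x).1) • x.1)) := by
      have h2 : Tendsto (fun y : K.X => (K.F^[n] y).1) (𝓝 x) (𝓝 (K.F^[n] x).1) :=
        (continuous_subtype_val.tendsto _).comp hcont
      have h3 : Tendsto (fun y : K.X => (rl M).mulVec (K.F^[n] y).1) (𝓝 x)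
          (𝓝 ((rl M).mulVec (K.F^[n] x).1)) := tendsto_linear (rl M).mulVecLin h2
      exact ((h3.sub ((tendsto_functional ht h3).smul
        (continuous_subtype_val.tendsto x))).mono_left nhdsWithin_le_nhds)
    have h2 : (𝓝[{y : K.X | K.matProd y n = M}] x).NeBot := mem_closure_iff_nhdsWithin_neBot.1 hM
    -- Proportionality holds exactly at the points using this branch, and it passes to the limit `x`
    -- of such points.
    have h3 : ∀ᶠ y in 𝓝[{y : K.X | K.matProd y n = M}] x, (rl M).mulVec (K.F^[n] y).1 -
        ht ((rl M).mulVec (K.F^[n] y).1) • y.1 = 0 := by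
      filter_upwards [self_mem_nhdsWithin] with y hy
      rw [← hy, sub_eq_zero]
      exact K.rl_matProd_eq y n
    rw [prj_apply]
    exact tendsto_nhds_unique (h1.congr' h3) tendsto_const_nhds
  · intro hbr
    have hval : ∀ M, ∀ᶠ y in 𝓝 x, K.matProd y n = M →
        K.IsBranch n x M := by
      intro M
      by_cases hM : K.IsBranch n x M
      · exact Eventually.of_forall fun _ _ => hM
      · have : (closure {y : K.X | K.matProd y n = M})ᶜ ∈ 𝓝 x :=
          isClosed_closure.isOpen_compl.mem_nhds hM
        filter_upwards [this] with y hy h1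
        exact absurd (show y ∈ closure _ from subset_closure h1) hy
    rw [ContinuousAt, tendsto_subtype_rng]
    have hloc : ∀ M, K.IsBranch n x M → Tendsto (fun y : K.X => normalizeDir (invMulVec M y.1))
        (𝓝 x) (𝓝 (K.F^[n] x).1) := by
      intro M hM
      obtain ⟨y, -, hy⟩ := mem_closure_iff_nhds.1 hM Set.univ univ_mem
      have hy' : K.matProd y n = M := hy
      have hpos := K.ht_matProd_pos y (K.F^[n] x) n
      have hdet := K.det_matProd y n
      rw [hy'] at hpos hdet
      have hu : IsUnit (rl M).det := by rw [det_rl]; exact hdet.map (Int.castRingHom ℝ)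
      have h1 := hbr M hM
      rw [prj_apply, sub_eq_zero] at h1
      set c := ht ((rl M).mulVec (K.F^[n] x).1) with hc
      have h2 : invMulVec M x.1 = c⁻¹ • (K.F^[n] x).1 := by
        have h3 : x.1 = c⁻¹ • (rl M).mulVec (K.F^[n] x).1 := by
          rw [h1, smul_smul, inv_mul_cancel₀ hpos.ne', one_smul]
        change ((rl M)⁻¹).mulVec x.1 = _
        conv_lhs => rw [h3]
        rw [Matrix.mulVec_smul, Matrix.mulVec_mulVec, Matrix.nonsing_inv_mul _ hu,
          Matrix.one_mulVec]
      have h4 : Tendsto (fun y : K.X => invMulVec M y.1) (𝓝 x) (𝓝 (c⁻¹ • (K.F^[n] x).1)) := by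
        rw [← h2]
        exact tendsto_linear ((rl M)⁻¹).mulVecLin (continuous_subtype_val.tendsto x)
      have h5 := tendsto_functional ht h4
      rw [map_smul, K.ht_coe, smul_eq_mul, mul_one] at h5
      have h6 := (h5.inv₀ (inv_ne_zero hpos.ne')).smul h4
      rw [smul_smul, inv_inv, mul_inv_cancel₀ hpos.ne', one_smul] at h6
      refine h6.congr fun y => ?_
      rw [normalizeDir, ht_apply]
    have hfin : ∀ᶠ y in 𝓝 x, K.IsBranch n x (K.matProd y n) := by
      have : ∀ᶠ y in 𝓝 x, ∀ M ∈ Set.range fun y : K.X => K.matProd y n,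
          K.matProd y n = M → K.IsBranch n x M :=
        (eventually_all_finite (K.matProd_finite n)).2 fun M _ => hval M
      filter_upwards [this] with y hy
      exact hy _ ⟨y, rfl⟩ rfl
    have hform : ∀ y : K.X, (K.F^[n] y).1 = normalizeDir (invMulVec (K.matProd y n) y.1) := by
      intro y
      obtain ⟨c, hc, h⟩ := K.matProd_mulVec y n
      have hu : IsUnit (rl (K.matProd y n)).det := by
        rw [det_rl]; exact (K.det_matProd y n).map (Int.castRingHom ℝ)
      have h1 : invMulVec (K.matProd y n) y.1 = c⁻¹ • (K.F^[n] y).1 := by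
        have h3 : y.1 = c⁻¹ • (rl (K.matProd y n)).mulVec (K.F^[n] y).1 := by
          rw [h, smul_smul, inv_mul_cancel₀ hc.ne', one_smul]
        change ((rl (K.matProd y n))⁻¹).mulVec y.1 = _
        conv_lhs => rw [h3]
        rw [Matrix.mulVec_smul, Matrix.mulVec_mulVec, Matrix.nonsing_inv_mul _ hu,
          Matrix.one_mulVec]
      rw [normalizeDir, ← ht_apply, h1, map_smul, K.ht_coe, smul_smul, smul_eq_mul, mul_one,
        inv_inv, mul_inv_cancel₀ hc.ne', one_smul]
    rw [tendsto_def]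
    intro U hU
    have hall : ∀ᶠ y in 𝓝 x, ∀ M ∈ Set.range fun y : K.X => K.matProd y n, K.IsBranch n x M →
        normalizeDir (invMulVec M y.1) ∈ U := by
      refine (eventually_all_finite (K.matProd_finite n)).2 fun M _ => ?_
      by_cases hM : K.IsBranch n x M
      · exact ((hloc M hM).eventually hU).mono fun y hy _ => hy
      · exact Eventually.of_forall fun y h => absurd h hM
    filter_upwards [hfin, hall] with y h1 h2
    have := h2 _ ⟨y, rfl⟩ h1
    rw [← hform] at this
    exact this

/-! ### Continuity at a periodic point as commutation of matrices -/

section Periodic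

variable {K} {x : K.X} {p : ℕ} {lam : ℝ}

/-- If `x` is an eigenvector of `A`, the commutator with `M` kills `x`, and its rows are integer
relations, hence zero. Conversely commutation makes `A x` an eigenvector for `lam`, and contraction
leaves no such direction except that of `x`. -/
theorem prj_eq_zero_iff_commute (h : IsPerron (K.matProd x p) x.1 lam)
    (hc : Contracts (K.matProd x p) x.1) (A : Matrix (Letter d) (Letter d) ℤ) :
    prj x.1 ((rl A).mulVec x.1) = 0 ↔ A * K.matProd x p = K.matProd x p * A := by
  constructor
  · intro h0
    rw [prj_apply, sub_eq_zero] at h0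
    generalize ht ((rl A).mulVec x.1) = c at h0
    have h1 : (rl (A * K.matProd x p - K.matProd x p * A)).mulVec x.1 = 0 := by
      have h2 : rl (A * K.matProd x p - K.matProd x p * A) =
          rl A * rl (K.matProd x p) - rl (K.matProd x p) * rl A := by
        rw [← rl_mul, ← rl_mul]; ext i j; simp [rl]
      rw [h2, Matrix.sub_mulVec, ← Matrix.mulVec_mulVec, ← Matrix.mulVec_mulVec, h.eig, h0,
        Matrix.mulVec_smul, Matrix.mulVec_smul, h.eig, h0, smul_comm, sub_self]
    rw [← sub_eq_zero]
    ext i j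
    have h2 := congrFun h1 i
    simp only [Matrix.mulVec, dotProduct, rl, Matrix.map_apply] at h2
    exact congrFun (h.int_independent hc (c := (A * K.matProd x p - K.matProd x p * A) i) h2) j
  · intro h0
    have h1 : ∀ n : ℕ, (rl (K.matProd x p) ^ n).mulVec ((rl A).mulVec x.1) =
        lam ^ n • (rl A).mulVec x.1 := by
      intro n
      have h2 : rl (K.matProd x p) ^ n * rl A = rl A * rl (K.matProd x p) ^ n := by
        have : Commute (rl A) (rl (K.matProd x p)) := by
          unfold Commute SemiconjBy; rw [← rl_mul, h0, rl_mul]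
        exact (this.pow_right n).eq.symm
      rw [Matrix.mulVec_mulVec, h2, ← Matrix.mulVec_mulVec, h.eig_pow, Matrix.mulVec_smul]
    have h2 := (hc ((rl A).mulVec x.1)).norm
    rw [norm_zero] at h2
    refine norm_le_zero_iff.1 (ge_of_tendsto' h2 fun n => ?_)
    have h3 : 1 ≤ lam ^ n := one_le_pow₀ h.one_le
    rw [h1, map_smul, norm_smul, Real.norm_of_nonneg (by linarith)]
    exact le_mul_of_one_le_left (norm_nonneg _) h3

/-- Periodicity expresses `F^n x`, up to scale, as the product of the remaining matrices of the
period applied to `x`; the branch condition at `F^n x` becomes an eigenvector condition at `x`. -/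
theorem continuousAt_iff_commute (hx : K.F^[p] x = x) (h : IsPerron (K.matProd x p) x.1 lam)
    (hc : Contracts (K.matProd x p) x.1) {n : ℕ} (hn : n ≤ p) : ContinuousAt (K.F^[n]) x ↔
      ∀ B, K.IsBranch n x B → B * morphMatrix (morphComp ((K.images x p).drop n)) *
        morphMatrix (morphComp (K.images x p)) = morphMatrix (morphComp (K.images x p)) *
          (B * morphMatrix (morphComp ((K.images x p).drop n))) := by
  obtain ⟨m, rfl⟩ := Nat.exists_eq_add_of_le hn
  rw [continuousAt_iterate_iff]
  refine forall_congr' fun B => imp_congr_right fun _ => ?_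
  rw [images_drop, morphMatrix_images, morphMatrix_images, ← prj_eq_zero_iff_commute h hc, rl_mul,
    ← Matrix.mulVec_mulVec]
  obtain ⟨c, hc0, h1⟩ := K.matProd_mulVec (K.F^[n] x) m
  rw [← Function.iterate_add_apply, add_comm m n, hx] at h1
  rw [h1, Matrix.mulVec_smul, map_smul, smul_eq_zero, or_iff_right hc0.ne']

/-- Write `n = n % p + p * (n / p)`: continuity of `F^p` at its fixed point `x` iterates, and the
remainder is at most one period. -/
theorem continuousAt_all_iff (hp : 1 ≤ p) (hx : K.F^[p] x = x) :
    (∀ n : ℕ, ContinuousAt (K.F^[n]) x) ↔ ∀ n < p, ContinuousAt (K.F^[n + 1]) x := by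
  refine ⟨fun h n _ => h _, fun h n => ?_⟩
  have hle : ∀ r ≤ p, ContinuousAt (K.F^[r]) x := by
    rintro (_ | r) hr
    · exact continuousAt_id
    · exact h r (by omega)
  rw [← Nat.mod_add_div n p, Function.iterate_add]
  refine ContinuousAt.comp (f := K.F^[p * (n / p)]) ?_ ?_
  · rw [iterate_mul hx]
    exact hle _ (Nat.mod_lt _ hp).le
  · rw [Function.iterate_mul]
    exact (hle p le_rfl).iterate hx _

end Periodic

end ExtendedCFA

/-! ### The operator norm for the 1-norm -/

section OpNorm

variable {d : ℕ}

theorem norm1_le (v : Letter d → ℝ) : norm1 v ≤ (d + 1) * ‖v‖ := by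
  calc norm1 v ≤ ∑ _i : Letter d, ‖v‖ := Finset.sum_le_sum fun i _ => norm_le_pi_norm v i
    _ = _ := by simp

theorem norm1_nonneg (v : Letter d → ℝ) : 0 ≤ norm1 v := Finset.sum_nonneg fun _ _ => abs_nonneg _

theorem norm_le_norm1 (v : Letter d → ℝ) : ‖v‖ ≤ norm1 v :=
  (pi_norm_le_iff_of_nonneg (norm1_nonneg v)).2 fun i =>
    Finset.single_le_sum (f := fun i => |v i|) (fun _ _ => abs_nonneg _) (Finset.mem_univ i)

variable (x : stdSimplex ℝ (Letter d)) (M : Matrix (Letter d) (Letter d) ℤ)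

theorem proj_eq_prj (v : Letter d → ℝ) :
    (proj x ((M.map (Int.cast : ℤ → ℝ)).mulVec v)).1 = prj x.1 ((rl M).mulVec v) := by
  ext i; simp [proj, prj_apply, ht_apply, rl]

theorem projOpNorm_bddAbove : BddAbove (Set.range fun v : {v : Letter d → ℝ // v ≠ 0} =>
    norm1 (proj x ((M.map (Int.cast : ℤ → ℝ)).mulVec v.1)).1 / norm1 v.1) := by
  obtain ⟨C, hC0, hC⟩ := linear_bound' (prj x.1 ∘ₗ (rl M).mulVecLin)
  refine ⟨(d + 1) * C, ?_⟩
  rintro _ ⟨v, rfl⟩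
  dsimp only
  rw [proj_eq_prj]
  refine div_le_of_le_mul₀ (norm1_nonneg _) (by positivity) ((norm1_le _).trans ?_)
  rw [mul_assoc]
  refine mul_le_mul_of_nonneg_left ((hC v.1).trans ?_) (by positivity)
  exact mul_le_mul_of_nonneg_left (norm_le_norm1 _) hC0

theorem norm1_prj_le (v : Letter d → ℝ) :
    norm1 (prj x.1 ((rl M).mulVec v)) ≤ projOpNorm x M * norm1 v := by
  by_cases hv : v = 0
  · simp [hv, norm1]
  · have h1 := le_ciSup (projOpNorm_bddAbove x M) ⟨v, hv⟩
    have h2 : 0 < norm1 v := (norm_pos_iff.2 hv).trans_le (norm_le_norm1 v)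
    rw [← proj_eq_prj]
    exact (div_le_iff₀ h2).1 h1

theorem projOpNorm_le {C : ℝ} (hC0 : 0 ≤ C)
    (hC : ∀ v, ‖prj x.1 ((rl M).mulVec v)‖ ≤ C * ‖v‖) : projOpNorm x M ≤ (d + 1) * C := by
  have : Nonempty {v : Letter d → ℝ // v ≠ 0} := ⟨⟨Pi.single 0 1, by simp⟩⟩
  refine ciSup_le fun v => ?_
  rw [proj_eq_prj]
  refine div_le_of_le_mul₀ (norm1_nonneg _) (by positivity) ((norm1_le _).trans ?_)
  rw [mul_assoc]
  refine mul_le_mul_of_nonneg_left ((hC v.1).trans ?_) (by positivity)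
  exact mul_le_mul_of_nonneg_left (norm_le_norm1 _) hC0

/-- Since `Real.log 0 = 0`, the exponential rate is meaningful only for positive norms.
Invertibility of `M` reduces the claim to the projection being nonzero, which uses two distinct
letters. -/
theorem projOpNorm_pos (hd : 1 ≤ d) (hM : IsUnit M.det) : 0 < projOpNorm x M := by
  have hu : IsUnit (rl M).det := by rw [det_rl]; exact hM.map (Int.castRingHom ℝ)
  by_contra hneg
  have h0 : ∀ w, prj x.1 w = 0 := by
    intro w
    have h1 := norm1_prj_le x M ((rl M)⁻¹.mulVec w)
    rw [Matrix.mulVec_mulVec, Matrix.mul_nonsing_inv _ hu, Matrix.one_mulVec] at h1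
    exact norm_le_zero_iff.1 ((norm_le_norm1 _).trans (h1.trans
      (mul_nonpos_of_nonpos_of_nonneg (not_lt.1 hneg) (norm1_nonneg _))))
  let i : Letter d := ⟨1, by omega⟩
  have hi : i ≠ 0 := by simp [i, Fin.ext_iff]
  have h1 := congrFun (h0 (Pi.single 0 1)) i
  have h2 := congrFun (h0 (Pi.single i 1)) i
  simp [prj_apply, ht_apply, hi] at h1 h2
  simp [h1] at h2

end OpNorm

/-! ### The exponential rate and contraction -/

namespace ExtendedCFA

variable {d : ℕ} {K : ExtendedCFA d} {x : K.X} {p : ℕ} {lam : ℝ}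

/-- A negative rate bounds the norms by a decaying exponential; along multiples of the period these
are norms of `π_x M ^ k`. -/
theorem contracts_of_limsup (hd : 1 ≤ d) (hp : 1 ≤ p) (hx : K.F^[p] x = x)
    (hl : limsup (fun n : ℕ =>
      (((1 / (n : ℝ)) * Real.log (projOpNorm (K.toSimplex x) (K.matProd x n)) : ℝ) : EReal))
      atTop < 0) : Contracts (K.matProd x p) x.1 := by
  obtain ⟨r, hr1, hr2⟩ := EReal.lt_iff_exists_real_btwn.1 hl
  have hr : r < 0 := by exact_mod_cast hr2
  have h1 := eventually_lt_of_limsup_lt hr1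
  have h2 : ∀ᶠ n : ℕ in atTop, projOpNorm (K.toSimplex x) (K.matProd x n) ≤ Real.exp (n * r) := by
    filter_upwards [h1, eventually_ge_atTop 1] with n hn hn1
    have hn' : (1 / (n : ℝ)) * Real.log (projOpNorm (K.toSimplex x) (K.matProd x n)) < r := by
      exact_mod_cast hn
    have hn0 : (0 : ℝ) < n := by positivity
    rw [one_div, inv_mul_lt_iff₀ hn0] at hn'
    exact ((Real.log_lt_iff_lt_exp (projOpNorm_pos _ _ hd (K.det_matProd x n))).1 hn').le
  have htend : Tendsto (fun k : ℕ => p * k) atTop atTop :=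
    tendsto_id.const_mul_atTop' (by omega)
  intro v
  refine squeeze_zero_norm' (a := fun k : ℕ => Real.exp (p * r) ^ k * norm1 v) ?_ ?_
  · filter_upwards [htend.eventually h2] with k hk
    rw [← rl_pow, ← matProd_mul hx]
    refine (norm_le_norm1 _).trans ((norm1_prj_le (K.toSimplex x) _ v).trans
      (mul_le_mul_of_nonneg_right (hk.trans_eq ?_) (norm1_nonneg v)))
    rw [← Real.exp_nat_mul]; push_cast; ring_nf
  · have : Real.exp (p * r) < 1 := (Real.exp_lt_exp.2
      (mul_neg_of_pos_of_neg (by positivity) hr)).trans_eq Real.exp_zero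
    simpa using (tendsto_pow_atTop_nhds_zero_of_lt_one (Real.exp_pos _).le this).mul_const (norm1 v)

theorem limsup_of_contracts (hd : 1 ≤ d) (hp : 1 ≤ p) (hx : K.F^[p] x = x)
    (h : IsPerron (K.matProd x p) x.1 lam) (hc : Contracts (K.matProd x p) x.1) :
    limsup (fun n : ℕ =>
      (((1 / (n : ℝ)) * Real.log (projOpNorm (K.toSimplex x) (K.matProd x n)) : ℝ) : EReal))
      atTop < 0 := by
  obtain ⟨C, ρ, hC, hρ0, hρ1, hb⟩ := h.exponential_of_contracts hc
  have hp0 : (0 : ℝ) < p := by positivity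
  choose B hB0 hB using fun r => linear_bound' (rl (K.matProd x r)).mulVecLin
  set D := ∑ r ∈ Finset.range p, B r + 1 with hD
  have hBD : ∀ r < p, B r ≤ D := fun r hr => by
    have := Finset.single_le_sum (f := B) (fun r _ => hB0 r) (Finset.mem_range.2 hr)
    linarith
  have hD0 : 0 < D := by
    have := Finset.sum_nonneg fun r (_ : r ∈ Finset.range p) => hB0 r
    linarith
  set E := (d + 1) * (C * D) with hE
  have hE0 : 0 < E := by positivity
  have hop : ∀ n : ℕ, projOpNorm (K.toSimplex x) (K.matProd x n) ≤ E * ρ ^ (n / p) := by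
    intro n
    refine (projOpNorm_le _ _ (C := C * D * ρ ^ (n / p)) (by positivity) fun v => ?_).trans_eq
      (by rw [hE]; ring)
    conv_lhs => rw [← Nat.div_add_mod n p, matProd_add, matProd_mul hx, iterate_mul hx, rl_mul,
      ← Matrix.mulVec_mulVec, rl_pow]
    refine (hb _ _).trans ?_
    have h1 : ‖(rl (K.matProd x (n % p))).mulVec v‖ ≤ D * ‖v‖ := (hB _ v).trans
      (mul_le_mul_of_nonneg_right (hBD _ (Nat.mod_lt _ hp)) (norm_nonneg _))
    calc C * ρ ^ (n / p) * ‖(rl (K.matProd x (n % p))).mulVec v‖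
        ≤ C * ρ ^ (n / p) * (D * ‖v‖) := mul_le_mul_of_nonneg_left h1 (by positivity)
      _ = _ := by ring
  have hlog : Real.log ρ < 0 := Real.log_neg hρ0 hρ1
  -- Half of the rate `log ρ / p`: the other half absorbs the constant `E` and the rounding of `n /
  -- p`.
  have hs : Real.log ρ / (2 * p) < 0 := div_neg_of_neg_of_pos hlog (by positivity)
  have hlim : Tendsto (fun n : ℕ => (Real.log E - Real.log ρ) / (n : ℝ)) atTop (𝓝 0) :=
    tendsto_const_div_atTop_nhds_zero_nat _
  have hev : ∀ᶠ n : ℕ in atTop,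
      (1 / (n : ℝ)) * Real.log (projOpNorm (K.toSimplex x) (K.matProd x n)) ≤
        Real.log ρ / (2 * p) := by
    filter_upwards [hlim.eventually_lt_const (neg_pos.2 hs), eventually_ge_atTop 1] with n hn hn1
    have hn0 : (0 : ℝ) < n := by positivity
    have h1 := Real.log_le_log (projOpNorm_pos (K.toSimplex x) _ hd (K.det_matProd x n)) (hop n)
    rw [Real.log_mul hE0.ne' (by positivity), Real.log_pow] at h1
    have h2 : (n : ℝ) / p - 1 ≤ ((n / p : ℕ) : ℝ) := by
      rw [sub_le_iff_le_add, div_le_iff₀ hp0]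
      have h3 := Nat.div_add_mod n p
      have h4 := Nat.mod_lt n hp
      have h5 : n ≤ (n / p + 1) * p := by nlinarith
      exact_mod_cast h5
    have h3 := mul_le_mul_of_nonpos_right h2 hlog.le
    rw [div_lt_iff₀ hn0] at hn
    rw [one_div, inv_mul_le_iff₀ hn0]
    have h4 : (n : ℝ) / p * Real.log ρ = 2 * (n * (Real.log ρ / (2 * p))) := by
      field_simp
    nlinarith
  refine lt_of_le_of_lt (limsup_le_of_le (a := ((Real.log ρ / (2 * p) : ℝ) : EReal)) (h := ?_)) ?_
  · filter_upwards [hev] with n hn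
    exact_mod_cast hn
  · exact_mod_cast hs

end ExtendedCFA

/-! ### Codes of algebraic numbers -/

section Codes

open Polynomial

theorem natDegree_ne_zero_of_aeval {P : ℤ[X]} (hP : P ≠ 0) {t : ℝ} (ht : aeval t P = 0) :
    P.natDegree ≠ 0 := by
  intro h0
  rw [eq_C_of_natDegree_eq_zero h0] at ht hP
  simp at ht
  simp [ht] at hP

/-- Gauss's lemma: over `ℚ` the polynomial `P` is the minimal polynomial of `t` up to a scalar, and
primitivity brings divisibility back to `ℤ`. -/
theorem dvd_of_common_root {P Q : ℤ[X]} (hP : Irreducible P) {t : ℝ}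
    (hPt : aeval t P = 0) (hQt : aeval t Q = 0) : P ∣ Q := by
  have hP1 := hP.isPrimitive (natDegree_ne_zero_of_aeval hP.ne_zero hPt)
  have hroot : ∀ R : ℤ[X], aeval t R = 0 → aeval t (R.map (Int.castRingHom ℚ)) = 0 := by
    intro R hR
    rw [← algebraMap_int_eq, aeval_map_algebraMap]; exact hR
  rw [IsPrimitive.Int.dvd_iff_map_cast_dvd_map_cast _ _ hP1]
  have h1 := minpoly.eq_of_irreducible (IsPrimitive.Int.irreducible_iff_irreducible_map_cast hP1 |>.1 hP)
    (hroot P hPt)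
  have h2 : minpoly ℚ t ∣ Q.map (Int.castRingHom ℚ) := minpoly.dvd ℚ t (hroot Q hQt)
  rw [← h1] at h2
  exact (Dvd.intro _ rfl).trans h2

theorem eq_of_common_root {P Q : ℤ[X]} (hP : Irreducible P) (hQ : Irreducible Q)
    (hP0 : 0 < P.leadingCoeff) (hQ0 : 0 < Q.leadingCoeff) {t : ℝ}
    (hPt : aeval t P = 0) (hQt : aeval t Q = 0) : P = Q := by
  obtain ⟨u, hu⟩ := associated_of_dvd_dvd (dvd_of_common_root hP hPt hQt)
    (dvd_of_common_root hQ hQt hPt)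
  obtain ⟨r, hr, hru⟩ := Polynomial.isUnit_iff.1 u.isUnit
  rw [← hru] at hu
  rcases Int.isUnit_iff.1 hr with rfl | rfl
  · simpa using hu
  · exfalso
    rw [← hu] at hQ0
    simp at hQ0
    omega

theorem IsAlgCode.unique {c c' : List ℤ × ℕ} {t : ℝ} (h : IsAlgCode c t) (h' : IsAlgCode c' t) :
    c = c' := by
  obtain ⟨P, h1, h2, h3, h4, h5⟩ := h
  obtain ⟨Q, h1', h2', h3', h4', h5'⟩ := h'
  obtain rfl := eq_of_common_root h1 h1' h2 h2' h3 h3'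
  exact Prod.ext (h4.trans h4'.symm) (h5.trans h5'.symm)

theorem eq_of_coeff_list {P Q : ℤ[X]} (h : (List.range (P.natDegree + 1)).map P.coeff =
    (List.range (Q.natDegree + 1)).map Q.coeff) : P = Q := by
  have hl := congrArg List.length h
  simp only [List.length_map, List.length_range, add_left_inj] at hl
  ext n
  by_cases hn : n ≤ P.natDegree
  · have h1 := congrArg (fun l => l[n]?) h
    simpa [List.getElem?_range (show n < P.natDegree + 1 by omega),
      List.getElem?_range (show n < Q.natDegree + 1 by omega)] using h1
  · rw [coeff_eq_zero_of_natDegree_lt (by omega), coeff_eq_zero_of_natDegree_lt (by omega)]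

theorem IsAlgCode.injective {c : List ℤ × ℕ} {t t' : ℝ} (h : IsAlgCode c t) (h' : IsAlgCode c t') :
    t = t' := by
  obtain ⟨P, h1, h2, h3, h4, h5⟩ := h
  obtain ⟨Q, h1', h2', h3', h4', h5'⟩ := h'
  obtain rfl := eq_of_coeff_list (h4.symm.trans h4')
  -- The smaller of two roots is itself counted below the larger one, so their ranks differ.
  have key : ∀ s s' : ℝ, s < s' → aeval s P = 0 →
      Set.ncard {r : ℝ | r < s ∧ aeval r P = 0} ≠ Set.ncard {r : ℝ | r < s' ∧ aeval r P = 0} := by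
    intro s s' hs hP
    have hfin : {r : ℝ | r < s' ∧ aeval r P = 0}.Finite := by
      refine (P.rootSet_finite ℝ).subset fun r hr => ?_
      rw [mem_rootSet]
      exact ⟨h1.ne_zero, hr.2⟩
    refine (Set.ncard_lt_ncard ?_ hfin).ne
    refine Set.ssubset_iff_subset_ne.2 ⟨fun r hr => ⟨hr.1.trans hs, hr.2⟩, fun h0 => ?_⟩
    have : s ∈ {r : ℝ | r < s ∧ aeval r P = 0} := by rw [h0]; exact ⟨hs, hP⟩
    exact lt_irrefl _ this.1
  rcases lt_trichotomy t t' with hlt | rfl | hlt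
  · exact absurd (h5.symm.trans h5') (key _ _ hlt h3)
  · rfl
  · exact absurd (h5'.symm.trans h5) (key _ _ hlt h3')

theorem exists_isAlgCode {t : ℝ} (ht : IsAlgebraic ℤ t) : ∃ c, IsAlgCode c t := by
  obtain ⟨R, hR0, hR⟩ := ht
  obtain ⟨f, hf, hfR⟩ := WfDvdMonoid.exists_factors R hR0
  have h1 : aeval t f.prod = 0 := by
    obtain ⟨u, hu⟩ := hfR.symm
    rw [← hu, map_mul, hR, zero_mul]
  rw [map_multiset_prod, Multiset.prod_eq_zero_iff, Multiset.mem_map] at h1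
  obtain ⟨P, hPf, hPt⟩ := h1
  have hP := hf P hPf
  rcases lt_or_gt_of_ne (leadingCoeff_ne_zero.2 hP.ne_zero) with hneg | hpos
  · exact ⟨(_, _), -P, (Associated.irreducible_iff ⟨-1, by simp⟩).1 hP, by rw [leadingCoeff_neg]; omega, by rw [map_neg, hPt, neg_zero],
      rfl, rfl⟩
  · exact ⟨(_, _), P, hP, hpos, hPt, rfl, rfl⟩

end Codes

/-! ### Contracting eigenvectors are algebraic -/

section Algebraic

variable {d : ℕ} {M : Matrix (Letter d) (Letter d) ℤ} {x : Letter d → ℝ} {lam : ℝ}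

theorem IsPerron.isAlgebraic (h : IsPerron M x lam) (hc : Contracts M x) (i : Letter d) :
    IsAlgebraic ℤ (x i) := by
  have hdet : (lam • (1 : Matrix (Letter d) (Letter d) ℝ) - rl M).det = 0 :=
    Matrix.exists_mulVec_eq_zero_iff.1 ⟨x, fun h0 => by
      have := h.ht_x
      simp [h0] at this, by
      rw [Matrix.sub_mulVec, Matrix.smul_mulVec, Matrix.one_mulVec, h.eig, sub_self]⟩
  have hlam : IsAlgebraic ℚ lam := by
    rw [← IsFractionRing.isAlgebraic_iff ℤ ℚ ℝ]
    refine ⟨M.charpoly, M.charpoly_monic.ne_zero, ?_⟩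
    have h1 : Polynomial.aeval lam M.charpoly = (M.map (algebraMap ℤ ℝ)).charpoly.eval lam := by
      rw [Matrix.charpoly_map, Polynomial.eval_map_algebraMap]
    rw [h1, Matrix.eval_charpoly, ← hdet]
    congr 1
    rw [Matrix.smul_one_eq_diagonal]; rfl
  let A := algebraicClosure ℚ ℝ
  let l : A := ⟨lam, mem_algebraicClosure_iff.2 hlam⟩
  have hdetA : (l • (1 : Matrix (Letter d) (Letter d) A) - M.map (Int.cast : ℤ → A)).det = 0 := by
    have h1 := (algebraMap A ℝ).map_det
      (l • (1 : Matrix (Letter d) (Letter d) A) - M.map (Int.cast : ℤ → A))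
    have h2 : (algebraMap A ℝ).mapMatrix
        (l • (1 : Matrix (Letter d) (Letter d) A) - M.map (Int.cast : ℤ → A)) =
        lam • (1 : Matrix (Letter d) (Letter d) ℝ) - rl M := by
      ext i j
      by_cases hij : i = j <;> simp [hij, rl, l]
    rw [h2, hdet] at h1
    exact (map_eq_zero_iff _ (algebraMap A ℝ).injective).1 h1
  -- Solving over the field of real algebraic numbers gives an algebraic eigenvector; contraction
  -- makes it proportional to `x`, and normalizing recovers `x`.
  obtain ⟨v, hv0, hv⟩ := Matrix.exists_mulVec_eq_zero_iff.2 hdetA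
  set w : Letter d → ℝ := fun j => (v j : ℝ) with hw
  have hwM : (rl M).mulVec w = lam • w := by
    rw [Matrix.sub_mulVec, Matrix.smul_mulVec, Matrix.one_mulVec, sub_eq_zero] at hv
    ext j
    have := congrArg (algebraMap A ℝ) (congrFun hv j)
    simp only [Matrix.mulVec, dotProduct, map_sum, map_mul, Matrix.map_apply, map_intCast,
      Pi.smul_apply, smul_eq_mul] at this
    exact this.symm
  have hwn : ∀ n : ℕ, (rl M ^ n).mulVec w = lam ^ n • w := by
    intro n
    induction n with
    | zero => simp
    | succ n ih =>
      rw [pow_succ, ← Matrix.mulVec_mulVec, hwM, Matrix.mulVec_smul, ih, smul_smul, pow_succ']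
  have hprj : prj x w = 0 := by
    have h2 := (hc w).norm
    rw [norm_zero] at h2
    refine norm_le_zero_iff.1 (ge_of_tendsto' h2 fun n => ?_)
    have h3 : 1 ≤ lam ^ n := one_le_pow₀ h.one_le
    rw [hwn, map_smul, norm_smul, Real.norm_of_nonneg (by linarith)]
    exact le_mul_of_one_le_left (norm_nonneg _) h3
  rw [prj_apply, sub_eq_zero] at hprj
  have hne : ht w ≠ 0 := by
    intro h0
    rw [h0, zero_smul] at hprj
    exact hv0 (funext fun j => Subtype.ext (congrFun hprj j))
  have halg : ∀ j, IsAlgebraic ℚ (w j) := fun j => mem_algebraicClosure_iff.1 (v j).2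
  have hht : IsAlgebraic ℚ (ht w) := by
    have : ht w ∈ A := by
      rw [ht_apply]; exact sum_mem fun j _ => (v j).2
    exact mem_algebraicClosure_iff.1 this
  have hxi : x i = (ht w)⁻¹ * w i := by
    conv_rhs => rw [hprj]
    rw [Pi.smul_apply, smul_eq_mul, map_smul, h.ht_x, smul_eq_mul, mul_one, inv_mul_cancel_left₀ hne]
  rw [IsFractionRing.isAlgebraic_iff ℤ ℚ ℝ, hxi]
  exact hht.inv.mul (halg i)

end Algebraic

/-! ### Seed points among periodic points -/

namespace ExtendedCFA

variable {d : ℕ} {K : ExtendedCFA d} {x : K.X} {p : ℕ}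

theorem isSeed_iff (hd : 1 ≤ d) (hp : 1 ≤ p) (hx : K.F^[p] x = x) {lam : ℝ}
    (h : IsPerron (K.matProd x p) x.1 lam) : K.IsSeed x ↔
    (∀ n < p, ContinuousAt (K.F^[n + 1]) x) ∧ Contracts (K.matProd x p) x.1 ∧
      ∃ f, IsLeft (K.matProd x p) x.1 lam f ∧ AllCoincide (morphComp (K.images x p)) f := by
  constructor
  · rintro ⟨-, h2, h3, h4⟩
    have hc := contracts_of_limsup hd hp hx h3
    exact ⟨(continuousAt_all_iff hp hx).1 h2, hc, (exists_interior_iff hd hx h hc).1 h4⟩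
  · rintro ⟨h2, hc, h4⟩
    exact ⟨linearIndependent_of_contracts h hc, (continuousAt_all_iff hp hx).2 h2,
      limsup_of_contracts hd hp hx h hc, (exists_interior_iff hd hx h hc).2 h4⟩

theorem exists_isPointCode (hd : 1 ≤ d) (hx : K.IsPeriodic x) (hs : K.IsSeed x) :
    ∃ c : PointCode d, IsPointCode c x.1 := by
  obtain ⟨p, hp, hx⟩ := hx
  obtain ⟨lam, h⟩ := isPerron hx
  obtain ⟨-, hc, -⟩ := (isSeed_iff hd hp hx h).1 hs
  choose c hc using fun i => exists_isAlgCode (h.isAlgebraic hc i)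
  exact ⟨c, hc⟩

end ExtendedCFA

/-! ### Following the orbit and assembling the decision procedure -/

section Algorithm

variable {d : ℕ}

/-- The condition that all branches agree, in integers: `W` lists the images of the letters along
the orbit, `L` the branches of the iterates. -/
def BranchesAgree (W : List (Letter d → List (Letter d)))
    (L : List (List (Letter d → Letter d → ℤ))) : Prop :=
  ∀ k < L.length, ∀ B ∈ L.getD k [],
    Matrix.of B * morphMatrix (morphComp (W.drop (k + 1))) * morphMatrix (morphComp W) =
      morphMatrix (morphComp W) * (Matrix.of B * morphMatrix (morphComp (W.drop (k + 1))))

theorem primrecPred_branchesAgree : PrimrecPred fun p : List (Letter d → List (Letter d)) ×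
    List (List (Letter d → Letter d → ℤ)) => BranchesAgree p.1 p.2 := by
  refine .forall_lt' (Primrec.list_length.comp Primrec.snd) (.forall_mem
    ((Primrec.list_getD []).comp (Primrec.snd.comp Primrec.fst) Primrec.snd) ?_)
  have hM := Primrec.morphMatrix (Primrec.morphComp (α := ((List (Letter d → List (Letter d)) ×
    List (List (Letter d → Letter d → ℤ))) × ℕ) × (Letter d → Letter d → ℤ))
    (Primrec.fst.comp (Primrec.fst.comp Primrec.fst)))
  have hR := Primrec.morphMatrix (Primrec.morphComp (α := ((List (Letter d → List (Letter d)) ×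
    List (List (Letter d → Letter d → ℤ))) × ℕ) × (Letter d → Letter d → ℤ))
    (Primrec.list_drop.comp (Primrec.succ.comp (Primrec.snd.comp Primrec.fst))
      (Primrec.fst.comp (Primrec.fst.comp Primrec.fst))))
  have hB : ∀ i j, Primrec fun p : ((List (Letter d → List (Letter d)) ×
      List (List (Letter d → Letter d → ℤ))) × ℕ) × (Letter d → Letter d → ℤ) => p.2 i j :=
    fun i j => Primrec.pi_iff.1 (Primrec.pi_iff.1 Primrec.snd i) j
  have hA := Primrec.matrix_mul (A := fun p : ((List (Letter d → List (Letter d)) ×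
    List (List (Letter d → Letter d → ℤ))) × ℕ) × (Letter d → Letter d → ℤ) => Matrix.of p.2) hB hR
  refine (PrimrecPred.forall_fin fun i => .forall_fin fun j =>
    .eq (Primrec.matrix_mul hA hM i j) (Primrec.matrix_mul hM hA i j)).of_eq fun p => ?_
  exact Matrix.ext_iff

/-- The data gathered along an orbit. -/
abbrev OrbitData (d : ℕ) : Type :=
  PointCode d × List (Letter d → List (Letter d)) × List (List (Letter d → Letter d → ℤ))

/-- Follow an orbit, given the algorithms for the map and for the branches. -/
def follow (f : PointCode d →. (Letter d → List (Letter d)) × PointCode d)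
    (b : PointCode d × ℕ →. List (Letter d → Letter d → ℤ)) (q : PointCode d × ℕ) :
    Part (OrbitData d) :=
  q.2.rec (Part.some (q.1, [], [])) fun n IH => IH.bind fun st => (f st.1).bind fun r =>
    (b (q.1, n + 1)).map fun B => (r.2, st.2.1 ++ [r.1], st.2.2 ++ [B])

theorem partrec_follow {f : PointCode d →. (Letter d → List (Letter d)) × PointCode d}
    {b : PointCode d × ℕ →. List (Letter d → Letter d → ℤ)} (hf : Partrec f) (hb : Partrec b) :
    Partrec (follow f b) := by
  refine Partrec.nat_rec (h := fun (q : PointCode d × ℕ) (y : ℕ × OrbitData d) =>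
    (f y.2.1).bind fun r => (b (q.1, y.1 + 1)).map fun B =>
      (r.2, y.2.2.1 ++ [r.1], y.2.2.2 ++ [B])) Computable.snd ?_ ?_
  · exact (Computable.pair Computable.fst (Computable.const ([], []))).partrec
  · refine Partrec.bind (hf.comp (Primrec.fst.comp (Primrec.snd.comp Primrec.snd)).to_comp) ?_
    refine Partrec.map (hb.comp (Primrec.pair ?_ ?_).to_comp) ?_
    · exact Primrec.fst.comp (Primrec.fst.comp Primrec.fst)
    · exact Primrec.succ.comp (Primrec.fst.comp (Primrec.snd.comp Primrec.fst))
    · refine Primrec₂.to_comp (Primrec.pair ?_ (Primrec.pair ?_ ?_))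
      · exact Primrec.snd.comp (Primrec.snd.comp Primrec.fst)
      · refine Primrec.list_concat.comp ?_ ?_
        · exact Primrec.fst.comp (Primrec.snd.comp (Primrec.snd.comp (Primrec.snd.comp
            (Primrec.fst.comp Primrec.fst))))
        · exact Primrec.fst.comp (Primrec.snd.comp Primrec.fst)
      · refine Primrec.list_concat.comp ?_ Primrec.snd
        exact Primrec.snd.comp (Primrec.snd.comp (Primrec.snd.comp (Primrec.snd.comp
            (Primrec.fst.comp Primrec.fst))))

namespace ExtendedCFA

variable {K : ExtendedCFA d}

/-- The invariant of the loop. The code moves along the orbit, whereas branches are always requested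
at the starting point; entry `k` concerns `F^(k + 1)`. -/
theorem exists_mem_follow {f : PointCode d →. (Letter d → List (Letter d)) × PointCode d}
    {b : PointCode d × ℕ →. List (Letter d → Letter d → ℤ)}
    (hf : ∀ (x : K.X) (c : PointCode d), IsPointCode c x.1 →
      ∃ r ∈ f c, r.1 = (K.s₀ x).image ∧ IsPointCode r.2 (K.F x).1)
    (hb : ∀ (x : K.X) (c : PointCode d) (n : ℕ), IsPointCode c x.1 →
      ∃ L ∈ b (c, n), ∀ M : Letter d → Letter d → ℤ, M ∈ L ↔ K.IsBranch n x (Matrix.of M))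
    {x : K.X} {c : PointCode d} (hc : IsPointCode c x.1) (n : ℕ) :
    ∃ st ∈ follow f b (c, n), IsPointCode st.1 (K.F^[n] x).1 ∧ st.2.1 = K.images x n ∧
      st.2.2.length = n ∧ ∀ k < n, ∀ B, B ∈ st.2.2.getD k [] ↔ K.IsBranch (k + 1) x (Matrix.of B) := by
  induction n with
  | zero => exact ⟨(c, [], []), Part.mem_some _, hc, by simp [images], rfl, by simp⟩
  | succ n ih =>
    obtain ⟨st, hst, h1, h2, h3, h4⟩ := ih
    obtain ⟨r, hr, hr1, hr2⟩ := hf _ _ h1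
    obtain ⟨L, hL, hL1⟩ := hb x c (n + 1) hc
    refine ⟨(r.2, st.2.1 ++ [r.1], st.2.2 ++ [L]), ?_, ?_, ?_, ?_, ?_⟩
    · exact Part.mem_bind hst (Part.mem_bind hr (Part.mem_map _ hL))
    · rw [iterate_succ]; exact hr2
    · rw [images_succ, h2, hr1]; rfl
    · simp [h3]
    · intro k hk B
      rcases Nat.lt_succ_iff_lt_or_eq.1 hk with hk | rfl
      · rw [← h4 k hk B, List.getD_append _ _ _ _ (by omega)]
      · rw [← hL1 B, List.getD_append_right _ _ _ _ (by omega)]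
        simp [h3]

end ExtendedCFA

open Classical in
/-- The decision procedure. -/
noncomputable def decideSeed (f : PointCode d →. (Letter d → List (Letter d)) × PointCode d)
    (b : PointCode d × ℕ →. List (Letter d → Letter d → ℤ))
    (G : (Letter d → List (Letter d)) →. Bool) (c : PointCode d) : Part Bool :=
  (Nat.rfind fun m => (follow f b (c, m + 1)).map fun st => decide (st.1 = c)).bind fun m =>
    (follow f b (c, m + 1)).bind fun st =>
      bif decide (BranchesAgree st.2.1 st.2.2) then G (morphComp st.2.1) else Part.some false

theorem partrec_decideSeed {f : PointCode d →. (Letter d → List (Letter d)) × PointCode d}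
    {b : PointCode d × ℕ →. List (Letter d → Letter d → ℤ)}
    {G : (Letter d → List (Letter d)) →. Bool} (hf : Partrec f) (hb : Partrec b)
    (hG : Partrec G) : Partrec (decideSeed f b G) := by
  classical
  have hrun := partrec_follow hf hb
  refine Partrec.bind (Partrec.rfind (p := fun c m => (follow f b (c, m + 1)).map fun st =>
    decide (st.1 = c)) ?_) ?_
  · refine Partrec.map (hrun.comp (Primrec.pair Primrec.fst (Primrec.succ.comp Primrec.snd)).to_comp)
      (Primrec₂.to_comp ?_)
    exact (PrimrecPred.eq (Primrec.fst.comp Primrec.snd)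
      (Primrec.fst.comp Primrec.fst)).decide
  · refine Partrec.bind (hrun.comp (Primrec.pair Primrec.fst
      (Primrec.succ.comp Primrec.snd)).to_comp) ?_
    refine Partrec.cond ?_ (hG.comp ?_) (Computable.const false).partrec
    · exact (primrecPred_branchesAgree.comp (Primrec.snd.comp Primrec.snd)).decide.to_comp
    · exact (Primrec.morphComp (Primrec.fst.comp (Primrec.snd.comp Primrec.snd))).to_comp

end Algorithm

theorem mainTheorem6 (d : ℕ) (hd : 1 ≤ d) (K : ExtendedCFA d) (hF : K.IsComputable) :
    (∀ x : K.X, K.IsPeriodic x → K.IsSeed x → ∃ c : PointCode d, IsPointCode c x.1) ∧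
    ∃ g : PointCode d →. Bool, Partrec g ∧
      ∀ (x : K.X) (c : PointCode d), K.IsPeriodic x → IsPointCode c x.1 →
        ∃ b ∈ g c, (b = true ↔ K.IsSeed x) := by
  classical
  refine ⟨fun x => ExtendedCFA.exists_isPointCode hd, ?_⟩
  obtain ⟨⟨f, hf, hf'⟩, b, hb, hb'⟩ := hF
  obtain ⟨G, hG, hG'⟩ := exists_decider hd
  refine ⟨decideSeed f b G, partrec_decideSeed hf hb hG, fun x c ⟨p, hp, hx⟩ hc => ?_⟩
  have hrun := fun n => K.exists_mem_follow hf' hb' hc n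
  have hdom : (Nat.rfind fun m => (follow f b (c, m + 1)).map fun st => decide (st.1 = c)).Dom := by
    refine Nat.rfind_dom.2 ?_
    obtain ⟨st, hst, h1, -⟩ := hrun p
    refine ⟨p - 1, Part.mem_map_iff _ |>.2 ⟨st, ?_, ?_⟩, fun {m} _ => ?_⟩
    · rwa [Nat.sub_add_cancel hp]
    · rw [hx] at h1
      -- Uniqueness of codes guarantees that the return to `x` is detected.
      exact decide_eq_true (funext fun i => (h1 i).unique (hc i))
    · obtain ⟨st, hst, -⟩ := hrun (m + 1)
      exact Part.dom_iff_mem.2 ⟨_, Part.mem_map _ hst⟩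
  obtain ⟨m, hm⟩ := Part.dom_iff_mem.1 hdom
  obtain ⟨st, hst, h1, h2, h3, h4⟩ := hrun (m + 1)
  have hper : K.F^[m + 1] x = x := by
    obtain ⟨st', hst', h5⟩ := (Part.mem_map_iff _).1 (Nat.rfind_spec hm)
    obtain rfl := Part.mem_unique hst hst'
    have h6 : st.1 = c := of_decide_eq_true h5
    rw [h6] at h1
    -- Conversely equal codes mean equal points, so `m + 1` is a true period.
    exact Subtype.ext (funext fun i => (h1 i).injective (hc i))
  obtain ⟨lam, h⟩ := ExtendedCFA.isPerron hper
  have hseed := ExtendedCFA.isSeed_iff hd (by omega) hper h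
  -- The commutation test is equivalent to continuity only under contraction. This is enough:
  -- without contraction `x` is not a seed point, and the procedure answers false whatever the test
  -- says.
  have hagree : Contracts (K.matProd x (m + 1)) x.1 → (BranchesAgree st.2.1 st.2.2 ↔
      ∀ n < m + 1, ContinuousAt (K.F^[n + 1]) x) := by
    intro hcon
    unfold BranchesAgree
    rw [h3, h2]
    refine forall_congr' fun n => imp_congr_right fun hn => ?_
    rw [ExtendedCFA.continuousAt_iff_commute hper h hcon (by omega)]
    exact forall_congr' fun B => imp_congr_left (h4 n hn B)
  obtain ⟨r, hr, hr'⟩ := hG' (morphComp (K.images x (m + 1))) x.1 lam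
    (by rwa [K.morphMatrix_images])
  rw [K.morphMatrix_images] at hr'
  by_cases hB : BranchesAgree st.2.1 st.2.2
  · refine ⟨r, Part.mem_bind hm (Part.mem_bind hst ?_), ?_⟩
    · rw [decide_eq_true hB, h2]; exact hr
    · rw [hseed, hr']
      exact ⟨fun h5 => ⟨(hagree h5.1).1 hB, h5⟩, fun h5 => h5.2⟩
  · refine ⟨false, Part.mem_bind hm (Part.mem_bind hst ?_), ?_⟩
    · rw [decide_eq_false hB]; exact Part.mem_some _
    · rw [hseed]
      simp only [Bool.false_eq_true, false_iff]
      exact fun h5 => hB ((hagree h5.2.1).2 h5.1)
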